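/- We use a deterministic random access machine with three memories, of natural numbers, of real numbers and of vectors of a real normed space $V$. Integer operations (addition, truncated subtraction, halving, comparison, indirect addressing), real operations ($+,-,\cdot,/$, comparison, conversion of a natural number to a real) and control steps take one unit of time; adding, scaling or copying vectors and computing a distance $\|x-y\|$ take $d\ge 1$ units each, and vectors can be accessed in no other way. A program is a finite text that may depend on $\alpha$ and $k$ but not on $V$, its norm, $d$, or the input. Let $\log^{(k)}n$ be the $k$-times iterated logarithm, read as $1$ where it is undefined or less than $1$. Theorem. Let $0<\alpha\le\frac12$ and $k\in\mathbb N$. There are constants $C\ge 1$ and $K>0$, depending only on $\alpha$ and $k$, and a program with the following property for every real normed space $V$, all integers $n,d\ge1$, all points $a_1,\dots,a_n\in V$ and every $r\ge 0$. On input $n,\alpha,r,a_1,\dots,a_n$ the program halts after at most $K\,n\,d\,\log^{(k)}n$ units of time with a vector $q\in V$; and if some closed ball of radius $r$ in $V$ contains at least $\alpha n$ of the points (counted with multiplicity), then the closed ball of radius $Cr$ around $q$ contains at least $\alpha n$ of the points. With the same constants, there is also such a program for the weighted problem: on input $n,\alpha,r,a_1,\dots,a_n$ and weights $w_1,\dots,w_n\ge0$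 with $w=\sum_i w_i>0$ it halts after at most $K\,n\,d\,\log^{(k)}n$ units of time with a vector $q$; and if some closed ball of radius $r$ contains points of total weight at least $\alpha w$, then the closed ball of radius $Cr$ around $q$ contains points of total weight at least $\alpha w$. -/

import Mathlib

universe u

/-!
A random access machine over a normed space: one memory of natural numbers (used for counters and
addresses), one memory of real numbers, and one memory of vectors.  Integer, real and control
operations cost one unit; every operation that reads, writes, adds or scales a vector, or that
evaluates a distance, costs `d` units.  Vectors can only be accessed through these operations.
Programs are finite texts that do not mention the space, its norm, `d` or the number of points.
-/

namespace VecRAM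

/-- The memory of the machine; all three memories are indexed by natural numbers. -/
structure State (V : Type*) where
  nat : ℕ → ℕ
  real : ℕ → ℝ
  vec : ℕ → V

/-- Integer expressions. `cell a` is the content of the integer cell with address `a`. There is
no multiplication of integers at unit cost. -/
inductive NExp where
  | lit (c : ℕ)
  | cell (a : NExp)
  | add (x y : NExp)
  | sub (x y : NExp)
  | half (x : NExp)

/-- Real expressions. The only real constants are natural numbers; `dist a b` is the distance of
the vectors in the vector cells `a` and `b`. -/
inductive RExp where
  | ofNat (x : NExp)
  | cell (a : NExp)
  | add (x y : RExp)
  | sub (x y : RExp)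
  | mul (x y : RExp)
  | div (x y : RExp)
  | dist (a b : NExp)

/-- Vector expressions. -/
inductive VExp where
  | cell (a : NExp)
  | add (x y : VExp)
  | smul (c : RExp) (x : VExp)

/-- Tests. -/
inductive BExp where
  | natLT (x y : NExp)
  | realLE (x y : RExp)
  | neg (b : BExp)
  | conj (b c : BExp)

/-- Programs. The first argument of an assignment is the address of the cell that is written. -/
inductive Cmd where
  | skip
  | setNat (a : NExp) (e : NExp)
  | setReal (a : NExp) (e : RExp)
  | setVec (a : NExp) (e : VExp)
  | seq (p q : Cmd)
  | cond (b : BExp) (p q : Cmd)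
  | loop (b : BExp) (p : Cmd)

/-- Value of an integer expression (subtraction is truncated at zero). -/
def NExp.eval (m : ℕ → ℕ) : NExp → ℕ
  | .lit c => c
  | .cell a => m (a.eval m)
  | .add x y => x.eval m + y.eval m
  | .sub x y => x.eval m - y.eval m
  | .half x => x.eval m / 2

def NExp.cost : NExp → ℕ
  | .lit _ => 1
  | .cell a => a.cost + 1
  | .add x y => x.cost + y.cost + 1
  | .sub x y => x.cost + y.cost + 1
  | .half x => x.cost + 1

section Semantics

variable {V : Type*} [NormedAddCommGroup V] [NormedSpace ℝ V]

/-- Value of a real expression (division by zero gives zero). -/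
noncomputable def RExp.eval (s : State V) : RExp → ℝ
  | .ofNat x => (x.eval s.nat : ℝ)
  | .cell a => s.real (a.eval s.nat)
  | .add x y => x.eval s + y.eval s
  | .sub x y => x.eval s - y.eval s
  | .mul x y => x.eval s * y.eval s
  | .div x y => x.eval s / y.eval s
  | .dist a b => ‖s.vec (a.eval s.nat) - s.vec (b.eval s.nat)‖

def RExp.cost (d : ℕ) : RExp → ℕ
  | .ofNat x => x.cost + 1
  | .cell a => a.cost + 1
  | .add x y => x.cost d + y.cost d + 1
  | .sub x y => x.cost d + y.cost d + 1
  | .mul x y => x.cost d + y.cost d + 1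
  | .div x y => x.cost d + y.cost d + 1
  | .dist a b => a.cost + b.cost + d

noncomputable def VExp.eval (s : State V) : VExp → V
  | .cell a => s.vec (a.eval s.nat)
  | .add x y => x.eval s + y.eval s
  | .smul c x => c.eval s • x.eval s

def VExp.cost (d : ℕ) : VExp → ℕ
  | .cell a => a.cost + d
  | .add x y => x.cost d + y.cost d + d
  | .smul c x => c.cost d + x.cost d + d

/-- Truth of a test. -/
def BExp.Holds (s : State V) : BExp → Prop
  | .natLT x y => x.eval s.nat < y.eval s.nat
  | .realLE x y => x.eval s ≤ y.eval s
  | .neg b => ¬ b.Holds s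
  | .conj b c => b.Holds s ∧ c.Holds s

def BExp.cost (d : ℕ) : BExp → ℕ
  | .natLT x y => x.cost + y.cost + 1
  | .realLE x y => x.cost d + y.cost d + 1
  | .neg b => b.cost d + 1
  | .conj b c => b.cost d + c.cost d + 1

/-- `Exec d p s t s'`: when vector operations cost `d`, the program `p`, started in the state `s`,
halts in the state `s'` after exactly `t` units of time. -/
inductive Exec (d : ℕ) : Cmd → State V → ℕ → State V → Prop where
  | skip (s : State V) : Exec d .skip s 1 s
  | setNat (a e : NExp) (s : State V) :
      Exec d (.setNat a e) s (a.cost + e.cost + 1)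
        { s with nat := Function.update s.nat (a.eval s.nat) (e.eval s.nat) }
  | setReal (a : NExp) (e : RExp) (s : State V) :
      Exec d (.setReal a e) s (a.cost + e.cost d + 1)
        { s with real := Function.update s.real (a.eval s.nat) (e.eval s) }
  | setVec (a : NExp) (e : VExp) (s : State V) :
      Exec d (.setVec a e) s (a.cost + e.cost d + d)
        { s with vec := Function.update s.vec (a.eval s.nat) (e.eval s) }
  | seq {p q : Cmd} {s s' s'' : State V} {t t' : ℕ} :
      Exec d p s t s' → Exec d q s' t' s'' → Exec d (.seq p q) s (t + t') s''
  | condTrue {b : BExp} {p q : Cmd} {s s' : State V} {t : ℕ} :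
      b.Holds s → Exec d p s t s' → Exec d (.cond b p q) s (b.cost d + t + 1) s'
  | condFalse {b : BExp} {p q : Cmd} {s s' : State V} {t : ℕ} :
      ¬ b.Holds s → Exec d q s t s' → Exec d (.cond b p q) s (b.cost d + t + 1) s'
  | loopDone {b : BExp} {p : Cmd} {s : State V} :
      ¬ b.Holds s → Exec d (.loop b p) s (b.cost d + 1) s
  | loopStep {b : BExp} {p : Cmd} {s s' s'' : State V} {t t' : ℕ} :
      b.Holds s → Exec d p s t s' → Exec d (.loop b p) s' t' s'' →
        Exec d (.loop b p) s (b.cost d + t + 1 + t') s''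

/-- The machine is deterministic: the initial state determines the running time and the result. -/
theorem Exec.deterministic {d : ℕ} {p : Cmd} {s s₁ : State V} {t₁ : ℕ} (h : Exec d p s t₁ s₁) :
    ∀ {s₂ : State V} {t₂ : ℕ}, Exec d p s t₂ s₂ → t₁ = t₂ ∧ s₁ = s₂ := by
  induction h with
  | skip => intro _ _ h; cases h; exact ⟨rfl, rfl⟩
  | setNat => intro _ _ h; cases h; exact ⟨rfl, rfl⟩
  | setReal => intro _ _ h; cases h; exact ⟨rfl, rfl⟩
  | setVec => intro _ _ h; cases h; exact ⟨rfl, rfl⟩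
  | seq _ _ ih ih' =>
    intro _ _ h
    cases h with
    | seq h h' =>
      obtain ⟨rfl, rfl⟩ := ih h
      obtain ⟨rfl, rfl⟩ := ih' h'
      exact ⟨rfl, rfl⟩
  | condTrue hb _ ih =>
    intro _ _ h
    cases h with
    | condTrue _ h => obtain ⟨rfl, rfl⟩ := ih h; exact ⟨rfl, rfl⟩
    | condFalse hb' _ => exact absurd hb hb'
  | condFalse hb _ ih =>
    intro _ _ h
    cases h with
    | condTrue hb' _ => exact absurd hb' hb
    | condFalse _ h => obtain ⟨rfl, rfl⟩ := ih h; exact ⟨rfl, rfl⟩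
  | loopDone hb =>
    intro _ _ h
    cases h with
    | loopDone _ => exact ⟨rfl, rfl⟩
    | loopStep hb' _ _ => exact absurd hb' hb
  | loopStep hb _ _ ih ih' =>
    intro _ _ h
    cases h with
    | loopDone hb' => exact absurd hb hb'
    | loopStep _ h h' =>
      obtain ⟨rfl, rfl⟩ := ih h
      obtain ⟨rfl, rfl⟩ := ih' h'
      exact ⟨rfl, rfl⟩

/-- The initial memory of the unweighted problem: the integer cell `0` holds the number `n` of
points, the real cells `0` and `1` hold `r` and `α`, the vector cells `0, …, n - 1` hold the
points, and every other cell holds zero. -/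
noncomputable def input (α r : ℝ) {n : ℕ} (a : Fin n → V) : State V where
  nat i := if i = 0 then n else 0
  real i := if i = 0 then r else if i = 1 then α else 0
  vec i := if h : i < n then a ⟨i, h⟩ else 0

/-- The initial memory of the weighted problem: as for the unweighted one, with the weights in the
real cells `2, …, n + 1`. -/
noncomputable def weightedInput (α r : ℝ) {n : ℕ} (a : Fin n → V) (w : Fin n → ℝ) : State V where
  nat i := if i = 0 then n else 0
  real i := if i = 0 then r else if i = 1 then α else if h : i - 2 < n then w ⟨i - 2, h⟩ else 0
  vec i := if h : i < n then a ⟨i, h⟩ else 0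

/-- The number of points (with multiplicity) in the closed ball with centre `p` and radius `ρ`. -/
noncomputable def ballCount {n : ℕ} (a : Fin n → V) (p : V) (ρ : ℝ) : ℕ :=
  (Finset.univ.filter fun i => ‖a i - p‖ ≤ ρ).card

/-- The total weight of the points in the closed ball with centre `p` and radius `ρ`. -/
noncomputable def ballWeight {n : ℕ} (a : Fin n → V) (w : Fin n → ℝ) (p : V) (ρ : ℝ) : ℝ :=
  ∑ i ∈ Finset.univ.filter (fun i => ‖a i - p‖ ≤ ρ), w i

end Semantics

/-- The program `P` solves 1-center clustering with outliers, with fraction `α` and approximation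
constant `C`, in every real normed space, in time at most `T n d` for `n` points when vector
operations cost `d`. The program halts in time on every input; the answer, which is left in the
vector cell `0`, matters only if some ball of radius `r` contains at least `α n` of the points. -/
def Solves (P : Cmd) (α C : ℝ) (T : ℕ → ℕ → ℝ) : Prop :=
  ∀ (V : Type u) [NormedAddCommGroup V] [NormedSpace ℝ V] (d n : ℕ), 1 ≤ d → 1 ≤ n →
    ∀ (a : Fin n → V) (r : ℝ), 0 ≤ r →
      ∃ (t : ℕ) (s : State V), Exec d P (input α r a) t s ∧ (t : ℝ) ≤ T n d ∧
        ((∃ p : V, α * n ≤ ballCount a p r) → α * n ≤ ballCount a (s.vec 0) (C * r))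

/-- The analogue of `Solves` for the weighted problem: the points carry nonnegative weights, not
all zero, and numbers of points are replaced by total weights. -/
def SolvesWeighted (P : Cmd) (α C : ℝ) (T : ℕ → ℕ → ℝ) : Prop :=
  ∀ (V : Type u) [NormedAddCommGroup V] [NormedSpace ℝ V] (d n : ℕ), 1 ≤ d → 1 ≤ n →
    ∀ (a : Fin n → V) (w : Fin n → ℝ) (r : ℝ), (∀ i, 0 ≤ w i) → 0 < ∑ i, w i → 0 ≤ r →
      ∃ (t : ℕ) (s : State V), Exec d P (weightedInput α r a w) t s ∧ (t : ℝ) ≤ T n d ∧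
        ((∃ p : V, α * ∑ i, w i ≤ ballWeight a w p r) →
          α * ∑ i, w i ≤ ballWeight a w (s.vec 0) (C * r))

/-- The `k`-th iterated logarithm, replaced by `1` where it is undefined or less than `1`. -/
noncomputable def iterLog : ℕ → ℝ → ℝ
  | 0, x => max 1 x
  | k + 1, x => max 1 (Real.log (iterLog k x))

end VecRAM

/-!
The unweighted problem is the weighted one with all weights equal to `1`. The weighted problem is
solved in stages. In a stage the points are divided into blocks; for each block a program `baseP`
computes at most `L` centres such that every ball that contains the fraction `3 / L` of the weight
of the block has a centre in its vicinity. Then the centres replace the block: the weight of a point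
moves to a centre nearby, if there is one. Thus a ball whose radius is enlarged by the constant
`8 * 100 ^ L + 2` loses at most the fraction `3 / L` of the total weight (`stageP_run`). For `L`
large compared with `k / α`, something remains after `k + 1` stages, so that one of the remaining
points is close to the centre of the given ball; the best one is found by trying all of them
(`chooseP_run`).

The centres of a block of `B` points are found in time `B` times a power of `log B`. Let `p` be a
prime of the order of `(log B) ^ 2`, and let `z` run through the vectors of length `m` over the
field with `p` elements, where `p ^ m` is slightly larger than `L * B`. The graph in which `z` is
joined to all `z + y • (1, x, x ^ 2, …)` has degree `p ^ 2` only, but nearly all of its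
neighbourhoods sample every set of vertices well (`moment_sampler`): a nontrivial character is
trivial on fewer than `m` of the `p` lines, because `m` points of the moment curve span the space.
Every vertex receives a point of the block, in proportion to the weights (`card_slots_ge`), and
afterwards keeps a list of at most `L` centres. In every round, each vertex collects the centres of
its neighbours and forms new ones from them, which only requires the distances of a
polylogarithmic number of vectors. If a ball contains many points, then most vertices know a centre
near the ball after the first round, and in every further round the fraction of vertices that know
none is halved, until it vanishes (`near_of_rounds`). The errors do not add up over
logarithmically many rounds because a new centre is the average of a cluster: if nearly all members
of the cluster are within the distance `e` of a point, then so is the average, up to a factor close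
to `1` (`Grouped.norm_suppMean_sub_le`); here the linear structure of the space is used. A vertex
does not know which of its centres are good, and clusters could merge; therefore shorter lists are
allowed a coarser accuracy, and the scale of the clusters is chosen such that they are separated
(`Picked.spec`, `StepAt.spec`).

Write `ℓ i` for the `i`-fold iterated binary length of the number `n` of points. The stages are
numbered `k + 1, …, 1`. Stage `i` has blocks of size `2 ^ (22 * ℓ i)`, so its running time per point
is of the order of `ℓ i ^ 22`; for the first stage, this is at most a constant times the
`k`-th iterated logarithm (`exists_sz_pow_le_iterLog`). A block of at least `ℓ (i - 1) ^ 22` points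
becomes at most `L` points, which makes up for the factor `ℓ (i - 1) ^ 22` in the running time of
the next stage (`stage_card`, `stage_time`). After stage `1` the number of points is bounded.

The memories of the machine are divided into arrays, called classes. Class `1` holds the points and
weights of the input, class `2` the current points and weights (their number in `na 2 0`), `ra 3 0`
the radius, `na 4 0` the block size, class `5` the points and weights for the next stage, and `6`
and `7` the start, the length and the weight of the current block. The classes from `10` on belong
to `baseP`: `11` the prime and the degree, `12` the length of the vectors, `13` the number of
vertices, `14` the number of rounds, `15` the powers of the prime, `16` the accuracies, `17` the
round, `18` and `20` its factors of accuracy, `19` and `21` the old and the new lists, `22` the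
current vertex, `23` its neighbours, `24` to `27` the centres collected from these, `28` and `29`
the radius and size of a cluster, `30` and `31` the scale, `32` and `33` the new centres.
-/

namespace VecRAM

/-! ### Memory layout and expressions -/

/-- The memory cell with class `c` and index `i`: every memory is split into infinitely many
arrays, one for each class.  The cell `0` belongs to no class. -/
def adr (c i : ℕ) : ℕ := 2 ^ c * (2 * i + 1)

theorem adr_inj {c i c' i' : ℕ} : adr c i = adr c' i' ↔ c = c' ∧ i = i' := by
  refine ⟨?_, fun h => by rw [h.1, h.2]⟩
  induction c generalizing c' with
  | zero =>
    cases c' with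
    | zero => simp only [adr, pow_zero, one_mul, true_and]; omega
    | succ c' =>
      have : 2 ^ (c' + 1) * (2 * i' + 1) = 2 * (2 ^ c' * (2 * i' + 1)) := by ring
      simp only [adr, pow_zero]; omega
  | succ c ih =>
    cases c' with
    | zero =>
      have : 2 ^ (c + 1) * (2 * i + 1) = 2 * (2 ^ c * (2 * i + 1)) := by ring
      simp only [adr, pow_zero]; omega
    | succ c' =>
      intro h
      have : adr c i = adr c' i' := by
        have h1 : 2 ^ (c + 1) * (2 * i + 1) = 2 * (2 ^ c * (2 * i + 1)) := by ring
        have h2 : 2 ^ (c' + 1) * (2 * i' + 1) = 2 * (2 ^ c' * (2 * i' + 1)) := by ring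
        simp only [adr] at h ⊢; omega
      have := ih this
      omega

theorem adr_ne_zero (c i : ℕ) : adr c i ≠ 0 := by simp [adr]

/-- The integer expression for the address of the cell with class `c` and index `e`. -/
def adrE : ℕ → NExp → NExp
  | 0, e => .add (.add e e) (.lit 1)
  | c + 1, e => .add (adrE c e) (adrE c e)

theorem adrE_eval (m : ℕ → ℕ) (c : ℕ) (e : NExp) : (adrE c e).eval m = adr c (e.eval m) := by
  induction c with
  | zero => simp only [adrE, NExp.eval, adr]; ring
  | succ c ih => simp only [adrE, NExp.eval, ih, adr, pow_succ]; ring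

instance : Add NExp := ⟨.add⟩
instance : Sub NExp := ⟨.sub⟩
instance (n : ℕ) : OfNat NExp n := ⟨.lit n⟩
instance : Add RExp := ⟨.add⟩
instance : Sub RExp := ⟨.sub⟩
instance : Mul RExp := ⟨.mul⟩
instance : Div RExp := ⟨.div⟩
instance : Add VExp := ⟨.add⟩

/-- The content of the integer cell with class `c` and index `e`. -/
def na (c : ℕ) (e : NExp) : NExp := .cell (adrE c e)
/-- The content of the real cell with class `c` and index `e`. -/
def ra (c : ℕ) (e : NExp) : RExp := .cell (adrE c e)
/-- The content of the vector cell with class `c` and index `e`. -/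
def va (c : ℕ) (e : NExp) : VExp := .cell (adrE c e)
/-- The distance of two vector cells, given by class and index. -/
def ds (c : ℕ) (e : NExp) (c' : ℕ) (e' : NExp) : RExp := .dist (adrE c e) (adrE c' e')
/-- A natural number as a real expression. -/
def rn (e : NExp) : RExp := .ofNat e
/-- The product of an integer expression with a fixed number. -/
def mulE : ℕ → NExp → NExp
  | 0, _ => 0
  | k + 1, e => mulE k e + e

/-- Assignment to the integer cell with class `c` and index `i`. -/
def setn (c : ℕ) (i e : NExp) : Cmd := .setNat (adrE c i) e
/-- Assignment to the real cell with class `c` and index `i`. -/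
def setr (c : ℕ) (i : NExp) (e : RExp) : Cmd := .setReal (adrE c i) e
/-- Assignment to the vector cell with class `c` and index `i`. -/
def setv (c : ℕ) (i : NExp) (e : VExp) : Cmd := .setVec (adrE c i) e
/-- The test for equality of integers. -/
def eqE (x y : NExp) : BExp := .conj (.neg (.natLT x y)) (.neg (.natLT y x))

infixr:60 " ;; " => Cmd.seq

@[simp] theorem NExp.eval_add (m : ℕ → ℕ) (x y : NExp) :
    (x + y).eval m = x.eval m + y.eval m := rfl
@[simp] theorem NExp.eval_sub (m : ℕ → ℕ) (x y : NExp) :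
    (x - y).eval m = x.eval m - y.eval m := rfl
@[simp] theorem NExp.eval_zero (m : ℕ → ℕ) : NExp.eval m 0 = 0 := rfl
@[simp] theorem NExp.eval_one (m : ℕ → ℕ) : NExp.eval m 1 = 1 := rfl
@[simp] theorem NExp.eval_two (m : ℕ → ℕ) : NExp.eval m 2 = 2 := rfl
@[simp] theorem NExp.eval_ofNat (m : ℕ → ℕ) (n : ℕ) :
    NExp.eval m (no_index (OfNat.ofNat n)) = (OfNat.ofNat n : ℕ) := rfl
@[simp] theorem NExp.eval_half (m : ℕ → ℕ) (x : NExp) :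
    (NExp.half x).eval m = x.eval m / 2 := rfl
@[simp] theorem NExp.eval_lit (m : ℕ → ℕ) (n : ℕ) : (NExp.lit n).eval m = n := rfl
@[simp] theorem mulE_eval (m : ℕ → ℕ) (k : ℕ) (x : NExp) :
    (mulE k x).eval m = k * x.eval m := by
  induction k with
  | zero => simp [mulE]
  | succ k ih => simp [mulE, ih]; ring

namespace State
variable {V : Type*}

/-- The integer with class `c` and index `i`. -/
def N (s : State V) (c i : ℕ) : ℕ := s.nat (adr c i)
/-- The real number with class `c` and index `i`. -/
def R (s : State V) (c i : ℕ) : ℝ := s.real (adr c i)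
/-- The vector with class `c` and index `i`. -/
def X (s : State V) (c i : ℕ) : V := s.vec (adr c i)
/-- The state after an assignment to an integer cell. -/
def setN (s : State V) (c i v : ℕ) : State V :=
  { s with nat := Function.update s.nat (adr c i) v }
/-- The state after an assignment to a real cell. -/
def setR (s : State V) (c i : ℕ) (v : ℝ) : State V :=
  { s with real := Function.update s.real (adr c i) v }
/-- The state after an assignment to a vector cell. -/
def setX (s : State V) (c i : ℕ) (v : V) : State V :=
  { s with vec := Function.update s.vec (adr c i) v }

variable (s : State V) (c i c' i' n : ℕ) (r : ℝ) (v : V)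

@[simp] theorem N_setN : (s.setN c i n).N c' i' = if c' = c ∧ i' = i then n else s.N c' i' := by
  simp [N, setN, Function.update_apply, adr_inj]
@[simp] theorem R_setN : (s.setN c i n).R c' i' = s.R c' i' := rfl
@[simp] theorem X_setN : (s.setN c i n).X c' i' = s.X c' i' := rfl
@[simp] theorem N_setR : (s.setR c i r).N c' i' = s.N c' i' := rfl
@[simp] theorem R_setR : (s.setR c i r).R c' i' = if c' = c ∧ i' = i then r else s.R c' i' := by
  simp [R, setR, Function.update_apply, adr_inj]
@[simp] theorem X_setR : (s.setR c i r).X c' i' = s.X c' i' := rfl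
@[simp] theorem N_setX : (s.setX c i v).N c' i' = s.N c' i' := rfl
@[simp] theorem R_setX : (s.setX c i v).R c' i' = s.R c' i' := rfl
@[simp] theorem X_setX : (s.setX c i v).X c' i' = if c' = c ∧ i' = i then v else s.X c' i' := by
  simp [X, setX, Function.update_apply, adr_inj]

@[simp] theorem R_setN_fun : (s.setN c i n).R c' = s.R c' := rfl
@[simp] theorem X_setN_fun : (s.setN c i n).X c' = s.X c' := rfl
@[simp] theorem N_setR_fun : (s.setR c i r).N c' = s.N c' := rfl
@[simp] theorem X_setR_fun : (s.setR c i r).X c' = s.X c' := rfl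
@[simp] theorem N_setX_fun : (s.setX c i v).N c' = s.N c' := rfl
@[simp] theorem R_setX_fun : (s.setX c i v).R c' = s.R c' := rfl
@[simp] theorem N_setN_fun (h : c' ≠ c) : (s.setN c i n).N c' = s.N c' := by ext; simp [h]
@[simp] theorem R_setR_fun (h : c' ≠ c) : (s.setR c i r).R c' = s.R c' := by ext; simp [h]
@[simp] theorem X_setX_fun (h : c' ≠ c) : (s.setX c i v).X c' = s.X c' := by ext; simp [h]

/-- Two states agree on the classes below `k` and on the integer cell `0` and the real cell `0`. -/
structure Frame (k : ℕ) (s s' : State V) : Prop where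
  n : ∀ c < k, ∀ i, s'.N c i = s.N c i
  r : ∀ c < k, ∀ i, s'.R c i = s.R c i
  x : ∀ c < k, ∀ i, s'.X c i = s.X c i
  n0 : s'.nat 0 = s.nat 0
  r0 : s'.real 0 = s.real 0

variable {s}

@[refl, simp] theorem Frame.refl (k : ℕ) (s : State V) : Frame k s s :=
  ⟨by simp, by simp, by simp, rfl, rfl⟩

theorem Frame.trans {k : ℕ} {s s' s'' : State V} (h : Frame k s s') (h' : Frame k s' s'') :
    Frame k s s'' :=
  ⟨fun c hc i => (h'.n c hc i).trans (h.n c hc i), fun c hc i => (h'.r c hc i).trans (h.r c hc i),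
    fun c hc i => (h'.x c hc i).trans (h.x c hc i), h'.n0.trans h.n0, h'.r0.trans h.r0⟩

theorem Frame.mono {k l : ℕ} {s s' : State V} (h : Frame l s s') (hk : k ≤ l) : Frame k s s' :=
  ⟨fun c hc => h.n c (hc.trans_le hk), fun c hc => h.r c (hc.trans_le hk),
    fun c hc => h.x c (hc.trans_le hk), h.n0, h.r0⟩

theorem Frame.symm {k : ℕ} {s s' : State V} (h : Frame k s s') : Frame k s' s :=
  ⟨fun c hc i => (h.n c hc i).symm, fun c hc i => (h.r c hc i).symm,
    fun c hc i => (h.x c hc i).symm, h.n0.symm, h.r0.symm⟩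

theorem Frame.n_fun {k : ℕ} {s s' : State V} (h : Frame k s s') {c : ℕ} (hc : c < k) :
    s'.N c = s.N c := funext (h.n c hc)
theorem Frame.r_fun {k : ℕ} {s s' : State V} (h : Frame k s s') {c : ℕ} (hc : c < k) :
    s'.R c = s.R c := funext (h.r c hc)
theorem Frame.x_fun {k : ℕ} {s s' : State V} (h : Frame k s s') {c : ℕ} (hc : c < k) :
    s'.X c = s.X c := funext (h.x c hc)

theorem frame_setN_self {k c : ℕ} (s : State V) (i n : ℕ) (hc : k ≤ c) :
    Frame k s (s.setN c i n) := by
  refine ⟨fun c' h j => ?_, fun _ _ _ => rfl, fun _ _ _ => rfl, ?_, rfl⟩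
  · rw [N_setN, if_neg]; omega
  · simp [setN, (adr_ne_zero c i).symm]

theorem frame_setR_self {k c : ℕ} (s : State V) (i : ℕ) (r : ℝ) (hc : k ≤ c) :
    Frame k s (s.setR c i r) := by
  refine ⟨fun _ _ _ => rfl, fun c' h j => ?_, fun _ _ _ => rfl, rfl, ?_⟩
  · rw [R_setR, if_neg]; omega
  · simp [setR, (adr_ne_zero c i).symm]

theorem frame_setX_self {k c : ℕ} (s : State V) (i : ℕ) (v : V) (hc : k ≤ c) :
    Frame k s (s.setX c i v) := by
  refine ⟨fun _ _ _ => rfl, fun _ _ _ => rfl, fun c' h j => ?_, rfl, rfl⟩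
  rw [X_setX, if_neg]; omega

theorem Frame.iff_of_frame {k : ℕ} {s t t' : State V} (h : Frame k t t') :
    Frame k s t' ↔ Frame k s t := ⟨fun h' => h'.trans h.symm, fun h' => h'.trans h⟩

@[simp] theorem frame_setN {k c : ℕ} (s s' : State V) (i n : ℕ) (hc : k ≤ c) :
    Frame k s (s'.setN c i n) ↔ Frame k s s' := (frame_setN_self s' i n hc).iff_of_frame
@[simp] theorem frame_setR {k c : ℕ} (s s' : State V) (i : ℕ) (r : ℝ) (hc : k ≤ c) :
    Frame k s (s'.setR c i r) ↔ Frame k s s' := (frame_setR_self s' i r hc).iff_of_frame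
@[simp] theorem frame_setX {k c : ℕ} (s s' : State V) (i : ℕ) (v : V) (hc : k ≤ c) :
    Frame k s (s'.setX c i v) ↔ Frame k s s' := (frame_setX_self s' i v hc).iff_of_frame

@[simp] theorem setN_nat_zero : (s.setN c i n).nat 0 = s.nat 0 :=
  (frame_setN_self (k := c) s i n le_rfl).n0
@[simp] theorem setR_nat : (s.setR c i r).nat = s.nat := rfl
@[simp] theorem setX_nat : (s.setX c i v).nat = s.nat := rfl
@[simp] theorem setR_real_zero : (s.setR c i r).real 0 = s.real 0 :=
  (frame_setR_self (k := c) s i r le_rfl).r0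
@[simp] theorem setN_real : (s.setN c i n).real = s.real := rfl
@[simp] theorem setX_real : (s.setX c i v).real = s.real := rfl

end State

open State

section
variable {V : Type*} (s : State V)
@[simp] theorem na_eval (c : ℕ) (e : NExp) : (na c e).eval s.nat = s.N c (e.eval s.nat) := by
  simp [na, NExp.eval, adrE_eval, State.N]
end

section
variable {V : Type*} [NormedAddCommGroup V] (s : State V)

@[simp] theorem RExp.eval_add (x y : RExp) : (x + y).eval s = x.eval s + y.eval s := rfl
@[simp] theorem RExp.eval_sub (x y : RExp) : (x - y).eval s = x.eval s - y.eval s := rfl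
@[simp] theorem RExp.eval_mul (x y : RExp) : (x * y).eval s = x.eval s * y.eval s := rfl
@[simp] theorem RExp.eval_div (x y : RExp) : (x / y).eval s = x.eval s / y.eval s := rfl
@[simp] theorem rn_eval (e : NExp) : (rn e).eval s = (e.eval s.nat : ℝ) := rfl
@[simp] theorem ra_eval (c : ℕ) (e : NExp) : (ra c e).eval s = s.R c (e.eval s.nat) := by
  simp [ra, RExp.eval, adrE_eval, State.R]
@[simp] theorem ds_eval (c c' : ℕ) (e e' : NExp) : (ds c e c' e').eval s =
    ‖s.X c (e.eval s.nat) - s.X c' (e'.eval s.nat)‖ := by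
  simp [ds, RExp.eval, adrE_eval, State.X]

@[simp] theorem holds_natLT (x y : NExp) :
    (BExp.natLT x y).Holds s ↔ x.eval s.nat < y.eval s.nat := Iff.rfl
@[simp] theorem holds_realLE (x y : RExp) :
    (BExp.realLE x y).Holds s ↔ x.eval s ≤ y.eval s := Iff.rfl
@[simp] theorem holds_neg (b : BExp) : (BExp.neg b).Holds s ↔ ¬ b.Holds s := Iff.rfl
@[simp] theorem holds_conj (b c : BExp) :
    (BExp.conj b c).Holds s ↔ b.Holds s ∧ c.Holds s := Iff.rfl
@[simp] theorem holds_eqE (x y : NExp) : (eqE x y).Holds s ↔ x.eval s.nat = y.eval s.nat := by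
  simp only [eqE, holds_conj, holds_neg, holds_natLT]; omega

end

section
variable {V : Type*} [NormedAddCommGroup V] [NormedSpace ℝ V] (s : State V)

@[simp] theorem VExp.eval_add (x y : VExp) : (x + y).eval s = x.eval s + y.eval s := rfl
@[simp] theorem VExp.eval_smul (c : RExp) (x : VExp) :
    (VExp.smul c x).eval s = c.eval s • x.eval s := rfl
@[simp] theorem va_eval (c : ℕ) (e : NExp) : (va c e).eval s = s.X c (e.eval s.nat) := by
  simp [va, VExp.eval, adrE_eval, State.X]
/-! ### Running time and correctness of programs -/

/-- A constant that depends on the text of a program only: the number of operations in the text,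
doubled for every surrounding loop, since a loop with `A` rounds evaluates its test `A + 1 ≤ 2 * A`
times. Running times are bounded by this constant times the product of the bounds for the numbers of
rounds of nested loops. -/
def kk : Cmd → ℕ
  | .skip => 1
  | .setNat a e => a.cost + e.cost + 1
  | .setReal a e => a.cost + e.cost 1 + 1
  | .setVec a e => a.cost + e.cost 1 + 1
  | .seq p q => kk p + kk q
  | .cond b p q => b.cost 1 + kk p + kk q + 1
  | .loop b p => 2 * (kk p + (b.cost 1 + 1))

/-- Started in the state `s`, the program `p` halts within `B * d` units of time, up to the constant
`kk p`, in a state that satisfies `Q`. -/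
def Run (d : ℕ) (p : Cmd) (s : State V) (B : ℕ) (Q : State V → Prop) : Prop :=
  ∃ (t : ℕ) (s' : State V), Exec d p s t s' ∧ t ≤ kk p * B * d ∧ Q s'

/-- The weakest precondition of a program without loops; it fails for programs with loops. -/
def wp : Cmd → State V → (State V → Prop) → Prop
  | .skip, s, Q => Q s
  | .setNat a e, s, Q => Q { s with nat := Function.update s.nat (a.eval s.nat) (e.eval s.nat) }
  | .setReal a e, s, Q => Q { s with real := Function.update s.real (a.eval s.nat) (e.eval s) }
  | .setVec a e, s, Q => Q { s with vec := Function.update s.vec (a.eval s.nat) (e.eval s) }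
  | .seq p q, s, Q => wp p s fun s' => wp q s' Q
  | .cond b p q, s, Q => (b.Holds s → wp p s Q) ∧ (¬ b.Holds s → wp q s Q)
  | .loop _ _, _, _ => False

theorem RExp.cost_le {d : ℕ} (hd : 1 ≤ d) (e : RExp) : e.cost d ≤ e.cost 1 * d := by
  induction e <;> simp only [RExp.cost] <;> nlinarith

theorem VExp.cost_le {d : ℕ} (hd : 1 ≤ d) (e : VExp) : e.cost d ≤ e.cost 1 * d := by
  induction e with
  | cell a => simp only [VExp.cost]; nlinarith
  | add x y hx hy => simp only [VExp.cost]; nlinarith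
  | smul c x hx => simp only [VExp.cost]; nlinarith [c.cost_le hd]

theorem BExp.cost_le {d : ℕ} (hd : 1 ≤ d) (e : BExp) : e.cost d ≤ e.cost 1 * d := by
  induction e with
  | natLT x y => simp only [BExp.cost]; nlinarith
  | realLE x y => simp only [BExp.cost]; nlinarith [x.cost_le hd, y.cost_le hd]
  | neg b hb => simp only [BExp.cost]; nlinarith
  | conj b c hb hc => simp only [BExp.cost]; nlinarith

variable {s} {d : ℕ}

theorem Run.mono {p : Cmd} {B B' : ℕ} {Q Q' : State V → Prop} (h : Run d p s B Q) (hB : B ≤ B')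
    (hQ : ∀ s', Q s' → Q' s') : Run d p s B' Q' := by
  obtain ⟨t, s', h1, h2, h3⟩ := h
  exact ⟨t, s', h1, h2.trans (by gcongr), hQ _ h3⟩

/-- Programs without loops. -/
theorem Run.of_wp (hd : 1 ≤ d) {B : ℕ} (hB : 1 ≤ B) {p : Cmd} {Q : State V → Prop}
    (h : wp p s Q) : Run d p s B Q := by
  suffices Run d p s 1 Q from this.mono hB fun _ h => h
  clear hB
  induction p generalizing s Q with
  | skip => exact ⟨_, _, .skip s, by simpa [kk] using hd, h⟩
  | setNat a e => exact ⟨_, _, .setNat a e s, by simp only [kk]; nlinarith, h⟩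
  | setReal a e =>
    exact ⟨_, _, .setReal a e s, by simp only [kk]; nlinarith [e.cost_le hd], h⟩
  | setVec a e =>
    exact ⟨_, _, .setVec a e s, by simp only [kk]; nlinarith [e.cost_le hd], h⟩
  | seq p q hp hq =>
    obtain ⟨t, s', h1, h2, h3⟩ := hp h
    obtain ⟨t', s'', h4, h5, h6⟩ := hq h3
    exact ⟨_, _, .seq h1 h4, by simp only [kk]; nlinarith, h6⟩
  | cond b p q hp hq =>
    have hb := b.cost_le hd
    by_cases hc : b.Holds s
    · obtain ⟨t, s', h1, h2, h3⟩ := hp (h.1 hc)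
      refine ⟨_, _, .condTrue hc h1, ?_, h3⟩
      simp only [kk]; nlinarith [Nat.zero_le (kk q * d)]
    · obtain ⟨t, s', h1, h2, h3⟩ := hq (h.2 hc)
      refine ⟨_, _, .condFalse hc h1, ?_, h3⟩
      simp only [kk]; nlinarith [Nat.zero_le (kk p * d)]
  | loop b p => exact h.elim

theorem Run.seq {p q : Cmd} {B : ℕ} {Q : State V → Prop}
    (h : Run d p s B fun s' => Run d q s' B Q) : Run d (p ;; q) s B Q := by
  obtain ⟨t, s', h1, h2, t', s'', h4, h5, h6⟩ := h
  exact ⟨_, _, .seq h1 h4, by simp only [kk]; nlinarith, h6⟩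

/-- A program without loops followed by an arbitrary program. -/
theorem Run.wp_seq (hd : 1 ≤ d) {p q : Cmd} {B : ℕ} (hB : 1 ≤ B) {Q : State V → Prop}
    (h : wp p s fun s' => Run d q s' B Q) : Run d (p ;; q) s B Q :=
  Run.seq (Run.of_wp hd hB h)

/-- A program with a known specification followed by an arbitrary program. -/
theorem Run.then {p q : Cmd} {B B' : ℕ} {P Q : State V → Prop} (h : Run d p s B' P) (hB : B' ≤ B)
    (h' : ∀ s', P s' → Run d q s' B Q) : Run d (p ;; q) s B Q :=
  Run.seq (h.mono hB h')

theorem Run.cond (hd : 1 ≤ d) {b : BExp} {p q : Cmd} {B : ℕ} (hB : 1 ≤ B) {Q : State V → Prop}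
    (h : b.Holds s → Run d p s B Q) (h' : ¬ b.Holds s → Run d q s B Q) :
    Run d (.cond b p q) s B Q := by
  have hb := b.cost_le hd
  have h1 : b.cost 1 * d ≤ b.cost 1 * (B * d) := Nat.mul_le_mul_left _ (by nlinarith)
  have h0 : 1 ≤ B * d := Nat.one_le_iff_ne_zero.2 (by positivity)
  by_cases hc : b.Holds s
  · obtain ⟨t, s', h1, h2, h3⟩ := h hc
    exact ⟨_, _, .condTrue hc h1, by simp only [kk]; nlinarith [Nat.zero_le (kk q * B * d)], h3⟩
  · obtain ⟨t, s', h1, h2, h3⟩ := h' hc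
    exact ⟨_, _, .condFalse hc h1, by simp only [kk]; nlinarith [Nat.zero_le (kk p * B * d)], h3⟩

/-- Loops: `I` is an invariant, `μ` decreases in every round, and `B` bounds the running time of the
body. -/
theorem Run.loop (hd : 1 ≤ d) {b : BExp} {p : Cmd} {A B C : ℕ} (hA : 1 ≤ A) (hB : 1 ≤ B)
    {Q : State V → Prop} (I : State V → Prop) (μ : State V → ℕ) (h0 : I s) (hμ : μ s ≤ A)
    (hC : A * B ≤ C)
    (hs : ∀ s, I s → b.Holds s → Run d p s B fun s' => I s' ∧ μ s' < μ s)
    (hQ : ∀ s', I s' → ¬ b.Holds s' → Q s') :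
    Run d (.loop b p) s C Q := by
  have hb := b.cost_le hd
  suffices h : ∃ (t : ℕ) (s' : State V), Exec d (.loop b p) s t s' ∧
      t ≤ (μ s + 1) * ((kk p * B + (b.cost 1 + 1)) * d) ∧ Q s' by
    obtain ⟨t, s', h1, h2, h3⟩ := h
    refine ⟨t, s', h1, h2.trans ?_, h3⟩
    calc (μ s + 1) * ((kk p * B + (b.cost 1 + 1)) * d)
        ≤ (2 * A) * ((kk p * B + (b.cost 1 + 1) * B) * d) := by
          apply Nat.mul_le_mul (by omega)
          gcongr
          exact Nat.le_mul_of_pos_right _ hB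
      _ = 2 * (kk p + (b.cost 1 + 1)) * (A * B) * d := by ring
      _ ≤ _ := by simp only [kk]; gcongr
  clear hμ
  induction hm : μ s using Nat.strong_induction_on generalizing s with
  | _ m ih =>
    by_cases hc : b.Holds s
    · obtain ⟨t, s', h1, h2, h3, h4⟩ := hs s h0 hc
      obtain ⟨t', s'', h5, h6, h7⟩ := ih _ (hm ▸ h4) h3 rfl
      refine ⟨_, _, .loopStep hc h1 h5, ?_, h7⟩
      have h8 : (μ s' + 1) * ((kk p * B + (b.cost 1 + 1)) * d) ≤
          m * ((kk p * B + (b.cost 1 + 1)) * d) := Nat.mul_le_mul_right _ (by omega)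
      nlinarith
    · refine ⟨_, _, .loopDone hc, ?_, hQ _ h0 hc⟩
      have h8 : 1 * ((b.cost 1 + 1) * d) ≤ (m + 1) * ((kk p * B + (b.cost 1 + 1)) * d) := by
        exact Nat.mul_le_mul (by omega) (Nat.mul_le_mul_right _ (Nat.le_add_left _ _))
      nlinarith

/-- `for v := 0, …, e - 1 do p`; the counter is the cell with class `v` and index `0`. -/
def forC (v : ℕ) (e : NExp) (p : Cmd) : Cmd :=
  setn v 0 0 ;; .loop (.natLT (na v 0) e) (p ;; setn v 0 (na v 0 + 1))

@[simp] theorem wp_setn (c : ℕ) (i e : NExp) (Q : State V → Prop) :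
    wp (setn c i e) s Q = Q (s.setN c (i.eval s.nat) (e.eval s.nat)) := by
  simp [wp, setn, State.setN, adrE_eval]
@[simp] theorem wp_setr (c : ℕ) (i : NExp) (e : RExp) (Q : State V → Prop) :
    wp (setr c i e) s Q = Q (s.setR c (i.eval s.nat) (e.eval s)) := by
  simp [wp, setr, State.setR, adrE_eval]
@[simp] theorem wp_setv (c : ℕ) (i : NExp) (e : VExp) (Q : State V → Prop) :
    wp (setv c i e) s Q = Q (s.setX c (i.eval s.nat) (e.eval s)) := by
  simp [wp, setv, State.setX, adrE_eval]
@[simp] theorem wp_seq (p q : Cmd) (Q : State V → Prop) :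
    wp (p ;; q) s Q = wp p s fun s' => wp q s' Q := rfl
@[simp] theorem wp_cond (b : BExp) (p q : Cmd) (Q : State V → Prop) :
    wp (.cond b p q) s Q = ((b.Holds s → wp p s Q) ∧ (¬ b.Holds s → wp q s Q)) := rfl
@[simp] theorem wp_skip (Q : State V → Prop) : wp .skip s Q = Q s := rfl

/-- Counting loops: `I j` is the invariant before round `j`. -/
theorem Run.forC (hd : 1 ≤ d) {v : ℕ} {e : NExp} {p : Cmd} (n : ℕ) {A B C : ℕ} (hA : 1 ≤ A)
    (hB : 1 ≤ B) (hn : n ≤ A) (hC : A * B ≤ C) {Q : State V → Prop}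
    (I : ℕ → State V → Prop) (h0 : I 0 (s.setN v 0 0))
    (hv : ∀ j s', j ≤ n → I j s' → s'.N v 0 = j ∧ e.eval s'.nat = n)
    (hs : ∀ j s', j < n → I j s' →
      Run d p s' B fun s'' => s''.N v 0 = j ∧ I (j + 1) (s''.setN v 0 (j + 1)))
    (hQ : ∀ s', I n s' → Q s') :
    Run d (forC v e p) s C Q := by
  have hC1 : 1 ≤ C := (Nat.one_le_iff_ne_zero.2 (by positivity)).trans hC
  have hμ : n - (s.setN v 0 0).N v 0 ≤ A := by simpa using hn
  have key := Run.loop (s := s.setN v 0 0) hd (b := .natLT (na v 0) e)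
    (p := p ;; setn v 0 (na v 0 + 1)) hA hB (Q := Q)
    (fun s' => ∃ j ≤ n, I j s') (fun s' => n - s'.N v 0) ⟨0, by simp, h0⟩ hμ hC ?_ ?_
  · exact Run.wp_seq hd hC1 (p := setn v 0 0) (by simpa using key)
  · rintro s' ⟨j, hj, hI⟩ hb
    obtain ⟨h1, h2⟩ := hv j s' hj hI
    simp only [holds_natLT, na_eval, NExp.eval_zero, h1, h2] at hb
    refine (hs j s' hb hI).then le_rfl fun s'' h => Run.of_wp hd hB ?_
    simp only [wp_setn, NExp.eval_zero, NExp.eval_one, NExp.eval_add, na_eval, h.1]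
    refine ⟨⟨j + 1, hb, h.2⟩, ?_⟩
    simp [h1]; omega
  · rintro s' ⟨j, hj, hI⟩ hb
    obtain ⟨h1, h2⟩ := hv j s' hj hI
    simp only [holds_natLT, na_eval, NExp.eval_zero, h1, h2] at hb
    obtain rfl : j = n := by omega
    exact hQ _ hI

end

/-! ### Expanding graphs of polylogarithmic degree -/

section Fourier

open Finset Complex ComplexConjugate

variable {G : Type*} [AddCommGroup G] [Fintype G]

/-- Parseval's identity. -/
theorem sum_norm_sq_fourier (f : G → ℂ) :
    ∑ ψ : AddChar G ℂ, ‖∑ z, f z * ψ z‖ ^ 2 = Fintype.card G * ∑ z, ‖f z‖ ^ 2 := by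
  classical
  have h1 : ∀ ψ : AddChar G ℂ, ((‖∑ z, f z * ψ z‖ ^ 2 : ℝ) : ℂ) =
      ∑ z, ∑ w, f z * conj (f w) * ψ (z - w) := by
    intro ψ
    rw [← Complex.normSq_eq_norm_sq, ← Complex.mul_conj, map_sum, Finset.sum_mul_sum]
    refine Finset.sum_congr rfl fun z _ => Finset.sum_congr rfl fun w _ => ?_
    rw [sub_eq_add_neg, AddChar.map_add_eq_mul, AddChar.map_neg_eq_conj, map_mul]
    ring
  have h2 : ((∑ ψ : AddChar G ℂ, ‖∑ z, f z * ψ z‖ ^ 2 : ℝ) : ℂ) =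
      ((Fintype.card G * ∑ z, ‖f z‖ ^ 2 : ℝ) : ℂ) := by
    rw [Complex.ofReal_sum]
    simp_rw [h1]
    rw [Finset.sum_comm]
    push_cast
    rw [Finset.mul_sum]
    refine Finset.sum_congr rfl fun z _ => ?_
    rw [Finset.sum_comm]
    simp_rw [← Finset.mul_sum, AddChar.sum_apply_eq_ite, sub_eq_zero]
    simp only [mul_ite, mul_zero, Finset.sum_ite_eq, Finset.mem_univ, if_true]
    rw [Complex.mul_conj, Complex.normSq_eq_norm_sq]
    push_cast
    ring
  exact_mod_cast h2

/-- A Cayley graph all of whose nontrivial character sums are at most `M` contracts functions with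
mean zero. -/
theorem sum_norm_sq_cayley_le {Q : Type*} [Fintype Q] (σ : Q → G) (f : G → ℂ) (hf : ∑ z, f z = 0)
    {M : ℝ} (hM : ∀ ψ : AddChar G ℂ, ψ ≠ 0 → ‖∑ q, ψ (-σ q)‖ ≤ M) :
    ∑ z, ‖∑ q, f (z + σ q)‖ ^ 2 ≤ M ^ 2 * ∑ z, ‖f z‖ ^ 2 := by
  have h1 : ∀ ψ : AddChar G ℂ, ∑ z, (∑ q, f (z + σ q)) * ψ z =
      (∑ q, ψ (-σ q)) * ∑ z, f z * ψ z := by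
    intro ψ
    simp_rw [Finset.sum_mul]
    rw [Finset.sum_comm]
    refine Finset.sum_congr rfl fun q _ => ?_
    rw [Finset.mul_sum, ← Equiv.sum_comp (Equiv.addRight (-σ q)) (fun z => f (z + σ q) * ψ z)]
    refine Finset.sum_congr rfl fun z _ => ?_
    simp only [Equiv.coe_addRight, neg_add_cancel_right, AddChar.map_add_eq_mul]
    ring
  have h2 : ∑ ψ : AddChar G ℂ, ‖∑ z, (∑ q, f (z + σ q)) * ψ z‖ ^ 2 ≤
      ∑ ψ : AddChar G ℂ, M ^ 2 * ‖∑ z, f z * ψ z‖ ^ 2 := by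
    refine Finset.sum_le_sum fun ψ _ => ?_
    rw [h1, norm_mul, mul_pow]
    by_cases hψ : ψ = 0
    · subst hψ; simp [hf]
    · have := hM ψ hψ
      gcongr
  rw [← Finset.mul_sum, sum_norm_sq_fourier, sum_norm_sq_fourier] at h2
  have hG : (0 : ℝ) < Fintype.card G := by exact_mod_cast Fintype.card_pos
  nlinarith

end Fourier

section Lines

open Finset

variable {p m : ℕ} [Fact p.Prime]

/-- The points of the moment curve. -/
def moment (m : ℕ) (x : ZMod p) : Fin m → ZMod p := fun j => x ^ (j : ℕ)

/-- A nontrivial character is trivial on fewer than `m` of the lines through the moment curve,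
since any `m` points of the curve span the space. -/
theorem card_lines_lt (ψ : AddChar (Fin m → ZMod p) ℂ) (hψ : ψ ≠ 0) :
    #{x : ZMod p | ∀ y : ZMod p, ψ (y • moment m x) = 1} < m := by
  by_contra! h
  obtain ⟨S, hS, hcard⟩ := Finset.exists_subset_card_eq h
  let e : Fin m ≃ S := (S.equivFinOfCardEq hcard).symm
  have hv : Function.Injective fun i => (e i : ZMod p) :=
    Subtype.val_injective.comp e.injective
  have hA : IsUnit (Matrix.vandermonde fun i => (e i : ZMod p)) := by
    rw [Matrix.isUnit_iff_isUnit_det, isUnit_iff_ne_zero]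
    exact Matrix.det_vandermonde_ne_zero_iff.2 hv
  refine hψ (AddChar.eq_zero_iff.2 fun g => ?_)
  obtain ⟨c, hc⟩ := Matrix.vecMul_surjective_iff_isUnit.2 hA g
  have hg : g = ∑ i, c i • moment m (e i : ZMod p) := by
    rw [← hc]
    ext j
    simp [Matrix.vecMul, dotProduct, Matrix.vandermonde_apply, moment, Finset.sum_apply]
  rw [hg]
  refine Finset.sum_induction _ (fun g => ψ g = 1)
    (fun a b ha hb => by rw [AddChar.map_add_eq_mul, ha, hb, one_mul]) ψ.map_zero_eq_one
    fun i _ => ?_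
  have := hS (e i).2
  simp only [Finset.mem_filter, Finset.mem_univ, true_and] at this
  exact this _

theorem norm_sum_lines_le (ψ : AddChar (Fin m → ZMod p) ℂ) (hψ : ψ ≠ 0) :
    ‖∑ q : ZMod p × ZMod p, ψ (-(q.2 • moment m q.1))‖ ≤ p * m := by
  classical
  rw [Fintype.sum_prod_type]
  have h : ∀ x : ZMod p, ∑ y : ZMod p, ψ (-(y • moment m x)) =
      if ∀ y : ZMod p, ψ (y • moment m x) = 1 then (p : ℂ) else 0 := by
    intro x
    let φ : AddChar (ZMod p) ℂ :=
      { toFun := fun y => ψ (-(y • moment m x))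
        map_zero_eq_one' := by simp
        map_add_eq_mul' := fun a b => by
          rw [add_smul, neg_add, AddChar.map_add_eq_mul] }
    have h1 := AddChar.sum_eq_ite φ
    have h2 : φ = 0 ↔ ∀ y : ZMod p, ψ (y • moment m x) = 1 := by
      rw [AddChar.eq_zero_iff]
      constructor
      · intro h y; simpa [φ] using h (-y)
      · intro h y; simpa [φ] using h (-y)
    rw [ZMod.card] at h1
    simp only [h2] at h1
    exact h1
  rw [Finset.sum_congr rfl fun x _ => h x, ← Finset.sum_filter, Finset.sum_const, nsmul_eq_mul,
    norm_mul, Complex.norm_natCast, Complex.norm_natCast, mul_comm]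
  gcongr
  exact (card_lines_lt ψ hψ).le

/-- Every set is sampled well by the neighbourhoods of the graph in which `z` is joined to all
`z + y • moment m x`. -/
theorem moment_sampler (B : Finset (Fin m → ZMod p)) :
    ∑ z : Fin m → ZMod p, ((#{q : ZMod p × ZMod p | z + q.2 • moment m q.1 ∈ B} : ℝ) -
      p ^ 2 * (#B / p ^ m)) ^ 2 ≤ (p * m) ^ 2 * #B := by
  classical
  set δ : ℝ := #B / p ^ m with hδ
  have hp : (0 : ℝ) < p ^ m := by have := (Fact.out : p.Prime).pos; positivity
  let f : (Fin m → ZMod p) → ℂ := fun z => (((if z ∈ B then 1 else 0) - δ : ℝ) : ℂ)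
  have hcard : (Fintype.card (Fin m → ZMod p) : ℝ) = p ^ m := by simp [ZMod.card]
  have hsum : ∑ z, ((if z ∈ B then (1 : ℝ) else 0) - δ) = 0 := by
    rw [Finset.sum_sub_distrib, Finset.sum_const, Finset.card_univ, nsmul_eq_mul, hcard, hδ]
    field_simp
    simp
  have key := sum_norm_sq_cayley_le (fun q : ZMod p × ZMod p => q.2 • moment m q.1) f
    (by simp only [f]; exact_mod_cast hsum) (M := p * m) (norm_sum_lines_le)
  have h1 : ∀ z, ‖∑ q : ZMod p × ZMod p, f (z + q.2 • moment m q.1)‖ ^ 2 =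
      ((#{q : ZMod p × ZMod p | z + q.2 • moment m q.1 ∈ B} : ℝ) - p ^ 2 * δ) ^ 2 := by
    intro z
    simp only [f]
    rw [← Complex.ofReal_sum, Complex.norm_real, Real.norm_eq_abs, sq_abs,
      Finset.sum_sub_distrib, Finset.sum_const, Finset.card_univ, Fintype.card_prod, ZMod.card]
    simp [pow_two]
  have h2 : ∑ z, ‖f z‖ ^ 2 ≤ #B := by
    have : ∑ z, ‖f z‖ ^ 2 = ∑ z, ((if z ∈ B then (1 : ℝ) else 0) -
        δ * ((if z ∈ B then (1 : ℝ) else 0) - δ) - δ * (if z ∈ B then (1 : ℝ) else 0)) := by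
      refine Finset.sum_congr rfl fun z _ => ?_
      simp only [f, Complex.norm_real, Real.norm_eq_abs, sq_abs]
      split_ifs <;> ring
    rw [this, Finset.sum_sub_distrib, Finset.sum_sub_distrib, ← Finset.mul_sum, hsum,
      ← Finset.mul_sum]
    simp only [Finset.sum_ite_mem, Finset.univ_inter, Finset.sum_const, nsmul_eq_mul, mul_one]
    have : 0 ≤ δ * #B := by positivity
    linarith
  rw [Finset.sum_congr rfl fun z _ => h1 z] at key
  refine key.trans ?_
  gcongr

/-- In the graph on `0, …, N - 1` in which the neighbours of `z` are the `Γ z q` with `q < g`, every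
set is sampled well by most neighbourhoods: the mean square deviation of the density of the set in a
neighbourhood from its density among all vertices is small. -/
def IsSampler (N g : ℕ) (lam : ℝ) (Γ : ℕ → ℕ → ℕ) : Prop :=
  (∀ z < N, ∀ q < g, Γ z q < N) ∧ ∀ B ⊆ range N,
    ∑ z ∈ range N, ((#{q ∈ range g | Γ z q ∈ B} : ℝ) / g - #B / N) ^ 2 ≤ lam ^ 2 * #B

/-- The `j`-th digit of `z` in base `p`, the most significant one of `m` digits first. -/
def digit (p m z j : ℕ) : ℕ := z / p ^ (m - 1 - j) % p

theorem eq_of_digit_eq {p m z z' : ℕ} (hz : z < p ^ m) (hz' : z' < p ^ m)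
    (h : ∀ j < m, digit p m z j = digit p m z' j) : z = z' := by
  have : ∀ i ≤ m, z % p ^ i = z' % p ^ i := by
    intro i hi
    induction i with
    | zero => simp [Nat.mod_one]
    | succ i ih =>
      have h1 := h (m - 1 - i) (by omega)
      simp only [digit, show m - 1 - (m - 1 - i) = i by omega] at h1
      rw [Nat.mod_pow_succ, Nat.mod_pow_succ, ih (by omega), h1]
  simpa [Nat.mod_eq_of_lt hz, Nat.mod_eq_of_lt hz'] using this m le_rfl

/-- The graph of `moment_sampler`, whose vertices are represented by numbers below `p ^ m`. -/
theorem isSampler_of_digit {Γ : ℕ → ℕ → ℕ} (hΓ : ∀ z < p ^ m, ∀ q < p * p, Γ z q < p ^ m)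
    (hd : ∀ z < p ^ m, ∀ q < p * p, ∀ j < m,
      digit p m (Γ z q) j = (digit p m z j + (q % p) * (q / p) ^ j) % p) :
    IsSampler (p ^ m) (p * p) (m / p) Γ := by
  classical
  refine ⟨hΓ, fun B hB => ?_⟩
  have hp : 0 < p := (Fact.out : p.Prime).pos
  let dec : ℕ → Fin m → ZMod p := fun z j => (digit p m z j : ZMod p)
  have hinj : Set.InjOn dec (range (p ^ m)) := by
    intro z hz z' hz' h
    simp only [Finset.coe_range, Set.mem_Iio] at hz hz'
    refine eq_of_digit_eq hz hz' fun j hj => ?_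
    have h1 := congrFun h ⟨j, hj⟩
    simp only [dec, ZMod.natCast_eq_natCast_iff'] at h1
    simpa [digit, Nat.mod_mod] using h1
  have himg : (range (p ^ m)).image dec = univ := by
    apply Finset.eq_univ_of_card
    rw [Finset.card_image_of_injOn hinj]
    simp [ZMod.card]
  have hB' : #(B.image dec) = #B := Finset.card_image_of_injOn (hinj.mono (by exact_mod_cast hB))
  have key := moment_sampler (B.image dec)
  rw [hB', ← himg, Finset.sum_image hinj] at key
  have hcount : ∀ z < p ^ m,
      #{q : ZMod p × ZMod p | dec z + q.2 • moment m q.1 ∈ B.image dec} =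
        #{q ∈ range (p * p) | Γ z q ∈ B} := by
    intro z hz
    symm
    refine Finset.card_nbij' (fun q => (((q / p : ℕ) : ZMod p), ((q % p : ℕ) : ZMod p)))
      (fun q => q.1.val * p + q.2.val) ?_ ?_ ?_ ?_
    · intro q hq
      simp only [Finset.coe_filter, Finset.mem_range, Set.mem_ofPred_eq, Finset.mem_univ,
        true_and] at hq ⊢
      refine Finset.mem_image.2 ⟨_, hq.2, ?_⟩
      ext j
      simp [dec, hd z hz q hq.1 j j.2, moment]
    · intro q hq
      simp only [Finset.coe_filter, Finset.mem_range, Set.mem_ofPred_eq, Finset.mem_univ,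
        true_and] at hq ⊢
      have h1 := q.1.val_lt
      have h2 := q.2.val_lt
      have h3 : q.1.val * p + q.2.val < p * p := by nlinarith
      refine ⟨h3, ?_⟩
      obtain ⟨b, hb, hb'⟩ := Finset.mem_image.1 hq
      have : dec (Γ z (q.1.val * p + q.2.val)) = dec b := by
        rw [hb']
        ext j
        have h4 : (q.1.val * p + q.2.val) % p = q.2.val := by
          rw [Nat.mul_add_mod_self_right, Nat.mod_eq_of_lt h2]
        have h5 : (q.1.val * p + q.2.val) / p = q.1.val := by
          rw [mul_comm, Nat.mul_add_div hp, Nat.div_eq_of_lt h2, add_zero]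
        simp [dec, hd z hz _ h3 j j.2, moment, h4, h5]
      rw [hinj (by simpa using hΓ z hz _ h3) (by simpa using hB hb) this]
      exact hb
    · intro q hq
      simp only [Finset.coe_filter, Finset.mem_range, Set.mem_ofPred_eq] at hq
      have h1 : q / p < p := Nat.div_lt_of_lt_mul hq.1
      simp only [ZMod.val_natCast, Nat.mod_eq_of_lt h1, Nat.mod_mod]
      rw [mul_comm]; exact Nat.div_add_mod q p
    · intro q hq
      have h1 := q.1.val_lt
      have h2 := q.2.val_lt
      have h4 : (q.1.val * p + q.2.val) % p = q.2.val := by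
        rw [Nat.mul_add_mod_self_right, Nat.mod_eq_of_lt h2]
      have h5 : (q.1.val * p + q.2.val) / p = q.1.val := by
        rw [mul_comm, Nat.mul_add_div hp, Nat.div_eq_of_lt h2, add_zero]
      simp [h4, h5]
  have hp' : (0 : ℝ) < p := by exact_mod_cast hp
  have h1 : ∀ z ∈ range (p ^ m), ((#{q ∈ range (p * p) | Γ z q ∈ B} : ℝ) / (p * p : ℕ) -
      #B / (p ^ m : ℕ)) ^ 2 = (1 / p ^ 2 : ℝ) ^ 2 *
      ((#{q : ZMod p × ZMod p | dec z + q.2 • moment m q.1 ∈ B.image dec} : ℝ) -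
        p ^ 2 * (#B / p ^ m)) ^ 2 := by
    intro z hz
    rw [hcount z (Finset.mem_range.1 hz), ← mul_pow]
    congr 1
    push_cast
    field_simp
  rw [Finset.sum_congr rfl h1, ← Finset.mul_sum]
  calc (1 / p ^ 2 : ℝ) ^ 2 * _ ≤ (1 / p ^ 2 : ℝ) ^ 2 * ((p * m) ^ 2 * #B) := by gcongr
    _ = (m / p : ℝ) ^ 2 * #B := by field_simp

end Lines

/-! ### Choosing new centres among the centres of the neighbours -/

section Local

open Finset

open scoped Classical in
/-- The indices of the points that are within `2 * e` of the point `x k`. -/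
noncomputable def supp {V : Type*} [NormedAddCommGroup V] (x : ℕ → V) (κ : ℕ) (e : ℝ) (k : ℕ) :
    Finset ℕ := {k' ∈ range κ | ‖x k - x k'‖ ≤ 2 * e}

/-- The point `x k` is rich if at least `τ` points are close to it. -/
def Rich {V : Type*} [NormedAddCommGroup V] (x : ℕ → V) (κ : ℕ) (e τ : ℝ) (k : ℕ) : Prop :=
  k < κ ∧ τ ≤ #(supp x κ e k)

/-- A maximal `D`-separated family of rich points, given by its indices `ref 0, …, ref (c - 1)`. -/
structure Net {V : Type*} [NormedAddCommGroup V] (x : ℕ → V) (κ : ℕ) (e τ D : ℝ) (c : ℕ)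
    (ref : ℕ → ℕ) : Prop where
  rich : ∀ i < c, Rich x κ e τ (ref i)
  sep : ∀ i < c, ∀ j < c, i ≠ j → D < ‖x (ref i) - x (ref j)‖
  cover : ∀ k, Rich x κ e τ k → ∃ i < c, ‖x k - x (ref i)‖ ≤ D

/-- The outcome of the search for a scale: `lam` is the largest number up to `lam0` for which the
`D lam`-separated family has at least `lam` members. There is no family if no point is rich. -/
def Picked {V : Type*} [NormedAddCommGroup V] (x : ℕ → V) (κ : ℕ) (e τ : ℝ) (D : ℕ → ℝ)
    (lam0 c : ℕ) (ref : ℕ → ℕ) : Prop :=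
  (c = 0 ∧ (lam0 = 0 ∨ ∀ k, ¬ Rich x κ e τ k)) ∨
    ∃ lam, 1 ≤ lam ∧ lam ≤ lam0 ∧ lam ≤ c ∧ Net x κ e τ (D lam) c ref ∧
      (lam < lam0 → ∃ c' ≤ lam, ∃ ref', Net x κ e τ (D (lam + 1)) c' ref')

variable {V : Type*} [NormedAddCommGroup V] {x : ℕ → V} {κ : ℕ} {e τ : ℝ}

theorem mem_supp {k k' : ℕ} : k' ∈ supp x κ e k ↔ k' < κ ∧ ‖x k - x k'‖ ≤ 2 * e := by
  simp [supp]

theorem dist_le_of_mem_supp {k i j : ℕ} (hi : k ∈ supp x κ e i) (hj : k ∈ supp x κ e j) :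
    ‖x i - x j‖ ≤ 4 * e := by
  have h1 := (mem_supp.1 hi).2
  have h2 := (mem_supp.1 hj).2
  rw [norm_sub_rev] at h2
  have := norm_sub_le_norm_sub_add_norm_sub (x i) (x k) (x j)
  linarith

/-- Rich points that are far apart have disjoint neighbourhoods, so there are few of them. -/
theorem packing {D : ℝ} (hD : 4 * e ≤ D) {c : ℕ} {ref : ℕ → ℕ}
    (hr : ∀ i < c, Rich x κ e τ (ref i))
    (hs : ∀ i < c, ∀ j < c, i ≠ j → D < ‖x (ref i) - x (ref j)‖) : c * τ ≤ κ := by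
  have hdisj : ((range c : Finset ℕ) : Set ℕ).PairwiseDisjoint fun i => supp x κ e (ref i) := by
    intro i hi j hj hij
    refine Finset.disjoint_left.2 fun k hk hk' => ?_
    have := hs i (by simpa using hi) j (by simpa using hj) hij
    have := dist_le_of_mem_supp hk hk'
    linarith
  have h1 : #((range c).biUnion fun i => supp x κ e (ref i)) ≤ κ := by
    calc _ ≤ #(range κ) := Finset.card_le_card fun k hk => by
          obtain ⟨i, _, hi⟩ := Finset.mem_biUnion.1 hk
          exact Finset.mem_range.2 (mem_supp.1 hi).1
      _ = κ := Finset.card_range κ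
  rw [Finset.card_biUnion hdisj] at h1
  calc (c * τ : ℝ) = ∑ i ∈ range c, τ := by simp
    _ ≤ ∑ i ∈ range c, (#(supp x κ e (ref i)) : ℝ) :=
        Finset.sum_le_sum fun i hi => (hr i (Finset.mem_range.1 hi)).2
    _ ≤ κ := by exact_mod_cast h1

/-- A coarser family has at most as many members as a finer one, because distinct members are close
to distinct members of the finer family; in the case of equality, every member of the finer family
is close to one of the coarser family. -/
theorem Net.card_le {D D' : ℝ} (hD : 2 * D' ≤ D) {c c' : ℕ} {ref ref' : ℕ → ℕ}
    (h : Net x κ e τ D c ref) (h' : Net x κ e τ D' c' ref') : c ≤ c' ∧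
    (c = c' → ∀ k, Rich x κ e τ k → ∃ i < c, ‖x k - x (ref i)‖ ≤ 2 * D') := by
  choose! f hf hf' using fun i (hi : i < c) => h'.cover _ (h.rich i hi)
  have hinj : Set.InjOn f (range c) := by
    intro i hi j hj hij
    by_contra hne
    simp only [Finset.coe_range, Set.mem_Iio] at hi hj
    have h1 := h.sep i hi j hj hne
    have h2 := hf' i hi
    have h3 := hf' j hj
    rw [← hij, norm_sub_rev] at h3
    have := norm_sub_le_norm_sub_add_norm_sub (x (ref i)) (x (ref' (f i))) (x (ref j))
    linarith
  have hsub : (range c).image f ⊆ range c' := by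
    intro j hj
    obtain ⟨i, hi, rfl⟩ := Finset.mem_image.1 hj
    exact Finset.mem_range.2 (hf i (Finset.mem_range.1 hi))
  have hcard := Finset.card_image_of_injOn hinj
  rw [Finset.card_range] at hcard
  refine ⟨?_, fun heq k hk => ?_⟩
  · simpa [hcard] using Finset.card_le_card hsub
  · obtain ⟨j, hj, hj'⟩ := h'.cover k hk
    have himg := Finset.eq_of_subset_of_card_le hsub (by rw [hcard, Finset.card_range, heq])
    have : j ∈ (range c).image f := himg ▸ Finset.mem_range.2 hj
    obtain ⟨i, hi, rfl⟩ := Finset.mem_image.1 this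
    have hi' := Finset.mem_range.1 hi
    refine ⟨i, hi', ?_⟩
    have h2 := hf' i hi'
    rw [norm_sub_rev] at h2
    have := norm_sub_le_norm_sub_add_norm_sub (x k) (x (ref' (f i))) (x (ref i))
    linarith

/-- The members of the family are far apart, and every rich point is close to one of them, where
closeness refers to a much smaller scale: at the finest scale the packing bound does not allow a
further member, and at a coarser scale the family has the same number of members as the family of
the next finer scale. -/
theorem Picked.spec {D : ℕ → ℝ} {lam0 c : ℕ} {ref : ℕ → ℕ} (he : 0 ≤ e) (hτ : 0 < τ)
    (h : Picked x κ e τ D lam0 c ref) (hκ : (κ : ℝ) < (lam0 + 1) * τ)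
    (hD : ∀ l, 1 ≤ l → l ≤ lam0 → 8 * e ≤ D l)
    (hDD : ∀ l, 1 ≤ l → l < lam0 → 2 * D (l + 1) ≤ D l) :
    c ≤ lam0 ∧ (∀ i < c, Rich x κ e τ (ref i)) ∧
    (∀ i < c, ∀ j < c, i ≠ j → D c < ‖x (ref i) - x (ref j)‖) ∧
    ∀ k, Rich x κ e τ k → lam0 ≠ 0 → ∃ i < c,
      (c = lam0 ∧ ‖x k - x (ref i)‖ ≤ 8 * e) ∨ (c < lam0 ∧ ‖x k - x (ref i)‖ ≤ 2 * D (c + 1)) := by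
  rcases h with ⟨rfl, h⟩ | ⟨lam, h1, h2, h3, hN, hN'⟩
  · refine ⟨by omega, by simp, by simp, fun k hk h0 => ?_⟩
    rcases h with h | h
    · exact absurd h h0
    · exact absurd hk (h k)
  · rcases h2.lt_or_eq with hlt | rfl
    · obtain ⟨c', hc', ref', hN''⟩ := hN' hlt
      obtain ⟨h4, h5⟩ := hN.card_le (hDD lam h1 hlt) hN''
      obtain rfl : c = lam := by omega
      refine ⟨hlt.le, hN.rich, hN.sep, fun k hk _ => ?_⟩
      obtain ⟨i, hi, hi'⟩ := h5 (by omega) k hk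
      exact ⟨i, hi, Or.inr ⟨hlt, hi'⟩⟩
    · have hp := packing (by linarith [hD lam h1 le_rfl]) hN.rich hN.sep
      have hc : c = lam := by
        have h6 : (c : ℝ) * τ < (lam + 1) * τ := hp.trans_lt hκ
        have h7 : (c : ℝ) < lam + 1 := lt_of_mul_lt_mul_right h6 hτ.le
        have : c < lam + 1 := by exact_mod_cast h7
        omega
      subst hc
      refine ⟨le_rfl, hN.rich, hN.sep, fun k hk _ => ?_⟩
      -- otherwise `k` could be added to the separated family, which would exceed the packing bound
      by_contra! hcon
      have hsep : ∀ i < c, 8 * e < ‖x k - x (ref i)‖ := fun i hi => (hcon i hi).1 rfl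
      let ref' : ℕ → ℕ := fun i => if i = c then k else ref i
      have hp' := packing (c := c + 1) (ref := ref') (D := 8 * e) (x := x) (κ := κ) (τ := τ)
        (e := e) (by linarith) ?_ ?_
      · push_cast at hp'
        linarith
      · intro i hi
        simp only [ref']
        split_ifs with hic
        · exact hk
        · exact hN.rich i (by omega)
      · intro i hi j hj hij
        simp only [ref']
        have h8 := hD c h1 le_rfl
        split_ifs with hic hjc hjc
        · omega
        · exact hsep j (by omega)
        · rw [norm_sub_rev]; exact hsep i (by omega)
        · exact h8.trans_lt (hN.sep i (by omega) j (by omega) hij)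

/-- The points come in groups of `l` points each; `p` is close to a point of all groups but a
fraction of `h`.  Within each group the points are far apart. -/
structure Grouped (x : ℕ → V) (l nU : ℕ) (e h : ℝ) (p : V) : Prop where
  sep : ∀ k < l * nU, ∀ k' < l * nU, k ≠ k' → k / l = k' / l → 20 * e < ‖x k - x k'‖
  bad : ∃ bad : Finset ℕ, #bad ≤ h * nU ∧
    ∀ u < nU, u ∉ bad → ∃ k < l * nU, k / l = u ∧ ‖x k - p‖ ≤ e

theorem Grouped.exists_rich {l nU : ℕ} {h : ℝ} {p : V} (hg : Grouped x l nU e h p) (hh : h < 1)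
    (hn : 0 < nU) : ∃ k, Rich x (l * nU) e ((1 - h) * nU) k ∧ ‖x k - p‖ ≤ e := by
  obtain ⟨bad, hbad, hgood⟩ := hg.bad
  choose! f hf hf' hf'' using hgood
  have hcard : ((1 - h) * nU : ℝ) ≤ #(range nU \ bad) := by
    have h1 := Finset.le_card_sdiff bad (range nU)
    rw [Finset.card_range] at h1
    have h2 : (nU : ℝ) ≤ #(range nU \ bad) + #bad := by
      have : nU ≤ #(range nU \ bad) + #bad := by omega
      exact_mod_cast this
    linarith
  have hn' : (0 : ℝ) < nU := by exact_mod_cast hn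
  have hpos : 0 < #(range nU \ bad) := by
    have : (0 : ℝ) < #(range nU \ bad) := lt_of_lt_of_le (by nlinarith) hcard
    exact_mod_cast this
  obtain ⟨u, hu⟩ := Finset.card_pos.1 hpos
  simp only [Finset.mem_sdiff, Finset.mem_range] at hu
  refine ⟨f u, ⟨hf u hu.1 hu.2, hcard.trans ?_⟩, hf'' u hu.1 hu.2⟩
  have : #(range nU \ bad) ≤ #(supp x (l * nU) e (f u)) := by
    refine Finset.card_le_card_of_injOn f ?_ ?_
    · intro v hv
      simp only [Finset.coe_sdiff, Finset.coe_range, Set.mem_sdiff, Set.mem_Iio,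
        Finset.mem_coe] at hv
      refine mem_supp.2 ⟨hf v hv.1 hv.2, ?_⟩
      have h1 := hf'' u hu.1 hu.2
      have h2 := hf'' v hv.1 hv.2
      rw [norm_sub_rev] at h2
      have := norm_sub_le_norm_sub_add_norm_sub (x (f u)) p (x (f v))
      linarith
    · intro v hv w hw hvw
      simp only [Finset.coe_sdiff, Finset.coe_range, Set.mem_sdiff, Set.mem_Iio,
        Finset.mem_coe] at hv hw
      rw [← hf' v hv.1 hv.2, ← hf' w hw.1 hw.2, hvw]
  exact_mod_cast this

variable [NormedSpace ℝ V]

/-- The average of the points that are close to `x k`. -/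
noncomputable def suppMean (x : ℕ → V) (κ : ℕ) (e : ℝ) (k : ℕ) : V :=
  (1 / (#(supp x κ e k) : ℝ)) • ∑ k' ∈ supp x κ e k, x k'

theorem norm_suppMean_sub_le {k : ℕ} {p : V} (hpos : 0 < #(supp x κ e k)) :
    ‖suppMean x κ e k - p‖ ≤
      (1 / (#(supp x κ e k) : ℝ)) * ∑ k' ∈ supp x κ e k, ‖x k' - p‖ := by
  have hs : (#(supp x κ e k) : ℝ) ≠ 0 := by exact_mod_cast hpos.ne'
  have h1 : suppMean x κ e k - p =
      (1 / (#(supp x κ e k) : ℝ)) • ∑ k' ∈ supp x κ e k, (x k' - p) := by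
    rw [Finset.sum_sub_distrib, smul_sub, Finset.sum_const, ← Nat.cast_smul_eq_nsmul ℝ, smul_smul,
      one_div, inv_mul_cancel₀ hs, one_smul, suppMean, one_div]
  rw [h1, norm_smul, Real.norm_of_nonneg (by positivity)]
  gcongr
  exact norm_sum_le _ _

theorem norm_suppMean_sub_self_le {k : ℕ} (hpos : 0 < #(supp x κ e k)) :
    ‖suppMean x κ e k - x k‖ ≤ 2 * e := by
  refine (norm_suppMean_sub_le hpos).trans ?_
  have hs : (0 : ℝ) < #(supp x κ e k) := by exact_mod_cast hpos
  rw [one_div, inv_mul_le_iff₀ hs]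
  calc ∑ k' ∈ supp x κ e k, ‖x k' - x k‖ ≤ ∑ k' ∈ supp x κ e k, 2 * e :=
        Finset.sum_le_sum fun k' hk' => by rw [norm_sub_rev]; exact (mem_supp.1 hk').2
    _ = _ := by simp

/-- Nearly all points that are close to a rich point in the vicinity of `p` are those close to `p`,
so their average is hardly farther from `p` than these. -/
theorem Grouped.norm_suppMean_sub_le {l nU : ℕ} {h : ℝ} {p : V} (hg : Grouped x l nU e h p)
    (he : 0 ≤ e) (hh0 : 0 ≤ h) (hh : h ≤ 1 / 2) (hn : 0 < nU) {j : ℕ}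
    (hj : Rich x (l * nU) e ((1 - h) * nU) j) (hjp : ‖x j - p‖ ≤ 9 * e) :
    ‖suppMean x (l * nU) e j - p‖ ≤ e * (1 + 20 * h) := by
  classical
  obtain ⟨bad, hbad, hgood⟩ := hg.bad
  set S := supp x (l * nU) e j with hS
  have hn' : (0 : ℝ) < nU := by exact_mod_cast hn
  have hs : (0 : ℝ) < #S := lt_of_lt_of_le (by nlinarith) hj.2
  set F := S.filter fun k => ¬ ‖x k - p‖ ≤ e with hF
  have hfar : ∀ k ∈ F, k / l ∈ bad := by
    intro k hk
    obtain ⟨hk1, hk2⟩ := Finset.mem_filter.1 hk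
    by_contra hcon
    have h1 := mem_supp.1 hk1
    have hlt : k / l < nU := Nat.div_lt_of_lt_mul h1.1
    obtain ⟨k', hk', hkl, hkp⟩ := hgood _ hlt hcon
    have hne : k ≠ k' := fun h => hk2 (h ▸ hkp)
    have h2 := hg.sep k h1.1 k' hk' hne hkl.symm
    have h3 := norm_sub_le_norm_sub_add_norm_sub (x k) (x j) p
    have h4 := norm_sub_le_norm_sub_add_norm_sub (x k) p (x k')
    rw [norm_sub_rev] at hkp
    have h5 := h1.2
    rw [norm_sub_rev] at h5
    linarith
  have hFcard : (#F : ℝ) ≤ h * nU := by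
    refine le_trans ?_ hbad
    have : #F ≤ #bad := by
      refine Finset.card_le_card_of_injOn (fun k => k / l) (fun k hk => hfar k hk) ?_
      intro k hk k' hk' hkk
      by_contra hne
      have h1 := (Finset.mem_filter.1 hk).1
      have h2 := (Finset.mem_filter.1 hk').1
      have h3 := hg.sep k (mem_supp.1 h1).1 k' (mem_supp.1 h2).1 hne hkk
      have h4 := norm_sub_le_norm_sub_add_norm_sub (x k) (x j) (x k')
      have h5 := (mem_supp.1 h1).2
      rw [norm_sub_rev] at h5
      have h6 := (mem_supp.1 h2).2
      linarith
    exact_mod_cast this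
  refine (VecRAM.norm_suppMean_sub_le (by exact_mod_cast hs)).trans ?_
  rw [← hS, one_div, inv_mul_le_iff₀ hs]
  have h1 : ∑ k ∈ S, ‖x k - p‖ ≤ ∑ k ∈ S, (e + if ¬ ‖x k - p‖ ≤ e then 10 * e else 0) := by
    refine Finset.sum_le_sum fun k hk => ?_
    split_ifs with hc
    · linarith
    · have h2 := (mem_supp.1 hk).2
      rw [norm_sub_rev] at h2
      have := norm_sub_le_norm_sub_add_norm_sub (x k) (x j) p
      linarith
  refine h1.trans ?_
  rw [Finset.sum_add_distrib, ← Finset.sum_filter, Finset.sum_const, Finset.sum_const,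
    nsmul_eq_mul, nsmul_eq_mul, ← hF]
  have h2 : (#F : ℝ) ≤ 2 * h * #S := by
    have := hj.2
    rw [← hS] at this
    nlinarith
  nlinarith

end Local

/-! ### One round: every vertex replaces its list of centres -/

section Round

open Finset
open scoped Classical

/-- A list of vectors for every vertex of the graph. -/
structure Lists (V : Type*) where
  len : ℕ → ℕ
  el : ℕ → ℕ → V

/-- The accuracy of a list with `l` elements, up to a factor that grows slowly: the shorter the
list, the coarser it is. -/
noncomputable def acc (L : ℕ) (ρ : ℝ) (l : ℕ) : ℝ := 100 ^ (L + 1 - l) * ρ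

theorem acc_succ {L l : ℕ} (ρ : ℝ) (hl : l ≤ L) : acc L ρ l = 100 * acc L ρ (l + 1) := by
  rw [acc, acc, show L + 1 - l = (L + 1 - (l + 1)) + 1 by omega, pow_succ]; ring

theorem acc_nonneg {L l : ℕ} {ρ : ℝ} (hρ : 0 ≤ ρ) : 0 ≤ acc L ρ l := by unfold acc; positivity

theorem acc_anti {L l l' : ℕ} {ρ : ℝ} (hρ : 0 ≤ ρ) (h : l ≤ l') : acc L ρ l' ≤ acc L ρ l := by
  unfold acc
  gcongr
  norm_num

variable {V : Type*} [NormedAddCommGroup V]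

/-- The lists have at most `L` elements each, and these are far apart. -/
def Lists.Sep (X : Lists V) (L : ℕ) (ρ gr : ℝ) (N : ℕ) : Prop :=
  ∀ z < N, X.len z ≤ L ∧ ∀ a < X.len z, ∀ b < X.len z, a ≠ b →
    20 * (acc L ρ (X.len z) * gr) < ‖X.el z a - X.el z b‖

/-- The list of `z` has an element close to `p`. -/
def Lists.Near (X : Lists V) (L : ℕ) (ρ gr : ℝ) (p : V) (z : ℕ) : Prop :=
  ∃ a < X.len z, ‖X.el z a - p‖ ≤ acc L ρ (X.len z) * gr

/-- The number of members that a cluster must have; in the round `0` every vertex has just one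
point, later nearly all lists should have an element in the cluster. -/
noncomputable def thr (L T t nU : ℕ) : ℝ := if t = 0 then nU / L else (1 - 1 / (20 * T)) * nU

/-- In the round `t`, a vertex with the neighbours `nb 0, …, nb (g - 1)` obtains the new list
`el' 0, …, el' (len' - 1)`: it selects a frequent length `lstar` of lists among its neighbours, and
forms clusters from the `lstar * nU` elements of the lists of this length. -/
def StepAt [NormedSpace ℝ V] (L T : ℕ) (ρ gr gr' : ℝ) (t g : ℕ) (nb : ℕ → ℕ) (X : Lists V)
    (len' : ℕ) (el' : ℕ → V) : Prop :=
  ∃ (lstar nU : ℕ) (usl : ℕ → ℕ) (x : ℕ → V) (ref : ℕ → ℕ),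
    ((lstar = 0 ∧ ∀ l, 1 ≤ l → l ≤ L → 2 * L * #{q ∈ range g | X.len (nb q) = l} < g) ∨
      (1 ≤ lstar ∧ lstar ≤ L ∧ g ≤ 2 * L * #{q ∈ range g | X.len (nb q) = lstar})) ∧
    (∀ P : ℕ → Prop, #{u ∈ range nU | P (usl u)} =
      #{q ∈ range g | X.len (nb q) = lstar ∧ P (nb q)}) ∧
    (∀ u < nU, ∀ a < lstar, x (lstar * u + a) = X.el (usl u) a) ∧
    Picked x (lstar * nU) (acc L ρ (if t = 0 then L + 1 else lstar) * gr) (thr L T t nU)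
      (fun l => 24 * (acc L ρ l * gr')) (if t = 0 then L else lstar) len' ref ∧
    ∀ i < len', el' i =
      suppMean x (lstar * nU) (acc L ρ (if t = 0 then L + 1 else lstar) * gr) (ref i)

variable {L T t g N : ℕ} {ρ gr gr' : ℝ} {nb : ℕ → ℕ} {X : Lists V} {len' : ℕ} {el' : ℕ → V}

/-- If nearly all neighbours have lists near `p`, then these lists are not empty, and one of the
possible lengths is frequent. -/
theorem exists_frequent_len (hL : 1 ≤ L) (hT : 1 ≤ T) (hg : 0 < g) (hnb : ∀ q < g, nb q < N)
    (hX : X.Sep L ρ gr N) {p : V}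
    (hp : (#{q ∈ range g | ¬ X.Near L ρ gr p (nb q)} : ℝ) ≤ g / (40 * L * T))
    (h : ∀ l, 1 ≤ l → l ≤ L → 2 * L * #{q ∈ range g | X.len (nb q) = l} < g) : False := by
  have hL' : (1 : ℝ) ≤ L := by exact_mod_cast hL
  have hT' : (1 : ℝ) ≤ T := by exact_mod_cast hT
  have hgood : (g : ℝ) ≤ #{q ∈ range g | ¬ X.Near L ρ gr p (nb q)} +
      ∑ l ∈ Icc 1 L, (#{q ∈ range g | X.len (nb q) = l} : ℝ) := by
    have : range g ⊆ {q ∈ range g | ¬ X.Near L ρ gr p (nb q)} ∪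
        (Icc 1 L).biUnion fun l => {q ∈ range g | X.len (nb q) = l} := by
      intro q hq
      by_cases hq' : X.Near L ρ gr p (nb q)
      · obtain ⟨a, ha, -⟩ := hq'
        have := (hX _ (hnb q (Finset.mem_range.1 hq))).1
        refine Finset.mem_union_right _ (Finset.mem_biUnion.2 ⟨X.len (nb q), ?_, ?_⟩)
        · exact Finset.mem_Icc.2 ⟨by omega, this⟩
        · exact Finset.mem_filter.2 ⟨hq, rfl⟩
      · exact Finset.mem_union_left _ (Finset.mem_filter.2 ⟨hq, hq'⟩)
    have h1 := (Finset.card_le_card this).trans (Finset.card_union_le _ _)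
    rw [Finset.card_range] at h1
    have h2 := h1.trans (Nat.add_le_add_left Finset.card_biUnion_le _)
    exact_mod_cast h2
  have hsum : ∑ l ∈ Icc 1 L, (#{q ∈ range g | X.len (nb q) = l} : ℝ) <
      ∑ l ∈ Icc 1 L, (g : ℝ) / (2 * L) := by
    refine Finset.sum_lt_sum_of_nonempty ⟨1, by simp [hL]⟩ fun l hl' => ?_
    rw [lt_div_iff₀ (by positivity)]
    have := h l (Finset.mem_Icc.1 hl').1 (Finset.mem_Icc.1 hl').2
    have h4 : ((2 * L * #{q ∈ range g | X.len (nb q) = l} : ℕ) : ℝ) < g := by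
      exact_mod_cast this
    push_cast at h4
    linarith
  have h5 : ∑ l ∈ Icc 1 L, (g : ℝ) / (2 * L) = g / 2 := by
    rw [Finset.sum_const, Nat.card_Icc, nsmul_eq_mul]
    simp only [Nat.add_sub_cancel]
    field_simp
  have hg' : (0 : ℝ) < g := by exact_mod_cast hg
  have h6 : (g : ℝ) / (40 * L * T) ≤ g / 2 := by
    apply div_le_div_of_nonneg_left hg'.le (by norm_num)
    nlinarith
  linarith

/-- A round preserves the separation of the lists, and a vertex obtains a centre near `p` if nearly
all of its neighbours have one. In the round `0` it suffices that the fraction `1 / L` of the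
neighbours has a point near `p`. -/
theorem StepAt.spec [NormedSpace ℝ V] (h : StepAt L T ρ gr gr' t g nb X len' el')
    (hL : 1 ≤ L) (hT : L ≤ T) (hρ : 0 ≤ ρ) (hgr : 0 < gr) (hgr' : gr' = gr * (1 + 1 / T)) (hg : 0 < g)
    (h0 : t = 0 → ∀ q < g, X.len (nb q) = 1) (hnb : ∀ q < g, nb q < N) (hX : X.Sep L ρ gr N) :
    (len' ≤ L ∧ ∀ a < len', ∀ b < len', a ≠ b → 20 * (acc L ρ len' * gr') < ‖el' a - el' b‖) ∧
    ∀ p : V, (t ≠ 0 → (#{q ∈ range g | ¬ X.Near L ρ gr p (nb q)} : ℝ) ≤ g / (40 * L * T)) →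
      (t = 0 → gr = 1 ∧ (g / L : ℝ) ≤ #{q ∈ range g | ‖X.el (nb q) 0 - p‖ ≤ ρ}) →
      ∃ a < len', ‖el' a - p‖ ≤ acc L ρ len' * gr' := by
  obtain ⟨lstar, nU, usl, x, ref, hl, hcount, hx, hpick, hel⟩ := h
  have hL' : (1 : ℝ) ≤ L := by exact_mod_cast hL
  have hTL : (L : ℝ) ≤ T := by exact_mod_cast hT
  have hT' : (1 : ℝ) ≤ T := hL'.trans hTL
  have hgg : gr ≤ gr' := by
    rw [hgr']; have : (0 : ℝ) ≤ 1 / T := by positivity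
    nlinarith
  have hgr0 : 0 < gr' := hgr.trans_le hgg
  have hnU : nU = #{q ∈ range g | X.len (nb q) = lstar} := by
    have := hcount fun _ => True
    simpa using this
  have husl : ∀ u < nU, X.len (usl u) = lstar ∧ usl u < N := by
    intro u hu
    obtain ⟨P, hP⟩ : ∃ P : ℕ → Prop, ∀ v, P v ↔ ¬ (X.len v = lstar ∧ v < N) := ⟨_, fun _ => Iff.rfl⟩
    have h1 : #{q ∈ range g | X.len (nb q) = lstar ∧ P (nb q)} = 0 := by
      refine Finset.card_eq_zero.2 (Finset.filter_eq_empty_iff.2 fun q hq => ?_)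
      rintro ⟨h1, h2⟩
      exact (hP _).1 h2 ⟨h1, hnb q (Finset.mem_range.1 hq)⟩
    rw [← hcount P, Finset.card_eq_zero, Finset.filter_eq_empty_iff] at h1
    exact not_not.1 fun h => h1 (Finset.mem_range.2 hu) ((hP _).2 h)
  have hlL : lstar ≤ L := by rcases hl with h | h <;> omega
  have hstar1 : t = 0 → lstar = 1 ∧ nU = g := by
    intro ht
    have h1 : ∀ l, #{q ∈ range g | X.len (nb q) = l} = if l = 1 then g else 0 := by
      intro l
      rw [Finset.filter_congr fun q hq => by rw [h0 ht q (Finset.mem_range.1 hq)]]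
      by_cases h : l = 1
      · simp [h]
      · simp [h, Ne.symm h]
    have : lstar = 1 := by
      rcases hl with ⟨_, h⟩ | ⟨_, _, h⟩
      · have := h 1 le_rfl hL
        rw [h1, if_pos rfl] at this
        nlinarith
      · rw [h1] at h
        by_contra hne
        rw [if_neg hne] at h
        omega
    refine ⟨this, ?_⟩
    rw [hnU, h1, if_pos this]
  set lsel := if t = 0 then L + 1 else lstar with hlsel
  set lam0 := if t = 0 then L else lstar with hlam0
  set e := acc L ρ lsel * gr with he
  have hacc : ∀ l, 0 ≤ acc L ρ l := fun l => acc_nonneg hρ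
  have he0 : 0 ≤ e := mul_nonneg (hacc _) hgr.le
  have hlam : lam0 ≤ lsel ∧ lam0 ≤ L ∧ (lam0 < lsel → t = 0) := by
    rw [hlam0, hlsel]
    split_ifs with ht
    · simp [ht]
    · exact ⟨le_rfl, hlL, by simp⟩
  have hele : ∀ l ≤ lsel, e ≤ acc L ρ l * gr' := fun l hl =>
    mul_le_mul (acc_anti hρ hl) hgg hgr.le (hacc _)
  rcases Nat.eq_zero_or_pos nU with hn0 | hnpos
  · -- without neighbours of the selected length, there are no clusters
    have hc : len' = 0 := by
      rcases hpick with h | ⟨lam, h1, -, h3, h4, -⟩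
      · exact h.1
      · have := (h4.rich 0 (by omega)).1
        simp [hn0] at this
    subst hc
    refine ⟨by simp, fun p hp hp0 => ?_⟩
    exfalso
    by_cases ht : t = 0
    · have := (hstar1 ht).2
      omega
    · refine exists_frequent_len hL (by omega) hg hnb hX (hp ht) fun l h1 h2 => ?_
      rcases hl with ⟨_, h⟩ | ⟨_, _, h⟩
      · exact h l h1 h2
      · rw [← hnU, hn0] at h
        omega
  have hn' : (0 : ℝ) < nU := by exact_mod_cast hnpos
  have hτ : 0 < thr L T t nU := by
    unfold thr
    split_ifs
    · positivity
    · have : (1 : ℝ) / (20 * T) < 1 := by rw [div_lt_one (by positivity)]; linarith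
      nlinarith
  have hκ : ((lstar * nU : ℕ) : ℝ) < (lam0 + 1) * thr L T t nU := by
    simp only [thr, hlam0]
    split_ifs with ht
    · rw [(hstar1 ht).1]
      push_cast
      rw [mul_div_assoc', lt_div_iff₀ (by positivity)]
      nlinarith
    · push_cast
      have h1 : ((lstar : ℝ) + 1) * (1 / (20 * T)) < 1 := by
        rw [mul_one_div, div_lt_one (by positivity)]
        have : (lstar : ℝ) ≤ L := by exact_mod_cast hlL
        linarith
      nlinarith
  obtain ⟨hc1, hrich, hsep, hnear⟩ := hpick.spec he0 hτ hκ
    (fun l _ h2 => by have := hele l (h2.trans hlam.1); nlinarith [hacc l])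
    (fun l _ h2 => by
      show 2 * (24 * (acc L ρ (l + 1) * gr')) ≤ 24 * (acc L ρ l * gr')
      rw [acc_succ ρ (by omega : l ≤ L)]
      nlinarith [mul_nonneg (hacc (l + 1)) hgr0.le])
  have hsupp : ∀ i < len', 0 < #(supp x (lstar * nU) e (ref i)) := fun i hi => by
    have := hτ.trans_le (hrich i hi).2
    exact_mod_cast this
  have hmean : ∀ i < len', ‖el' i - x (ref i)‖ ≤ 2 * e := fun i hi => by
    rw [hel i hi]; exact norm_suppMean_sub_self_le (hsupp i hi)
  refine ⟨⟨hc1.trans hlam.2.1, fun a ha b hb hab => ?_⟩, fun p hp hp0 => ?_⟩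
  · have h1 := hsep a ha b hb hab
    have h2 := hmean a ha
    have h3 := hmean b hb
    rw [norm_sub_rev] at h2
    have h4 := norm_sub_le_norm_sub_add_norm_sub (x (ref a)) (el' a) (x (ref b))
    have h5 := norm_sub_le_norm_sub_add_norm_sub (el' a) (el' b) (x (ref b))
    have h6 := hele len' (hc1.trans hlam.1)
    linarith
  -- it is enough to find a rich point close to `p` and to treat the finest scale
  suffices hkey : ∃ k, Rich x (lstar * nU) e (thr L T t nU) k ∧ ‖x k - p‖ ≤ e ∧ lam0 ≠ 0 ∧
      ∀ i < len', len' = lam0 → ‖x k - x (ref i)‖ ≤ 8 * e →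
        ‖el' i - p‖ ≤ acc L ρ lam0 * gr' by
    obtain ⟨k, hk, hkp, hlam00, hfin⟩ := hkey
    obtain ⟨i, hi, hi' | hi'⟩ := hnear k hk hlam00
    · exact ⟨i, hi, by rw [hi'.1]; exact hfin i hi hi'.1 hi'.2⟩
    · refine ⟨i, hi, ?_⟩
      have h1 := hmean i hi
      have h2 := hi'.2
      rw [norm_sub_rev] at h2
      have h3 := norm_sub_le_norm_sub_add_norm_sub (el' i) (x (ref i)) p
      have h4 := norm_sub_le_norm_sub_add_norm_sub (x (ref i)) (x k) p
      have h5 := hele (len' + 1) (by omega)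
      rw [acc_succ ρ (by omega : len' ≤ L)]
      have := mul_nonneg (hacc (len' + 1)) hgr0.le
      linarith
  by_cases ht : t = 0
  · obtain ⟨hs1, hs2⟩ := hstar1 ht
    obtain ⟨hgr1, hp0⟩ := hp0 ht
    have heρ : e = ρ := by simp [he, hlsel, ht, hgr1, acc]
    have hxu : ∀ u < nU, x u = X.el (usl u) 0 := fun u hu => by
      have := hx u hu 0 (by omega)
      simpa [hs1] using this
    have hcnt := hcount fun v => ‖X.el v 0 - p‖ ≤ ρ
    rw [hs1, Finset.filter_congr (s := range g) (q := fun q => ‖X.el (nb q) 0 - p‖ ≤ ρ)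
      fun q hq => by rw [h0 ht q (Finset.mem_range.1 hq)]; simp] at hcnt
    have hS : (nU / L : ℝ) ≤ #{u ∈ range nU | ‖X.el (usl u) 0 - p‖ ≤ ρ} := by
      rw [hcnt, hs2]; exact hp0
    have hpos : 0 < #{u ∈ range nU | ‖X.el (usl u) 0 - p‖ ≤ ρ} := by
      have : (0 : ℝ) < #{u ∈ range nU | ‖X.el (usl u) 0 - p‖ ≤ ρ} :=
        lt_of_lt_of_le (by positivity) hS
      exact_mod_cast this
    obtain ⟨k, hk⟩ := Finset.card_pos.1 hpos
    obtain ⟨hk1, hk2⟩ := Finset.mem_filter.1 hk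
    rw [Finset.mem_range] at hk1
    rw [← hxu k hk1] at hk2
    refine ⟨k, ⟨by rw [hs1]; omega, ?_⟩, heρ ▸ hk2, ?_, ?_⟩
    · simp only [thr, ht, if_true]
      refine hS.trans ?_
      have : #{u ∈ range nU | ‖X.el (usl u) 0 - p‖ ≤ ρ} ≤ #(supp x (lstar * nU) e k) := by
        refine Finset.card_le_card fun u hu => ?_
        obtain ⟨hu1, hu2⟩ := Finset.mem_filter.1 hu
        rw [Finset.mem_range] at hu1
        rw [← hxu u hu1, norm_sub_rev] at hu2
        refine mem_supp.2 ⟨by rw [hs1]; omega, ?_⟩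
        have := norm_sub_le_norm_sub_add_norm_sub (x k) p (x u)
        linarith
      exact_mod_cast this
    · simp only [hlam0, ht, if_true]; omega
    · intro i hi _ hik
      have h1 := hmean i hi
      rw [norm_sub_rev] at hik
      have h3 := norm_sub_le_norm_sub_add_norm_sub (el' i) (x (ref i)) p
      have h4 := norm_sub_le_norm_sub_add_norm_sub (x (ref i)) (x k) p
      have h5 := hele (L + 1) (by simp [hlsel, ht])
      simp only [hlam0, ht, if_true]
      rw [acc_succ ρ le_rfl]
      have := mul_nonneg (hacc (L + 1)) hgr0.le
      linarith
  · have hp := hp ht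
    have hl1 : 1 ≤ lstar ∧ (g : ℝ) ≤ 2 * L * nU := by
      rcases hl with ⟨h1, h2⟩ | ⟨h1, h2, h3⟩
      · -- lists without elements are not near `p`
        exact (exists_frequent_len hL (by omega) hg hnb hX hp h2).elim
      · refine ⟨h1, ?_⟩
        rw [← hnU] at h3
        exact_mod_cast h3
    have hlam0' : lam0 = lstar := by simp [hlam0, ht]
    have hlsel' : lsel = lstar := by simp [hlsel, ht]
    have hdm : ∀ k < lstar * nU, k / lstar < nU ∧ k % lstar < lstar ∧
        x k = X.el (usl (k / lstar)) (k % lstar) := by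
      intro k hk
      have h1 : k / lstar < nU := Nat.div_lt_of_lt_mul hk
      have h2 : k % lstar < lstar := Nat.mod_lt _ hl1.1
      refine ⟨h1, h2, ?_⟩
      rw [← hx _ h1 _ h2, Nat.div_add_mod]
    have hG : Grouped x lstar nU e (1 / (20 * T)) p := by
      refine ⟨fun k hk k' hk' hne heq => ?_, {u ∈ range nU | ¬ X.Near L ρ gr p (usl u)}, ?_, ?_⟩
      · obtain ⟨h1, h2, h3⟩ := hdm k hk
        obtain ⟨h1', h2', h3'⟩ := hdm k' hk'
        rw [h3, h3', ← heq]
        have h4 := (hX _ (husl _ h1).2).2 (k % lstar) (by rwa [(husl _ h1).1]) (k' % lstar)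
          (by rwa [(husl _ h1).1]) fun hmod => hne ?_
        · rw [(husl _ h1).1] at h4
          rwa [he, hlsel']
        · rw [← Nat.div_add_mod k lstar, ← Nat.div_add_mod k' lstar, heq, hmod]
      · obtain ⟨P, hP⟩ : ∃ P : ℕ → Prop, ∀ v, P v ↔ ¬ X.Near L ρ gr p v := ⟨_, fun _ => Iff.rfl⟩
        have h0 := hcount P
        simp only [hP] at h0
        have h0 : #{u ∈ range nU | ¬ X.Near L ρ gr p (usl u)} =
          #{q ∈ range g | X.len (nb q) = lstar ∧ ¬ X.Near L ρ gr p (nb q)} := by convert h0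
        rw [h0]
        have h1 : #{q ∈ range g | X.len (nb q) = lstar ∧ ¬ X.Near L ρ gr p (nb q)} ≤
            #{q ∈ range g | ¬ X.Near L ρ gr p (nb q)} :=
          Finset.card_le_card fun q hq => by
            simp only [Finset.mem_filter] at hq ⊢
            exact ⟨hq.1, hq.2.2⟩
        refine (Nat.cast_le.2 h1).trans (hp.trans ?_)
        rw [div_le_iff₀ (by positivity)]
        calc (g : ℝ) ≤ 2 * L * nU := hl1.2
          _ = 1 / (20 * T) * nU * (40 * L * T) := by field_simp; norm_num
      · intro u hu hub
        have hN : X.Near L ρ gr p (usl u) := by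
          by_contra hcon
          exact hub (Finset.mem_filter.2 ⟨Finset.mem_range.2 hu, hcon⟩)
        obtain ⟨a, ha, hap⟩ := hN
        rw [(husl u hu).1] at ha hap
        refine ⟨lstar * u + a, ?_, ?_, ?_⟩
        · calc lstar * u + a < lstar * u + lstar := by omega
            _ = lstar * (u + 1) := by ring
            _ ≤ lstar * nU := Nat.mul_le_mul_left _ hu
        · rw [Nat.mul_add_div hl1.1, Nat.div_eq_of_lt ha, add_zero]
        · rw [hx u hu a ha, he, hlsel']; exact hap
    have hthr : thr L T t nU = (1 - 1 / (20 * T)) * nU := by simp [thr, ht]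
    have hh : (1 : ℝ) / (20 * T) ≤ 1 / 2 := by
      apply div_le_div_of_nonneg_left <;> linarith
    obtain ⟨k, hk, hkp⟩ := hG.exists_rich (by linarith) hnpos
    refine ⟨k, by rw [hthr]; exact hk, hkp, by omega, fun i hi _ hik => ?_⟩
    rw [hel i hi, hlam0']
    have hri := hrich i hi
    rw [hthr] at hri
    rw [norm_sub_rev] at hik
    have h4 := norm_sub_le_norm_sub_add_norm_sub (x (ref i)) (x k) p
    have h5 := hG.norm_suppMean_sub_le he0 (by positivity) hh hnpos hri (by linarith)
    refine h5.trans (le_of_eq ?_)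
    rw [he, hlsel', hgr']
    field_simp

theorem IsSampler.card_mul_sq_le {lam δ : ℝ} {Γ : ℕ → ℕ → ℕ} (hΓ : IsSampler N g lam Γ)
    (hδ : 0 ≤ δ) {A B : Finset ℕ} (hA : A ⊆ range N) (hB : B ⊆ range N)
    (h : ∀ z ∈ A, δ ≤ |(#{q ∈ range g | Γ z q ∈ B} : ℝ) / g - #B / N|) :
    #A * δ ^ 2 ≤ lam ^ 2 * #B := by
  refine le_trans ?_ (hΓ.2 B hB)
  rw [← nsmul_eq_mul]
  refine (Finset.card_nsmul_le_sum _ _ _ fun z hz => ?_).trans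
    (Finset.sum_le_sum_of_subset_of_nonneg hA fun _ _ _ => sq_nonneg _)
  rw [← sq_abs ((#{q ∈ range g | Γ z q ∈ B} : ℝ) / g - #B / N)]
  convert pow_le_pow_left₀ hδ (h z hz) 2

/-- Repeating the round spreads the information: if many vertices start in the ball around `p`, then
the fraction of vertices without a centre near `p` becomes small in the first round and is halved in
every later round, so that it vanishes in the end. -/
theorem near_of_rounds [NormedSpace ℝ V] {lam : ℝ} {Γ : ℕ → ℕ → ℕ} {X : ℕ → Lists V} (hL : 1 ≤ L)
    (hT : L ≤ T) (hρ : 0 ≤ ρ) (hg : 0 < g) (hΓ : IsSampler N g lam Γ) (hlam0 : 0 ≤ lam)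
    (hlam : lam ≤ 1 / (160 * L * T)) (hNT : N ≤ 2 ^ T) (h0 : ∀ z < N, (X 0).len z = 1)
    (hstep : ∀ t ≤ T, ∀ z < N, StepAt L T ρ ((1 + 1 / T) ^ t) ((1 + 1 / T) ^ (t + 1)) t g (Γ z)
      (X t) ((X (t + 1)).len z) ((X (t + 1)).el z)) :
    (∀ z < N, (X (T + 1)).len z ≤ L) ∧
    ∀ p : V, (2 / L * N : ℝ) ≤ #{z ∈ range N | ‖(X 0).el z 0 - p‖ ≤ ρ} →
      ∀ z < N, (X (T + 1)).Near L ρ ((1 + 1 / T) ^ (T + 1)) p z := by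
  have hL' : (1 : ℝ) ≤ L := by exact_mod_cast hL
  have hTL : (L : ℝ) ≤ T := by exact_mod_cast hT
  have hT' : (1 : ℝ) ≤ T := hL'.trans hTL
  have hg' : (0 : ℝ) < g := by exact_mod_cast hg
  have hgr : ∀ t : ℕ, (0 : ℝ) < (1 + 1 / T) ^ t := fun t => by positivity
  have hspec := fun t (ht : t ≤ T) (hX : (X t).Sep L ρ ((1 + 1 / T) ^ t) N) z (hz : z < N) =>
    (hstep t ht z hz).spec hL hT hρ (hgr t) (pow_succ _ _) hg
      (by rintro rfl q hq; exact h0 _ (hΓ.1 z hz q hq)) (hΓ.1 z hz) hX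
  have hsep : ∀ t ≤ T + 1, (X t).Sep L ρ ((1 + 1 / T) ^ t) N := by
    intro t ht
    induction t with
    | zero =>
      refine fun z hz => ⟨by rw [h0 z hz]; exact hL, fun a ha b hb hab => ?_⟩
      rw [h0 z hz] at ha hb
      omega
    | succ t ih => exact fun z hz => (hspec t (by omega) (ih (by omega)) z hz).1
  refine ⟨fun z hz => (hsep (T + 1) le_rfl z hz).1, fun p hp => ?_⟩
  rcases Nat.eq_zero_or_pos N with rfl | hN
  · intro z hz; omega
  have hN' : (0 : ℝ) < N := by exact_mod_cast hN
  set bad : ℕ → Finset ℕ := fun t => {z ∈ range N | ¬ (X t).Near L ρ ((1 + 1 / T) ^ t) p z} with hbad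
  set η : ℝ := 1 / (40 * L * T) with hη
  have hη0 : 0 < η := by positivity
  have hlamη : lam ≤ η / 4 := hlam.trans (le_of_eq (by rw [hη]; field_simp; norm_num))
  have hlam2 : lam ^ 2 ≤ (η / 4) ^ 2 := by gcongr
  have hbadN : ∀ t, bad t ⊆ range N := fun t => Finset.filter_subset _ _
  have hmain : ∀ t ≤ T, (#(bad (t + 1)) : ℝ) * 2 ^ t ≤ η / 2 * N := by
    intro t ht
    induction t with
    | zero =>
      set S : Finset ℕ := {z ∈ range N | ‖(X 0).el z 0 - p‖ ≤ ρ} with hS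
      have hSN : (#S : ℝ) ≤ N := by
        have := Finset.card_le_card (Finset.filter_subset (fun z => ‖(X 0).el z 0 - p‖ ≤ ρ) (range N))
        rw [Finset.card_range] at this
        exact_mod_cast this
      have h1 : (#(bad 1) : ℝ) * (1 / L) ^ 2 ≤ lam ^ 2 * #S := by
        refine hΓ.card_mul_sq_le (by positivity) (hbadN 1) (Finset.filter_subset _ _) fun z hz => ?_
        obtain ⟨hz1, hz2⟩ := Finset.mem_filter.1 hz
        rw [Finset.mem_range] at hz1
        have h2 : (#{q ∈ range g | Γ z q ∈ S} : ℝ) < g / L := by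
          by_contra! hcon
          refine hz2 ((hspec 0 (by omega) (hsep 0 (by omega)) z hz1).2 p (by simp) fun _ => ⟨by simp, ?_⟩)
          refine hcon.trans (Nat.cast_le.2 (Finset.card_le_card fun q hq => ?_))
          obtain ⟨hq1, hq2⟩ := Finset.mem_filter.1 hq
          exact Finset.mem_filter.2 ⟨hq1, (Finset.mem_filter.1 hq2).2⟩
        rw [abs_sub_comm, le_abs]
        left
        have h3 : (2 / L : ℝ) ≤ #S / N := by rw [le_div_iff₀ hN']; exact hp
        have h4 : (#{q ∈ range g | Γ z q ∈ S} : ℝ) / g ≤ 1 / L := by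
          rw [div_le_iff₀ hg']
          calc _ ≤ _ := h2.le
            _ = 1 / L * g := by ring
        have h5 : (2 / L : ℝ) = 1 / L + 1 / L := by ring
        linarith
      have h2 : lam ^ 2 * #S ≤ (η / 4) ^ 2 * N := by gcongr
      have h3 : (#(bad 1) : ℝ) * (1 / L) ^ 2 ≤ (η / 2 * N) * (1 / L) ^ 2 := by
        refine (h1.trans h2).trans ?_
        have h4 : η / 8 ≤ (1 / L : ℝ) ^ 2 := by
          rw [hη, div_div, div_pow, one_pow]
          apply one_div_le_one_div_of_le (by positivity)
          nlinarith
        calc (η / 4) ^ 2 * N = (η / 2 * N) * (η / 8) := by ring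
          _ ≤ _ := by gcongr
      have := le_of_mul_le_mul_right h3 (by positivity)
      simpa using this
    | succ t ih =>
      have ih := ih (by omega)
      have hb2 : (#(bad (t + 1)) : ℝ) ≤ η / 2 * N := by
        refine le_trans ?_ ih
        have : (1 : ℝ) ≤ 2 ^ t := one_le_pow₀ (by norm_num)
        nlinarith [(Nat.cast_nonneg _ : (0 : ℝ) ≤ #(bad (t + 1)))]
      have h1 : (#(bad (t + 2)) : ℝ) * (η / 2) ^ 2 ≤ lam ^ 2 * #(bad (t + 1)) := by
        refine hΓ.card_mul_sq_le (by positivity) (hbadN _) (hbadN _) fun z hz => ?_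
        obtain ⟨hz1, hz2⟩ := Finset.mem_filter.1 hz
        rw [Finset.mem_range] at hz1
        have h2 : η * g < (#{q ∈ range g | Γ z q ∈ bad (t + 1)} : ℝ) := by
          by_contra! hcon
          refine hz2 ((hspec (t + 1) (by omega) (hsep _ (by omega)) z hz1).2 p (fun _ => ?_) (by simp))
          refine le_trans (Nat.cast_le.2 (Finset.card_le_card fun q hq => ?_)) (hcon.trans (le_of_eq ?_))
          · obtain ⟨hq1, hq2⟩ := Finset.mem_filter.1 hq
            exact Finset.mem_filter.2 ⟨hq1, Finset.mem_filter.2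
              ⟨Finset.mem_range.2 (hΓ.1 z hz1 q (Finset.mem_range.1 hq1)), hq2⟩⟩
          · rw [hη]; ring
        rw [le_abs]
        left
        have h3 : (#(bad (t + 1)) : ℝ) / N ≤ η / 2 := by rw [div_le_iff₀ hN']; exact hb2
        have h4 : η ≤ (#{q ∈ range g | Γ z q ∈ bad (t + 1)} : ℝ) / g := by
          rw [le_div_iff₀ hg']; exact h2.le
        linarith
      have h2 : (#(bad (t + 2)) : ℝ) * (η / 2) ^ 2 ≤ (#(bad (t + 1)) / 4) * (η / 2) ^ 2 := by
        calc _ ≤ _ := h1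
          _ ≤ (η / 4) ^ 2 * #(bad (t + 1)) := by gcongr
          _ = _ := by ring
      have h3 := le_of_mul_le_mul_right h2 (by positivity)
      calc (#(bad (t + 2)) : ℝ) * 2 ^ (t + 1) ≤ (#(bad (t + 1)) / 4) * 2 ^ (t + 1) := by gcongr
        _ = (#(bad (t + 1)) * 2 ^ t) / 2 := by ring
        _ ≤ η / 2 * N := by
          have := mul_nonneg (Nat.cast_nonneg (α := ℝ) #(bad (t + 1))) (pow_nonneg (zero_le_two (α := ℝ)) t)
          linarith
  have hlast : #(bad (T + 1)) = 0 := by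
    have h1 := hmain T le_rfl
    have h2 : (N : ℝ) ≤ 2 ^ T := by exact_mod_cast hNT
    have h3 : η < 1 := by
      rw [hη, div_lt_one (by positivity)]
      nlinarith
    by_contra hne
    have h4 : (1 : ℝ) ≤ #(bad (T + 1)) := by exact_mod_cast Nat.one_le_iff_ne_zero.2 hne
    have h5 : (2 : ℝ) ^ T ≤ #(bad (T + 1)) * 2 ^ T := by
      have : (0 : ℝ) ≤ 2 ^ T := by positivity
      nlinarith
    nlinarith
  intro z hz
  by_contra hcon
  rw [Finset.card_eq_zero, Finset.filter_eq_empty_iff] at hlast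
  exact hlast (Finset.mem_range.2 hz) hcon

end Round

/-! ### Arithmetic on the machine -/

section Arithmetic

/-- Computes the number of binary digits of `e`. -/
def sizeP (c : ℕ) (e : NExp) : Cmd :=
  setn c 1 e ;; setn c 0 0 ;;
  .loop (.natLT 0 (na c 1)) (setn c 1 (.half (na c 1)) ;; setn c 0 (na c 0 + 1))

/-- Multiplication by repeated addition. -/
def mulP (c : ℕ) (e e' : NExp) : Cmd :=
  setn c 1 e ;; setn c 2 e' ;; setn c 0 0 ;;
  .loop (.natLT 0 (na c 1)) (setn c 1 (na c 1 - 1) ;; setn c 0 (na c 0 + na c 2))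

/-- Trial division: decides whether `e` is a prime. -/
def primeP (c : ℕ) (e : NExp) : Cmd :=
  setn c 1 e ;; setn c 0 1 ;; setn c 2 2 ;;
  .loop (.natLT (na c 2) (na c 1))
    (setn c 3 0 ;; .loop (.natLT (na c 3) (na c 1)) (setn c 3 (na c 3 + na c 2)) ;;
      .cond (eqE (na c 3) (na c 1)) (setn c 0 0) .skip ;; setn c 2 (na c 2 + 1))

/-- Finds the smallest prime above `e`. -/
def nextPrimeP (c : ℕ) (e : NExp) : Cmd :=
  setn c 0 (e + 1) ;; primeP (c + 1) (na c 0) ;;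
  .loop (.natLT (na (c + 1) 0) 1) (setn c 0 (na c 0 + 1) ;; primeP (c + 1) (na c 0))

theorem size_half {x : ℕ} (hx : 0 < x) : Nat.size x = Nat.size (x / 2) + 1 := by
  apply le_antisymm
  · rw [Nat.size_le, pow_succ]
    have := Nat.lt_size_self (x / 2)
    omega
  · rw [Nat.succ_le_iff, Nat.lt_size]
    rcases Nat.eq_zero_or_pos (Nat.size (x / 2)) with h | h
    · rw [h]; omega
    · have := Nat.lt_size.1 (Nat.sub_lt h one_pos)
      have h2 : 2 ^ (x / 2).size = 2 ^ ((x / 2).size - 1) * 2 := by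
        rw [← pow_succ, Nat.sub_add_cancel h]
      omega

variable {V : Type u} [NormedAddCommGroup V] [NormedSpace ℝ V] {d : ℕ} {s : State V}

theorem sizeP_run (hd : 1 ≤ d) (c : ℕ) (e : NExp) {x : ℕ} (hx : e.eval s.nat = x) :
    Run d (sizeP c e) s (Nat.size x + 1) fun s' => Frame c s s' ∧ s'.N c 0 = Nat.size x := by
  refine Run.wp_seq hd (by omega) ?_
  simp only [wp_setn]
  refine Run.wp_seq hd (by omega) ?_
  simp only [wp_setn]
  refine Run.loop hd (A := Nat.size x + 1) (by omega) le_rfl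
    (fun s' => Frame c s s' ∧ s'.N c 0 + Nat.size (s'.N c 1) = Nat.size x)
    (fun s' => Nat.size (s'.N c 1)) ?_ ?_ (by omega) ?_ ?_
  · simp [hx]
  · simp [hx]
  · rintro s' ⟨hF, h⟩ hb
    simp only [holds_natLT, NExp.eval_zero, na_eval, NExp.eval_one] at hb
    have := size_half hb
    refine Run.of_wp hd le_rfl ?_
    simp [hF]
    omega
  · rintro s' ⟨hF, h⟩ hb
    simp only [holds_natLT, NExp.eval_zero, na_eval, NExp.eval_one, not_lt, nonpos_iff_eq_zero] at hb
    exact ⟨hF, by simpa [hb] using h⟩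

theorem mulP_run (hd : 1 ≤ d) (c : ℕ) (e e' : NExp) {x y : ℕ} (hx : e.eval s.nat = x)
    (hy : e'.eval (s.setN c 1 x).nat = y) :
    Run d (mulP c e e') s (x + 1) fun s' => Frame c s s' ∧ s'.N c 0 = x * y := by
  refine Run.wp_seq hd (by omega) ?_
  simp only [wp_setn]
  refine Run.wp_seq hd (by omega) ?_
  simp only [wp_setn]
  refine Run.wp_seq hd (by omega) ?_
  simp only [wp_setn]
  refine Run.loop hd (A := x + 1) (by omega) le_rfl
    (fun s' => Frame c s s' ∧ s'.N c 2 = y ∧ s'.N c 0 + s'.N c 1 * y = x * y)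
    (fun s' => s'.N c 1) ?_ ?_ (by omega) ?_ ?_
  · simp [hx, hy]
  · simp [hx]
  · rintro s' ⟨hF, hy', h⟩ hb
    simp only [holds_natLT, NExp.eval_zero, na_eval, NExp.eval_one] at hb
    refine Run.of_wp hd le_rfl ?_
    simp only [wp_seq, wp_setn, NExp.eval_zero, NExp.eval_one, NExp.eval_sub, NExp.eval_add,
      na_eval]
    obtain ⟨q, hq⟩ : ∃ q, s'.N c 1 = q + 1 := ⟨s'.N c 1 - 1, by omega⟩
    simp [hF, hy', hq]
    rw [← h, hq]
    ring
  · rintro s' ⟨hF, hy', h⟩ hb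
    simp only [holds_natLT, NExp.eval_zero, na_eval, NExp.eval_one, not_lt, nonpos_iff_eq_zero] at hb
    exact ⟨hF, by simpa [hb] using h⟩

theorem primeP_run (hd : 1 ≤ d) (c : ℕ) (e : NExp) {x : ℕ} (hx : e.eval s.nat = x) (h2 : 2 ≤ x) :
    Run d (primeP c e) s (x * x) fun s' => Frame c s s' ∧ (1 ≤ s'.N c 0 ↔ x.Prime) := by
  have hxx : 1 ≤ x * x := by nlinarith
  refine Run.wp_seq hd hxx ?_
  simp only [wp_setn]
  refine Run.wp_seq hd hxx ?_
  simp only [wp_setn]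
  refine Run.wp_seq hd hxx ?_
  simp only [wp_setn]
  refine Run.loop hd (A := x) (B := x) (by omega) (by omega)
    (fun s' => Frame c s s' ∧ s'.N c 1 = x ∧ 2 ≤ s'.N c 2 ∧ s'.N c 2 ≤ x ∧
      (1 ≤ s'.N c 0 ↔ ∀ a, 2 ≤ a → a < s'.N c 2 → ¬ a ∣ x))
    (fun s' => x - s'.N c 2) ?_ ?_ le_rfl ?_ ?_
  · simp [hx, h2]; omega
  · simp
  · rintro s' ⟨hF, h1, ha, hax, hfl⟩ hb
    simp [h1] at hb
    refine Run.wp_seq hd (by omega) ?_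
    simp only [wp_setn]
    refine Run.then (P := fun t => Frame c s t ∧ t.N c 1 = x ∧ t.N c 2 = s'.N c 2 ∧
      t.N c 0 = s'.N c 0 ∧ (t.N c 3 = x ↔ s'.N c 2 ∣ x)) (B' := x) ?_ le_rfl ?_
    · refine Run.loop hd (A := x) (B := 1) (by omega) le_rfl (fun t => Frame c s t ∧ t.N c 1 = x ∧
        t.N c 2 = s'.N c 2 ∧ t.N c 0 = s'.N c 0 ∧ s'.N c 2 ∣ t.N c 3 ∧ t.N c 3 < x + s'.N c 2)
        (fun t => x - t.N c 3) ?_ ?_ (by omega) ?_ ?_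
      · simp [hF, h1]; omega
      · simp
      · rintro t ⟨hF, h1, h2, h0, h3, h4⟩ hb
        simp [h1] at hb
        refine Run.of_wp hd le_rfl ?_
        simp [hF, h1, h2, h0, h3]
        omega
      · rintro t ⟨hF, h1, h2, h0, h3, h4⟩ hb
        simp [h1] at hb
        refine ⟨hF, h1, h2, h0, fun h => h ▸ h3, fun h => ?_⟩
        have h5 := Nat.dvd_sub h3 h
        have := Nat.eq_zero_of_dvd_of_lt h5 (by omega)
        omega
    · rintro t ⟨hF, h1, h2, h0, h3⟩
      refine Run.of_wp hd (by omega) ?_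
      have key : (∀ a, 2 ≤ a → a ≤ s'.N c 2 → ¬ a ∣ x) ↔
          (∀ a, 2 ≤ a → a < s'.N c 2 → ¬ a ∣ x) ∧ ¬ s'.N c 2 ∣ x := by
        refine ⟨fun h => ⟨fun a h1 h2 => h a h1 h2.le, h _ ha le_rfl⟩, fun h a h1 h2 => ?_⟩
        rcases h2.lt_or_eq with h3 | rfl
        · exact h.1 a h1 h3
        · exact h.2
      simp [hF, h1, h2, h0, h3, key, -not_forall]
      refine ⟨fun h => ⟨⟨by omega, by omega, fun _ => h⟩, by omega⟩,
        fun h => ⟨⟨by omega, by omega, ?_⟩, by omega⟩⟩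
      simp only [hfl, iff_self_and]
      exact fun _ => h
  · rintro s' ⟨hF, h1, ha, hax, hfl⟩ hb
    simp [h1] at hb
    obtain h : s'.N c 2 = x := by omega
    rw [h] at hfl
    refine ⟨hF, hfl.trans ?_⟩
    rw [Nat.prime_def_lt']
    simp [h2]

theorem nextPrimeP_run (hd : 1 ≤ d) (c : ℕ) (e : NExp) {x : ℕ} (hx : e.eval s.nat = x)
    (h1 : 1 ≤ x) : Run d (nextPrimeP c e) s ((2 * x) ^ 3) fun s' => Frame c s s' ∧
      (s'.N c 0).Prime ∧ x < s'.N c 0 ∧ s'.N c 0 ≤ 2 * x := by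
  obtain ⟨q, hq, hxq, hq2⟩ := Nat.exists_prime_lt_and_le_two_mul x (by omega)
  have hpow : (2 * x) ^ 3 = (2 * x) * ((2 * x) * (2 * x)) := by ring
  have hpos : 1 ≤ (2 * x) * (2 * x) := by nlinarith
  have hle : (2 * x) * (2 * x) ≤ (2 * x) ^ 3 := by rw [hpow]; nlinarith
  refine Run.wp_seq hd (by omega) ?_
  simp only [wp_setn]
  refine Run.then (primeP_run hd (c + 1) _ (x := x + 1) (by simp [hx]) (by omega))
    (le_trans (by nlinarith) hle) ?_
  rintro t ⟨hF, hp⟩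
  have hN : t.N c 0 = x + 1 := by rw [hF.n c (by omega)]; simp [hx]
  have hF' : Frame c s t := by
    have := hF.mono (k := c) (by omega)
    refine Frame.trans ?_ this
    simp
  refine Run.loop hd (A := 2 * x) (B := (2 * x) * (2 * x)) (by omega) hpos
    (fun s' => Frame c s s' ∧ x < s'.N c 0 ∧ s'.N c 0 ≤ q ∧ (1 ≤ s'.N (c + 1) 0 ↔ (s'.N c 0).Prime))
    (fun s' => q - s'.N c 0) ?_ ?_ hpow.ge ?_ ?_
  · exact ⟨hF', by omega, by omega, by rw [hN]; exact hp⟩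
  · omega
  · rintro s' ⟨hF, h3, h4, h5⟩ hb
    simp at hb
    simp [hb] at h5
    have hne : s'.N c 0 ≠ q := by rintro h; exact h5 (h ▸ hq)
    refine Run.wp_seq hd hpos ?_
    simp only [wp_setn]
    refine (primeP_run hd (c + 1) _ (x := s'.N c 0 + 1) (by simp) (by omega)).mono
      (Nat.mul_le_mul (by omega) (by omega)) ?_
    rintro t ⟨hF1, hp⟩
    have hN : t.N c 0 = s'.N c 0 + 1 := by rw [hF1.n c (by omega)]; simp
    refine ⟨⟨?_, by omega, by omega, by rw [hN]; exact hp⟩, by omega⟩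
    refine Frame.trans ?_ (hF1.mono (by omega))
    simpa using hF
  · rintro s' ⟨hF, h3, h4, h5⟩ hb
    simp at hb
    exact ⟨hF, h5.1 (by omega), h3, h4.trans hq2⟩

end Arithmetic

/-! ### The neighbours of a vertex -/

section Neighbours

/-- The number with the `j` leading digits `(z_i + y * x ^ i) % p`, where `z_i` are the digits of
`z`. -/
def nbr (p m z x y : ℕ) : ℕ → ℕ
  | 0 => 0
  | j + 1 => nbr p m z x y j * p + (digit p m z j + y * x ^ j) % p

theorem nbr_lt {p m z x y : ℕ} (hp : 0 < p) (j : ℕ) : nbr p m z x y j < p ^ j := by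
  induction j with
  | zero => simp [nbr]
  | succ j ih =>
    have h := Nat.mod_lt (digit p m z j + y * x ^ j) hp
    rw [nbr, pow_succ]
    nlinarith

theorem nbr_digit {p m z x y : ℕ} (hp : 0 < p) {i j : ℕ} (hij : i < j) :
    nbr p m z x y j / p ^ (j - 1 - i) % p = (digit p m z i + y * x ^ i) % p := by
  induction j with
  | zero => omega
  | succ j ih =>
    have h := Nat.mod_lt (digit p m z j + y * x ^ j) hp
    rw [nbr]
    rcases Nat.lt_succ_iff_lt_or_eq.1 hij with h1 | rfl
    · rw [show j + 1 - 1 - i = (j - 1 - i) + 1 by omega, pow_succ', ← Nat.div_div_eq_div_mul,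
        mul_comm _ p, Nat.mul_add_div hp, Nat.div_eq_of_lt h, add_zero, ih h1]
    · simp [Nat.add_mod, Nat.mul_mod_left]

/-- The graph of the neighbourhoods is a sampler. -/
theorem isSampler_nbr {p m : ℕ} (hp : p.Prime) :
    IsSampler (p ^ m) (p * p) (m / p) fun z q => nbr p m z (q / p) (q % p) m :=
  haveI := Fact.mk hp
  isSampler_of_digit (fun _ _ _ _ => nbr_lt hp.pos m) fun _ _ _ _ _ hj => nbr_digit hp.pos hj

/-- One neighbour: the digits of `z` are split off one after the other. -/
def nbrP : Cmd :=
  setn 43 0 (na 22 0) ;; setn 44 0 0 ;; setn 45 0 (na 41 0) ;;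
  forC 46 (na 12 0) (
    setn 47 0 0 ;;
    .loop (.neg (.natLT (na 43 0) (na 15 (na 12 0 - 1 - na 46 0))))
      (setn 43 0 (na 43 0 - na 15 (na 12 0 - 1 - na 46 0)) ;; setn 47 0 (na 47 0 + 1)) ;;
    setn 47 0 (na 47 0 + na 45 0) ;;
    .cond (.natLT (na 47 0) (na 11 0)) .skip (setn 47 0 (na 47 0 - na 11 0)) ;;
    mulP 50 (na 11 0) (na 44 0) ;; setn 44 0 (na 50 0 + na 47 0) ;;
    setn 50 0 0 ;;
    forC 51 (na 40 0) (
      setn 50 0 (na 50 0 + na 45 0) ;;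
      .cond (.natLT (na 50 0) (na 11 0)) .skip (setn 50 0 (na 50 0 - na 11 0))) ;;
    setn 45 0 (na 50 0))

/-- All neighbours. -/
def nbsP : Cmd :=
  setn 42 0 0 ;; forC 40 (na 11 0) (forC 41 (na 11 0)
    (nbrP ;; setn 23 (na 42 0) (na 44 0) ;; setn 42 0 (na 42 0 + 1)))

variable {V : Type u} {d : ℕ} {s : State V}

/-- The parameters of the graph and the table of powers of `p` are in place. -/
structure Par (p m : ℕ) (s : State V) : Prop where
  two_le : 2 ≤ p
  m_le : m ≤ p
  p_eq : s.N 11 0 = p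
  g_eq : s.N 11 1 = p * p
  m_eq : s.N 12 0 = m
  pow_eq : ∀ j ≤ m, s.N 15 j = p ^ j

theorem Par.frame {p m : ℕ} {s' : State V} (h : Par p m s) {k : ℕ} (hk : 16 ≤ k)
    (hF : Frame k s s') : Par p m s' :=
  ⟨h.two_le, h.m_le, by rw [hF.n _ (by omega), h.p_eq], by rw [hF.n _ (by omega), h.g_eq],
    by rw [hF.n _ (by omega), h.m_eq], fun j hj => by rw [hF.n _ (by omega), h.pow_eq j hj]⟩

variable [NormedAddCommGroup V] [NormedSpace ℝ V]

theorem nbrP_run (hd : 1 ≤ d) {p m z x y : ℕ} (hpar : Par p m s) (hz : s.N 22 0 = z)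
    (hx : s.N 40 0 = x) (hy : s.N 41 0 = y) (hzm : z < p ^ m) (hxp : x < p) (hyp : y < p) :
    Run d nbrP s (p * (p * p)) fun s' => Frame 43 s s' ∧ s'.N 44 0 = nbr p m z x y m := by
  have h2 := hpar.two_le
  have hpp : p + 1 ≤ p * p := by nlinarith
  have hppp : 1 ≤ p * (p * p) := by nlinarith
  refine Run.wp_seq hd hppp ?_
  simp only [wp_setn]
  refine Run.wp_seq hd hppp ?_
  simp only [wp_setn]
  refine Run.wp_seq hd hppp ?_
  simp only [wp_setn]
  refine Run.forC hd m (A := p) (B := p * p) (by omega) (by omega) hpar.m_le le_rfl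
    (fun j t => Frame 43 s t ∧ t.N 46 0 = j ∧ t.N 43 0 = z % p ^ (m - j) ∧
      t.N 44 0 = nbr p m z x y j ∧ t.N 45 0 = y * x ^ j % p) ?_ ?_ ?_ ?_
  · simp [hz, hy, nbr, Nat.mod_eq_of_lt hzm, Nat.mod_eq_of_lt hyp]
  · rintro j t hj ⟨hF, h1, -⟩
    simp [h1, hF.n, hpar.m_eq]
  · rintro j t hj ⟨hF, h1, h3, h4, h5⟩
    set pw := p ^ (m - 1 - j) with hpw
    have hpw0 : 0 < pw := by positivity
    have hpowj : p ^ (m - j) = pw * p := by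
      rw [hpw, ← pow_succ]; congr 1; omega
    have hrem : z % p ^ (m - j) < p * pw := by
      rw [hpowj, mul_comm p]; exact Nat.mod_lt _ (by positivity)
    have hdig : z % p ^ (m - j) / pw = digit p m z j := by
      rw [hpowj, Nat.mod_mul_right_div_self, digit]
    have hmod : z % p ^ (m - j) % pw = z % pw := by
      rw [hpowj]; exact Nat.mod_mod_of_dvd _ (dvd_mul_right _ _)
    have hdp : digit p m z j < p := Nat.mod_lt _ (by omega)
    obtain ⟨w, hw⟩ : ∃ w, y * x ^ j % p = w := ⟨_, rfl⟩
    rw [hw] at h5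
    have hc : (digit p m z j + y * x ^ j) % p = (digit p m z j + w) % p := by
      rw [← hw, Nat.add_mod_mod]
    refine Run.wp_seq hd (by omega) ?_
    simp only [wp_setn]
    refine Run.then (B' := p * 1) (P := fun t => Frame 43 s t ∧ t.N 46 0 = j ∧ t.N 43 0 = z % pw ∧
      t.N 44 0 = nbr p m z x y j ∧ t.N 45 0 = w ∧ t.N 47 0 = digit p m z j) ?_
      (by omega) ?_
    · refine Run.loop hd (A := p) (B := 1) (by omega) le_rfl (fun t => Frame 43 s t ∧ t.N 46 0 = j ∧
        t.N 44 0 = nbr p m z x y j ∧ t.N 45 0 = w ∧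
        t.N 43 0 + t.N 47 0 * pw = z % p ^ (m - j)) (fun t => p - t.N 47 0) ?_ ?_ le_rfl ?_ ?_
      · simp [hF, h1, h3, h4, h5]
      · simp
      · rintro t ⟨hF, h1, h4, h5, h6⟩ hb
        have hpw' : t.N 15 (m - 1 - j) = pw := by rw [hF.n _ (by omega), hpar.pow_eq _ (by omega)]
        simp [hF.n, hpar.m_eq, h1] at hb
        rw [← hF.n 15 (by omega), hpw'] at hb
        have h7 : t.N 47 0 < p := by
          by_contra! hcon
          have := Nat.mul_le_mul_right pw hcon
          omega
        refine Run.of_wp hd le_rfl ?_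
        simp [hF, h1, h4, h5, hF.n, hpar.m_eq]
        rw [← hF.n 15 (by omega), hpw']
        refine ⟨?_, by omega⟩
        rw [← h6, add_mul]
        omega
      · rintro t ⟨hF, h1, h4, h5, h6⟩ hb
        have hpw' : t.N 15 (m - 1 - j) = pw := by rw [hF.n _ (by omega), hpar.pow_eq _ (by omega)]
        simp [hF.n, hpar.m_eq, h1] at hb
        rw [← hF.n 15 (by omega), hpw'] at hb
        refine ⟨hF, h1, ?_, h4, h5, ?_⟩
        · rw [← hmod, ← h6, Nat.add_mul_mod_self_right, Nat.mod_eq_of_lt hb]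
        · rw [← hdig, ← h6, Nat.add_mul_div_right _ _ hpw0, Nat.div_eq_of_lt hb, zero_add]
    clear hF h1 h3 h4 h5 t
    rintro t ⟨hF, h1, h3, h4, h5, h6⟩
    refine Run.wp_seq hd (by omega) ?_
    simp only [wp_setn]
    have htt : w < p := hw ▸ Nat.mod_lt _ (by omega)
    refine Run.then (B' := 1) (P := fun t => Frame 43 s t ∧ t.N 46 0 = j ∧ t.N 43 0 = z % pw ∧
      t.N 44 0 = nbr p m z x y j ∧ t.N 45 0 = w ∧
      t.N 47 0 = (digit p m z j + w) % p) (Run.of_wp hd le_rfl ?_) (by omega) ?_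
    · simp [hF, h1, h3, h4, h5, h6, hF.n, hpar.p_eq]
      refine ⟨fun h => (Nat.mod_eq_of_lt h).symm, fun h => ?_⟩
      rw [Nat.mod_eq_sub_mod h, Nat.mod_eq_of_lt (by omega)]
    clear hF h1 h3 h4 h5 h6 t
    rintro t ⟨hF, h1, h3, h4, h5, h6⟩
    refine Run.then (mulP_run hd 50 (na 11 0) (na 44 0) (x := p) (y := nbr p m z x y j)
      (by simp [hF.n, hpar.p_eq]) (by simp [h4])) (by omega) ?_
    rintro t' ⟨hF', hm⟩
    have e1 : Frame 43 s t' := hF.trans (hF'.mono (by omega))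
    rw [← hF'.n _ (by omega)] at h1 h3 h4 h5 h6
    clear hF hF' t
    refine Run.wp_seq hd (by omega) ?_
    simp only [wp_setn]
    refine Run.wp_seq hd (by omega) ?_
    simp only [wp_setn]
    refine Run.then (B' := p * 1) (P := fun t => Frame 43 s t ∧ t.N 46 0 = j ∧ t.N 43 0 = z % pw ∧
      t.N 44 0 = nbr p m z x y (j + 1) ∧ t.N 50 0 = x * w % p) ?_ (by omega) ?_
    · refine Run.forC hd x (A := p) (B := 1) (by omega) le_rfl hxp.le le_rfl
        (fun i t => Frame 43 s t ∧ t.N 46 0 = j ∧ t.N 43 0 = z % pw ∧ t.N 51 0 = i ∧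
        t.N 44 0 = nbr p m z x y (j + 1) ∧ t.N 45 0 = w ∧
        t.N 50 0 = i * w % p) ?_ ?_ ?_ ?_
      · simp [e1, h1, h3, h5, h6, nbr, hm, hc]
        ring
      · rintro i t hi ⟨hF, -, -, h7, -⟩
        simp [hF.n, hx, h7]
      · rintro i t hi ⟨hF, h1, h3, h7, h4, h5, h8⟩
        refine Run.of_wp hd le_rfl ?_
        have h9 : i * w % p < p := Nat.mod_lt _ (by omega)
        simp only [wp_seq, wp_setn, wp_cond, wp_skip]
        simp [hF, h1, h3, h7, h4, h5, h8, hF.n, hpar.p_eq, add_mul]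
        rw [← Nat.mod_add_mod]
        generalize i * w % p = u at h9 ⊢
        refine ⟨fun h => (Nat.mod_eq_of_lt h).symm, fun h => ?_⟩
        rw [Nat.mod_eq_sub_mod h, Nat.mod_eq_of_lt (by omega)]
      · rintro t ⟨hF, h1, h3, h7, h4, h5, h8⟩
        exact ⟨hF, h1, h3, h4, h8⟩
    rintro t ⟨hF, h1, h3, h4, h5⟩
    refine Run.of_wp hd (by omega) ?_
    simp [hF, h1, h3, h4, h5]
    refine ⟨by rw [hpw]; congr 2; omega, ?_⟩
    rw [← hw, Nat.mul_mod_mod, pow_succ]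
    congr 1
    ring
  · rintro t ⟨hF, -, -, h, -⟩
    exact ⟨hF, h⟩

theorem nbsP_run (hd : 1 ≤ d) {p m z : ℕ} (hpar : Par p m s) (hz : s.N 22 0 = z)
    (hzm : z < p ^ m) : Run d nbsP s (p ^ 5) fun s' => Frame 23 s s' ∧
      ∀ q < p * p, s'.N 23 q = nbr p m z (q / p) (q % p) m := by
  have h2 := hpar.two_le
  have hpow : ∀ i, 1 ≤ p ^ i := fun i => Nat.one_le_pow _ _ (by omega)
  refine Run.wp_seq hd (hpow 5) ?_
  simp only [wp_setn]
  refine Run.forC hd p (A := p) (B := p ^ 4) (by omega) (hpow 4) le_rfl (by rw [← pow_succ'])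
    (fun x t => Frame 23 s t ∧ t.N 40 0 = x ∧ t.N 42 0 = x * p ∧
      ∀ q < x * p, t.N 23 q = nbr p m z (q / p) (q % p) m) ?_ ?_ ?_ ?_
  · simp
  · rintro x t hx ⟨hF, h1, -⟩
    simp [hF.n, h1, hpar.p_eq]
  · rintro x t hx ⟨hF, h1, h3, h4⟩
    refine Run.forC hd p (A := p) (B := p ^ 3) (by omega) (hpow 3) le_rfl (by rw [← pow_succ'])
      (fun y t => Frame 23 s t ∧ t.N 40 0 = x ∧ t.N 41 0 = y ∧ t.N 42 0 = x * p + y ∧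
        ∀ q < x * p + y, t.N 23 q = nbr p m z (q / p) (q % p) m) ?_ ?_ ?_ ?_
    · simpa [hF, h1, h3] using h4
    · rintro y t hy ⟨hF, h1, h3, -⟩
      simp [hF.n, h3, hpar.p_eq]
    · clear hF h1 h3 h4 t
      rintro y t hy ⟨hF, h1, h3, h4, h5⟩
      refine Run.then (nbrP_run hd (hpar.frame (by omega) hF) (z := z) (by rw [hF.n _ (by omega), hz])
        h1 h3 hzm hx hy) (by rw [pow_succ, pow_two, mul_assoc]) ?_
      rintro t' ⟨hF', h6⟩
      refine Run.of_wp hd (hpow 3) ?_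
      have hq : ∀ q < x * p + (y + 1), t'.N 23 q = nbr p m z (q / p) (q % p) m ∨ q = x * p + y := by
        intro q hq
        rw [hF'.n _ (by omega)]
        rcases Nat.lt_succ_iff_lt_or_eq.1 hq with h | h
        · exact .inl (h5 q h)
        · exact .inr h
      simp [hF.trans (hF'.mono (by omega)), hF'.n, h1, h3, h4]
      refine ⟨by ring, fun q hq' => ?_⟩
      split_ifs with h
      · rw [h6, h, mul_comm x p, Nat.mul_add_div (by omega), Nat.div_eq_of_lt hy,
          Nat.mul_add_mod, Nat.mod_eq_of_lt hy, add_zero]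
      · have := (hq q hq').resolve_right h
        rwa [hF'.n _ (by omega)] at this
    · rintro t ⟨hF, h1, h3, h4, h5⟩
      have : (x + 1) * p = x * p + p := by ring
      simp [hF, h1, h4, this]
      exact h5
  · rintro t ⟨hF, h1, h3, h4⟩
    exact ⟨hF, h4⟩

end Neighbours

/-! ### Collecting the centres of the neighbours -/

section Collect

open Finset

/-- Finds a frequent length of the lists of the neighbours, or `0` if there is none. -/
def selectP (L : ℕ) : Cmd :=
  setn 24 0 0 ;; forC 40 (.lit L) (
    setn 41 0 0 ;;
    forC 42 (na 11 1) (.cond (eqE (na 19 (na 23 (na 42 0))) (na 40 0 + 1))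
      (setn 41 0 (na 41 0 + 1)) .skip) ;;
    .cond (.natLT (mulE (2 * L) (na 41 0)) (na 11 1)) .skip (setn 24 0 (na 40 0 + 1)))

/-- Lists the neighbours with lists of the selected length. -/
def collectP : Cmd :=
  setn 26 0 0 ;; forC 40 (na 11 1) (.cond (eqE (na 19 (na 23 (na 40 0))) (na 24 0))
    (setn 25 (na 26 0) (na 23 (na 40 0)) ;; setn 26 0 (na 26 0 + 1)) .skip)

/-- Copies the elements of their lists into one array. -/
def gatherP (L : ℕ) : Cmd :=
  setn 27 0 0 ;; forC 40 (na 26 0) (forC 41 (na 24 0)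
    (setv 27 (na 27 0) (va 19 (mulE L (na 25 (na 40 0)) + na 41 0)) ;;
      setn 27 0 (na 27 0 + 1)))

theorem card_filter_range_succ (P : ℕ → Prop) [DecidablePred P] (j : ℕ) :
    #{q ∈ range (j + 1) | P q} = #{q ∈ range j | P q} + if P j then 1 else 0 := by
  rw [Finset.range_add_one, Finset.filter_insert]
  split_ifs with h
  · rw [Finset.card_insert_of_notMem (by simp)]
  · rfl

variable {V : Type u} [NormedAddCommGroup V] [NormedSpace ℝ V] {d : ℕ} {s : State V}

theorem selectP_run (hd : 1 ≤ d) {p m L : ℕ} (hpar : Par p m s) (hL : L ≤ p) :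
    Run d (selectP L) s (p ^ 3) fun s' => Frame 24 s s' ∧
      ((s'.N 24 0 = 0 ∧ ∀ l, 1 ≤ l → l ≤ L →
          2 * L * #{q ∈ range (p * p) | s.N 19 (s.N 23 q) = l} < p * p) ∨
        (1 ≤ s'.N 24 0 ∧ s'.N 24 0 ≤ L ∧
          p * p ≤ 2 * L * #{q ∈ range (p * p) | s.N 19 (s.N 23 q) = s'.N 24 0})) := by
  have h2 := hpar.two_le
  have hpow : ∀ i, 1 ≤ p ^ i := fun i => Nat.one_le_pow _ _ (by omega)
  refine Run.wp_seq hd (hpow 3) ?_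
  simp only [wp_setn]
  refine Run.forC hd L (A := p) (B := p ^ 2) (by omega) (hpow 2) hL (by rw [← pow_succ'])
    (fun j t => Frame 24 s t ∧ t.N 40 0 = j ∧
      ((t.N 24 0 = 0 ∧ ∀ l, 1 ≤ l → l ≤ j →
          2 * L * #{q ∈ range (p * p) | s.N 19 (s.N 23 q) = l} < p * p) ∨
        (1 ≤ t.N 24 0 ∧ t.N 24 0 ≤ L ∧
          p * p ≤ 2 * L * #{q ∈ range (p * p) | s.N 19 (s.N 23 q) = t.N 24 0}))) ?_ ?_ ?_ ?_
  · simp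
    intro l h1 h2
    omega
  · rintro j t hj ⟨hF, h1, -⟩
    simp [h1]
  · rintro j t hj ⟨hF, h1, h3⟩
    refine Run.wp_seq hd (hpow 2) ?_
    simp only [wp_setn]
    refine Run.then (B' := p ^ 2 * 1) (P := fun t' => Frame 24 s t' ∧ t'.N 40 0 = j ∧
      t'.N 24 0 = t.N 24 0 ∧
      t'.N 41 0 = #{q ∈ range (p * p) | s.N 19 (s.N 23 q) = j + 1}) ?_ (by omega) ?_
    · refine Run.forC hd (p * p) (A := p ^ 2) (B := 1) (hpow 2) le_rfl (pow_two p).ge le_rfl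
        (fun i t' => Frame 24 s t' ∧ t'.N 40 0 = j ∧ t'.N 24 0 = t.N 24 0 ∧ t'.N 42 0 = i ∧
          t'.N 41 0 = #{q ∈ range i | s.N 19 (s.N 23 q) = j + 1}) ?_ ?_ ?_ ?_
      · simp [hF, h1]
      · rintro i t' hi ⟨hF, -, -, h4, -⟩
        simp [hF.n, h4, hpar.g_eq]
      · rintro i t' hi ⟨hF, h1, h3, h4, h5⟩
        refine Run.of_wp hd le_rfl ?_
        simp [hF, h1, h3, h4, h5, hF.n, card_filter_range_succ]
      · rintro t' ⟨hF, h1, h3, h4, h5⟩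
        exact ⟨hF, h1, h3, h5⟩
    · rintro t' ⟨hF, h1, h4, h5⟩
      refine Run.of_wp hd (hpow 2) ?_
      simp only [wp_cond, wp_skip, wp_setn]
      simp [hF, h1, h4, h5, hF.n, hpar.g_eq]
      refine ⟨fun h => ?_, fun h => ⟨hj, h⟩⟩
      rcases h3 with ⟨h6, h7⟩ | h6
      · refine .inl ⟨h6, fun l hl1 hl2 => ?_⟩
        rcases Nat.le_succ_iff.1 hl2 with h8 | rfl
        · exact h7 l hl1 h8
        · exact h
      · exact .inr h6
  · rintro t ⟨hF, -, h⟩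
    exact ⟨hF, h⟩

open scoped Classical in
theorem collectP_run (hd : 1 ≤ d) {p m : ℕ} (hpar : Par p m s) :
    Run d collectP s (p ^ 2) fun s' => Frame 25 s s' ∧ s'.N 26 0 ≤ p * p ∧ ∀ P : ℕ → Prop,
      #{u ∈ range (s'.N 26 0) | P (s'.N 25 u)} =
        #{q ∈ range (p * p) | s.N 19 (s.N 23 q) = s.N 24 0 ∧ P (s.N 23 q)} := by
  have h2 := hpar.two_le
  have hpow : ∀ i, 1 ≤ p ^ i := fun i => Nat.one_le_pow _ _ (by omega)
  refine Run.wp_seq hd (hpow 2) ?_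
  simp only [wp_setn]
  refine Run.forC hd (p * p) (A := p ^ 2) (B := 1) (hpow 2) le_rfl (pow_two p).ge (by omega)
    (fun j t => Frame 25 s t ∧ t.N 40 0 = j ∧ t.N 26 0 ≤ j ∧ ∀ P : ℕ → Prop,
      #{u ∈ range (t.N 26 0) | P (t.N 25 u)} =
        #{q ∈ range j | s.N 19 (s.N 23 q) = s.N 24 0 ∧ P (s.N 23 q)}) ?_ ?_ ?_ ?_
  · simp
  · rintro j t hj ⟨hF, h1, -⟩
    simp [h1, hF.n, hpar.g_eq]
  · rintro j t hj ⟨hF, h1, h3, h4⟩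
    refine Run.of_wp hd le_rfl ?_
    simp only [wp_cond, wp_skip, wp_setn, wp_seq]
    simp [hF, h1, hF.n, card_filter_range_succ]
    refine ⟨fun h => ⟨h3, fun P => ?_⟩, fun h => ⟨by omega, fun P => ?_⟩⟩
    · rw [← h4 P]
      simp only [h, true_and]
      congr 2
      refine Finset.filter_congr fun u hu => ?_
      rw [if_neg (Finset.mem_range.1 hu).ne]
    · simp only [h, false_and, if_false, add_zero]
      exact h4 P
  · rintro t ⟨hF, -, h3, h4⟩
    exact ⟨hF, h3, h4⟩

theorem gatherP_run (hd : 1 ≤ d) {p L : ℕ} (hp : 1 ≤ p) (hl : s.N 24 0 ≤ p)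
    (hn : s.N 26 0 ≤ p * p) :
    Run d (gatherP L) s (p ^ 3) fun s' => Frame 27 s s' ∧ s'.N 27 0 = s.N 24 0 * s.N 26 0 ∧
      ∀ u < s.N 26 0, ∀ a < s.N 24 0,
        s'.X 27 (s.N 24 0 * u + a) = s.X 19 (L * s.N 25 u + a) := by
  have hpow : ∀ i, 1 ≤ p ^ i := fun i => Nat.one_le_pow _ _ (by omega)
  refine Run.wp_seq hd (hpow 3) ?_
  simp only [wp_setn]
  refine Run.forC hd (s.N 26 0) (A := p ^ 2) (B := p) (hpow 2) hp (by rw [pow_two]; exact hn)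
    (by rw [← pow_succ])
    (fun u t => Frame 27 s t ∧ t.N 40 0 = u ∧ t.N 27 0 = s.N 24 0 * u ∧ ∀ u' < u, ∀ a < s.N 24 0,
        t.X 27 (s.N 24 0 * u' + a) = s.X 19 (L * s.N 25 u' + a)) ?_ ?_ ?_ ?_
  · simp
  · rintro u t hu ⟨hF, h1, -⟩
    simp [h1, hF.n]
  · rintro u t hu ⟨hF, h1, h3, h4⟩
    refine Run.forC hd (s.N 24 0) (A := p) (B := 1) hp le_rfl hl (by omega)
      (fun a t => Frame 27 s t ∧ t.N 40 0 = u ∧ t.N 41 0 = a ∧ t.N 27 0 = s.N 24 0 * u + a ∧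
        (∀ u' < u, ∀ a < s.N 24 0, t.X 27 (s.N 24 0 * u' + a) = s.X 19 (L * s.N 25 u' + a)) ∧
        ∀ a' < a, t.X 27 (s.N 24 0 * u + a') = s.X 19 (L * s.N 25 u + a')) ?_ ?_ ?_ ?_
    · simpa [hF, h1, h3] using h4
    · rintro a t ha ⟨hF, h1, h3, -⟩
      simp [h3, hF.n]
    · clear hF h1 h3 h4 t
      rintro a t ha ⟨hF, h1, h3, h4, h5, h6⟩
      refine Run.of_wp hd le_rfl ?_
      simp [hF, h1, h3, h4, hF.n, hF.x]
      refine ⟨by ring, fun u' hu' a' ha' => ?_, fun a' ha' => ?_⟩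
      · have : s.N 24 0 * u' + a' ≠ s.N 24 0 * u + a := by
          have := Nat.mul_le_mul_left (s.N 24 0) (Nat.succ_le_of_lt hu')
          rw [Nat.mul_succ] at this
          omega
        rw [if_neg this]
        exact h5 u' hu' a' ha'
      · split_ifs with h
        · rw [h]
        · exact h6 a' (by omega)
    · rintro t ⟨hF, h1, h3, h4, h5, h6⟩
      simp [hF, h1, h4]
      refine ⟨by ring, fun u' hu' a ha => ?_⟩
      rcases Nat.lt_succ_iff_lt_or_eq.1 (Nat.lt_succ_of_le hu') with h | rfl
      · exact h5 u' h a ha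
      · exact h6 a ha
  · rintro t ⟨hF, h1, h3, h4⟩
    exact ⟨hF, h3, h4⟩

end Collect

/-! ### Choosing the new centres -/

section Pick

open Finset

/-- Sets `e` and `τ`, the radius and the size of a cluster. -/
def scaleP (L : ℕ) : Cmd :=
  .cond (eqE (na 17 0) 0)
    (setr 28 0 (ra 16 (.lit (L + 1)) * ra 18 0) ;; setr 29 0 (rn (na 26 0) / rn (.lit L)) ;;
      setn 30 0 (.lit L))
    (setr 28 0 (ra 16 (na 24 0) * ra 18 0) ;;
      setr 29 0 ((rn 1 - rn 1 / (rn 20 * rn (na 14 0))) * rn (na 26 0)) ;; setn 30 0 (na 24 0))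

/-- The number and the sum of the points that are close to a given one. -/
def suppP : Cmd :=
  setn 46 0 0 ;; setv 46 0 (.smul (rn 0) (va 46 0)) ;;
  forC 47 (na 27 0) (.cond (.realLE (ds 27 (na 45 0) 27 (na 47 0)) (rn 2 * ra 28 0))
    (setn 46 0 (na 46 0 + 1) ;; setv 46 0 (va 46 0 + va 27 (na 47 0))) .skip)

/-- Greedy choice of a separated family of rich points. -/
def greedyP : Cmd :=
  setn 33 0 0 ;; forC 41 (na 27 0) (
    setn 45 0 (na 41 0) ;; suppP ;;
    .cond (.realLE (ra 29 0) (rn (na 46 0))) (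
      setn 42 0 0 ;;
      forC 43 (na 33 0) (.cond (.realLE (ds 27 (na 41 0) 27 (na 32 (na 43 0))) (ra 31 0))
        (setn 42 0 1) .skip) ;;
      .cond (eqE (na 42 0) 0) (setn 32 (na 33 0) (na 41 0) ;; setn 33 0 (na 33 0 + 1)) .skip) .skip)

/-- The search for the scale. -/
def pickP : Cmd :=
  setn 31 0 0 ;; setn 33 0 0 ;;
  .loop (.conj (eqE (na 31 0) 0) (.natLT 0 (na 30 0))) (
    setr 31 0 (rn 24 * (ra 16 (na 30 0) * ra 20 0)) ;; greedyP ;;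
    .cond (.natLT (na 33 0) (na 30 0)) (setn 30 0 (na 30 0 - 1)) (setn 31 0 1)) ;;
  .cond (eqE (na 31 0) 0) (setn 33 0 0) .skip

/-- The averages of the clusters. -/
def meansP : Cmd :=
  forC 41 (na 33 0) (setn 45 0 (na 32 (na 41 0)) ;; suppP ;;
    setv 32 (na 41 0) (.smul (rn 1 / rn (na 46 0)) (va 46 0)))

variable {V : Type u} [NormedAddCommGroup V] {d : ℕ} {s : State V}

theorem supp_succ {x : ℕ → V} {e : ℝ} {k j : ℕ} : supp x (j + 1) e k =
    if ‖x k - x j‖ ≤ 2 * e then insert j (supp x j e k) else supp x j e k := by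
  ext i
  split_ifs with h <;> simp only [Finset.mem_insert, mem_supp, Nat.lt_succ_iff_lt_or_eq]
  · constructor
    · rintro ⟨h1 | rfl, h2⟩ <;> simp [*]
    · rintro (rfl | h1) <;> simp [*]
  · constructor
    · rintro ⟨h1 | rfl, h2⟩
      · exact ⟨h1, h2⟩
      · exact absurd h2 h
    · rintro ⟨h1, h2⟩
      exact ⟨.inl h1, h2⟩

variable [NormedSpace ℝ V]

theorem suppP_run (hd : 1 ≤ d) {k A : ℕ} (hA : 1 ≤ A) (hk : s.N 45 0 = k) (hκ : s.N 27 0 ≤ A) :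
    Run d suppP s A fun s' => Frame 46 s s' ∧
      s'.N 46 0 = #(supp (s.X 27) (s.N 27 0) (s.R 28 0) k) ∧
      s'.X 46 0 = ∑ i ∈ supp (s.X 27) (s.N 27 0) (s.R 28 0) k, s.X 27 i := by
  refine Run.wp_seq hd hA ?_
  simp only [wp_setn]
  refine Run.wp_seq hd hA ?_
  simp only [wp_setv]
  refine Run.forC hd (s.N 27 0) hA le_rfl hκ (by omega) (fun j t => Frame 46 s t ∧ t.N 47 0 = j ∧
      t.N 46 0 = #(supp (s.X 27) j (s.R 28 0) k) ∧
      t.X 46 0 = ∑ i ∈ supp (s.X 27) j (s.R 28 0) k, s.X 27 i) ?_ ?_ ?_ ?_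
  · have : supp (s.X 27) 0 (s.R 28 0) k = ∅ := by ext; simp [mem_supp]
    simp [this]
  · rintro j t hj ⟨hF, h1, -⟩
    simp [h1, hF.n]
  · rintro j t hj ⟨hF, h1, h2, h3⟩
    refine Run.of_wp hd le_rfl ?_
    simp only [wp_seq, wp_cond, wp_skip, wp_setn, wp_setv]
    have hnot : j ∉ supp (s.X 27) j (s.R 28 0) k := by simp [mem_supp]
    simp [hF, h1, h2, h3, hF.n, hF.r, hF.x, hk, supp_succ, -not_le]
    refine ⟨fun h => ?_, fun h => by simp [h]⟩
    rw [if_pos h, Finset.card_insert_of_notMem hnot, Finset.sum_insert hnot, add_comm (s.X 27 j)]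
    simp
  · rintro t ⟨hF, -, h⟩
    exact ⟨hF, h⟩

theorem greedyP_run (hd : 1 ≤ d) {A : ℕ} (hA : 1 ≤ A) (hκ : s.N 27 0 ≤ A)
    (hD : 0 ≤ s.R 31 0) : Run d greedyP s (A * A) fun s' => Frame 32 s s' ∧ s'.N 33 0 ≤ s.N 27 0 ∧
      Net (s.X 27) (s.N 27 0) (s.R 28 0) (s.R 29 0) (s.R 31 0) (s'.N 33 0) (s'.N 32) := by
  have hAA : 1 ≤ A * A := by nlinarith
  refine Run.wp_seq hd hAA ?_
  simp only [wp_setn]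
  refine Run.forC hd (s.N 27 0) hA hA hκ le_rfl (fun j t => Frame 32 s t ∧ t.N 41 0 = j ∧
    t.N 33 0 ≤ j ∧ (∀ i < t.N 33 0, Rich (s.X 27) (s.N 27 0) (s.R 28 0) (s.R 29 0) (t.N 32 i)) ∧
    (∀ i < t.N 33 0, ∀ j < t.N 33 0, i ≠ j →
      s.R 31 0 < ‖s.X 27 (t.N 32 i) - s.X 27 (t.N 32 j)‖) ∧
    ∀ k < j, Rich (s.X 27) (s.N 27 0) (s.R 28 0) (s.R 29 0) k →
      ∃ i < t.N 33 0, ‖s.X 27 k - s.X 27 (t.N 32 i)‖ ≤ s.R 31 0) ?_ ?_ ?_ ?_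
  · simp
  · rintro j t hj ⟨hF, h1, -⟩
    simp [h1, hF.n]
  · rintro j t hj ⟨hF, h1, h2, h3, h4, h5⟩
    refine Run.wp_seq hd hA ?_
    simp only [wp_setn]
    refine Run.then (suppP_run hd hA (k := j) (by simp [h1]) (by simp [hF.n, hκ])) le_rfl ?_
    rintro t' ⟨hF', hc, -⟩
    have hx27 : (t.setN 45 0 (t.N 41 0)).X 27 = s.X 27 := funext fun i => by simp [hF.x]
    simp [hF.n, hx27, hF.r] at hc
    have hF2 : Frame 32 s t' := hF.trans (Frame.trans (by simp) (hF'.mono (by omega)))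
    have hN : ∀ c < 45, ∀ i, t'.N c i = t.N c i := fun c hc i => by
      rw [hF'.n c (by omega)]; simp; omega
    have h32 : ∀ i, t'.N 32 i = t.N 32 i := hN 32 (by omega)
    have hcov : ∀ {k}, k < j + 1 → k < j ∨ k = j := fun h => by omega
    refine Run.cond hd hA (fun hb => ?_) (fun hb => Run.of_wp hd hA ?_)
    · simp [hF2.r, hc] at hb
      refine Run.wp_seq hd hA ?_
      simp only [wp_setn]
      refine Run.then (B' := A) (P := fun t'' => Frame 42 t' t'' ∧ (t''.N 42 0 = 0 ↔
        ∀ i < t.N 33 0, s.R 31 0 < ‖s.X 27 j - s.X 27 (t.N 32 i)‖)) ?_ le_rfl ?_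
      · refine Run.forC hd (t.N 33 0) hA le_rfl (by omega) (by omega) (fun i t'' => Frame 42 t' t'' ∧
          t''.N 43 0 = i ∧ (t''.N 42 0 = 0 ↔
          ∀ i' < i, s.R 31 0 < ‖s.X 27 j - s.X 27 (t.N 32 i')‖)) ?_ ?_ ?_ ?_
        · simp
        · rintro i u hi ⟨hF, h1, -⟩
          simp [h1, hF.n, hN]
        · rintro i u hi ⟨hF, h6, h7⟩
          refine Run.of_wp hd le_rfl ?_
          have hcov' : (∀ i' < i + 1, s.R 31 0 < ‖s.X 27 j - s.X 27 (t.N 32 i')‖) ↔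
              (∀ i' < i, s.R 31 0 < ‖s.X 27 j - s.X 27 (t.N 32 i')‖) ∧
              s.R 31 0 < ‖s.X 27 j - s.X 27 (t.N 32 i)‖ := by
            refine ⟨fun h => ⟨fun i' hi' => h i' (by omega), h i (by omega)⟩, fun h i' hi' => ?_⟩
            rcases Nat.lt_succ_iff_lt_or_eq.1 hi' with h8 | rfl
            · exact h.1 i' h8
            · exact h.2
          simp only [wp_cond, wp_skip, wp_setn, hcov', N_setN]
          simp [hF, h6, h7, hF.n, hF.x, hF.r, hF2.x, hF2.r, hN, h1, -not_lt]
          refine ⟨fun h _ => not_lt.2 h, fun h _ => h⟩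
        · rintro u ⟨hF, -, h7⟩
          exact ⟨hF, h7⟩
      · rintro u ⟨hF3, h7⟩
        refine Run.of_wp hd hA ?_
        have hN' : ∀ c < 42, ∀ i, u.N c i = t.N c i := fun c hc i => by
          rw [hF3.n c hc, hN c (by omega)]
        have hF4 : Frame 32 s u := hF2.trans (hF3.mono (by omega))
        simp only [wp_seq, wp_cond, wp_skip, wp_setn]
        simp [h7, hF4, hN', h1, -not_lt, -not_forall]
        refine ⟨fun h => ⟨h2, fun i hi => ?_, fun i hi i' hi' hne => ?_, fun k hk hr => ?_⟩,
          fun h => ⟨by omega, fun i hi => ?_, fun i hi i' hi' hne => ?_, fun k hk hr => ?_⟩⟩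
        · split_ifs
          · exact ⟨hj, hb⟩
          · exact h3 i (by omega)
        · split_ifs with h8 h9 h9
          · omega
          · exact h i' (by omega)
          · rw [norm_sub_rev]; exact h i (by omega)
          · exact h4 i (by omega) i' (by omega) hne
        · rcases hcov (Nat.lt_succ_of_le hk) with h8 | rfl
          · obtain ⟨i, hi, h9⟩ := h5 k h8 hr
            exact ⟨i, by omega, by rw [if_neg hi.ne]; exact h9⟩
          · refine ⟨t.N 33 0, by omega, ?_⟩
            simpa using hD
        · exact h3 i hi
        · exact h4 i hi i' hi' hne
        · rcases hcov (Nat.lt_succ_of_le hk) with h8 | rfl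
          · exact h5 k h8 hr
          · push Not at h
            exact h
    · simp [hF2.r, hc] at hb
      simp [hF2, hN, h1]
      refine ⟨by omega, h3, h4, fun k hk hr => ?_⟩
      rcases hcov (Nat.lt_succ_of_le hk) with h8 | rfl
      · exact h5 k h8 hr
      · exact absurd hr.2 (not_le.2 hb)
  · rintro t ⟨hF, -, h2, h3, h4, h5⟩
    exact ⟨hF, h2, h3, h4, fun k hk => h5 k hk.1 hk⟩

theorem pickP_run (hd : 1 ≤ d) {A : ℕ} (hA : 1 ≤ A) (hκ : s.N 27 0 ≤ A) {lam0 : ℕ}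
    (hlam : s.N 30 0 = lam0) (hlamA : lam0 + 1 ≤ A)
    (hD : ∀ l ≤ lam0, 0 ≤ 24 * (s.R 16 l * s.R 20 0)) :
    Run d pickP s (A * (A * A)) fun s' => Frame 30 s s' ∧ s'.N 33 0 ≤ s.N 27 0 ∧
      Picked (s.X 27) (s.N 27 0) (s.R 28 0) (s.R 29 0) (fun l => 24 * (s.R 16 l * s.R 20 0)) lam0
        (s'.N 33 0) (s'.N 32) := by
  have hAA : 1 ≤ A * A := by nlinarith
  have hAAA : 1 ≤ A * (A * A) := by nlinarith
  refine Run.wp_seq hd hAAA ?_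
  simp only [wp_setn]
  refine Run.wp_seq hd hAAA ?_
  simp only [wp_setn]
  refine Run.then (B' := A * (A * A)) (P := fun t => Frame 30 s t ∧ t.N 33 0 ≤ s.N 27 0 ∧
    t.N 30 0 ≤ lam0 ∧ (t.N 30 0 < lam0 → ∃ c' ≤ t.N 30 0, ∃ ref', Net (s.X 27) (s.N 27 0)
      (s.R 28 0) (s.R 29 0) (24 * (s.R 16 (t.N 30 0 + 1) * s.R 20 0)) c' ref') ∧
    (t.N 31 0 = 0 → t.N 30 0 = 0) ∧
    (t.N 31 0 ≠ 0 → 1 ≤ t.N 30 0 ∧ t.N 30 0 ≤ t.N 33 0 ∧ Net (s.X 27) (s.N 27 0)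
      (s.R 28 0) (s.R 29 0) (24 * (s.R 16 (t.N 30 0) * s.R 20 0)) (t.N 33 0) (t.N 32))) ?_ le_rfl ?_
  · refine Run.loop hd hA hAA (fun t => Frame 30 s t ∧ t.N 33 0 ≤ s.N 27 0 ∧
      t.N 30 0 ≤ lam0 ∧ (t.N 30 0 < lam0 → ∃ c' ≤ t.N 30 0, ∃ ref', Net (s.X 27) (s.N 27 0)
        (s.R 28 0) (s.R 29 0) (24 * (s.R 16 (t.N 30 0 + 1) * s.R 20 0)) c' ref') ∧
      (t.N 31 0 ≠ 0 → 1 ≤ t.N 30 0 ∧ t.N 30 0 ≤ t.N 33 0 ∧ Net (s.X 27) (s.N 27 0)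
        (s.R 28 0) (s.R 29 0) (24 * (s.R 16 (t.N 30 0) * s.R 20 0)) (t.N 33 0) (t.N 32)))
      (fun t => t.N 30 0 + if t.N 31 0 = 0 then 1 else 0) ?_ ?_ le_rfl ?_ ?_
    · simp [hlam]
    · simp [hlam]; omega
    · rintro t ⟨hF, h1, h2, h3, -⟩ hb
      simp at hb
      refine Run.wp_seq hd hAA ?_
      simp only [wp_setr]
      have hx27 : ∀ r, (t.setR 31 0 r).X 27 = s.X 27 := fun r => funext fun i => by simp [hF.x]
      have hval : (rn 24 * (ra 16 (na 30 0) * ra 20 0)).eval t =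
          24 * (s.R 16 (t.N 30 0) * s.R 20 0) := by simp [hF.r]
      rw [hval]
      refine Run.then (greedyP_run hd hA (by simp [hF.n, hκ])
        (by simpa only [R_setR, NExp.eval_zero, and_self, if_true] using hD _ h2)) le_rfl ?_
      rintro t' ⟨hF', h4, h5⟩
      have hF2 : Frame 30 s t' := hF.trans (Frame.trans (by simp) (hF'.mono (by omega)))
      have hN30 : t'.N 30 0 = t.N 30 0 := by rw [hF'.n 30 (by omega)]; simp
      have hN31 : t'.N 31 0 = t.N 31 0 := by rw [hF'.n 31 (by omega)]; simp
      simp [hx27, hF.n, hF.r] at h4 h5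
      refine Run.of_wp hd hAA ?_
      simp only [wp_cond, wp_setn]
      simp [hF2, hN30, hN31, h4, hb.1]
      refine ⟨fun h => ⟨⟨by omega, fun _ => ?_⟩, hb.2⟩, fun h => ⟨h2, h3, hb.2, h, h5⟩⟩
      refine ⟨t'.N 33 0, by omega, t'.N 32, ?_⟩
      rwa [Nat.sub_add_cancel hb.2]
    · rintro t ⟨hF, h1, h2, h3, h4⟩ hb
      simp at hb
      exact ⟨hF, h1, h2, h3, hb, h4⟩
  · rintro t ⟨hF, h1, h2, h3, h4, h5⟩
    refine Run.of_wp hd hAAA ?_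
    simp only [wp_cond, wp_skip, wp_setn]
    simp [hF]
    refine ⟨fun h => .inl ⟨by simp, ?_⟩, fun h => ⟨h1, .inr ?_⟩⟩
    · rw [h4 h] at h3
      refine or_iff_not_imp_left.2 fun h0 k hk => ?_
      obtain ⟨c', hc', ref', hnet⟩ := h3 (Nat.pos_of_ne_zero h0)
      obtain ⟨i, hi, -⟩ := hnet.cover k hk
      omega
    · obtain ⟨h6, h7, h8⟩ := h5 h
      exact ⟨t.N 30 0, h6, h2, h7, h8, h3⟩

theorem meansP_run (hd : 1 ≤ d) {A : ℕ} (hA : 1 ≤ A) (hκ : s.N 27 0 ≤ A) (hc : s.N 33 0 ≤ A) :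
    Run d meansP s (A * A) fun s' => Frame 32 s s' ∧ s'.N 33 0 = s.N 33 0 ∧
      ∀ i < s.N 33 0, s'.X 32 i = suppMean (s.X 27) (s.N 27 0) (s.R 28 0) (s.N 32 i) := by
  refine Run.forC hd (s.N 33 0) hA hA hc le_rfl (fun j t => Frame 32 s t ∧ t.N 41 0 = j ∧
    t.N 33 0 = s.N 33 0 ∧ t.N 32 = s.N 32 ∧
    ∀ i < j, t.X 32 i = suppMean (s.X 27) (s.N 27 0) (s.R 28 0) (s.N 32 i)) ?_ ?_ ?_ ?_
  · simp
  · rintro j t hj ⟨hF, h1, h2, -⟩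
    simp [h1, h2]
  · rintro j t hj ⟨hF, h1, h2, h3, h4⟩
    refine Run.wp_seq hd hA ?_
    simp only [wp_setn]
    refine Run.then (suppP_run hd hA (k := s.N 32 j) (by simp [h1, h3]) (by simp [hF.n, hκ])) le_rfl ?_
    rintro t' ⟨hF', hc, hs⟩
    have hx27 : ∀ r, (t.setN 45 0 r).X 27 = s.X 27 := fun r => funext fun i => by simp [hF.x]
    have hN32 : t'.N 32 = s.N 32 := funext fun i => by rw [hF'.n 32 (by omega)]; simp [h3]
    have hX32 : ∀ i, t'.X 32 i = t.X 32 i := fun i => by rw [hF'.x 32 (by omega)]; simp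
    have hN33 : t'.N 33 0 = s.N 33 0 := by rw [hF'.n 33 (by omega)]; simp [h2]
    have hN41 : t'.N 41 0 = j := by rw [hF'.n 41 (by omega)]; simp [h1]
    have hF2 : Frame 32 s t' := hF.trans (Frame.trans (by simp) (hF'.mono (by omega)))
    simp [hF.n, hx27, hF.r, hF.x] at hc hs
    refine Run.of_wp hd hA ?_
    simp [hF2, hN41, hN33, hc, hs]
    refine ⟨by ext; simp [hN32], fun i hi => ?_⟩
    split_ifs with h
    · rw [h, suppMean, one_div]
    · rw [hX32]; exact h4 i (by omega)
  · rintro t ⟨hF, -, h1, -, h2⟩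
    exact ⟨hF, h1, h2⟩

end Pick

/-! ### The rounds -/

section Rounds

open Finset

/-- The new list of one vertex. -/
def stepP (L : ℕ) : Cmd :=
  nbsP ;; selectP L ;; collectP ;; gatherP L ;; scaleP L ;; pickP ;; meansP

/-- Stores the new list. -/
def writeP (L : ℕ) : Cmd :=
  forC 40 (na 33 0) (setv 21 (mulE L (na 22 0) + na 40 0) (va 32 (na 40 0))) ;;
  setn 21 (na 22 0) (na 33 0)

/-- Replaces the old lists by the new ones. -/
def copyP (L : ℕ) : Cmd :=
  setr 18 0 (ra 20 0) ;;
  forC 40 (mulE L (na 13 0)) (setv 19 (na 40 0) (va 21 (na 40 0))) ;;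
  forC 40 (na 13 0) (setn 19 (na 40 0) (na 21 (na 40 0)))

/-- All rounds. -/
def roundsP (L : ℕ) : Cmd :=
  setr 18 0 (rn 1) ;; forC 17 (na 14 0 + 1) (
    setr 20 0 (ra 18 0 * (rn 1 + rn 1 / rn (na 14 0))) ;;
    forC 22 (na 13 0) (stepP L ;; writeP L) ;; copyP L)

/-- The lists stored in class `c`. -/
def State.lists {V : Type*} (s : State V) (L c : ℕ) : Lists V :=
  ⟨s.N c, fun z a => s.X c (L * z + a)⟩

variable {V : Type u} {d : ℕ} {s : State V}

theorem StepAt.congr [NormedAddCommGroup V] [NormedSpace ℝ V] {L T t g : ℕ} {ρ gr gr' : ℝ}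
    {nb : ℕ → ℕ} {X : Lists V} {len' : ℕ}
    {el' el'' : ℕ → V} (h : StepAt L T ρ gr gr' t g nb X len' el')
    (he : ∀ i < len', el'' i = el' i) : StepAt L T ρ gr gr' t g nb X len' el'' := by
  obtain ⟨lstar, nU, usl, x, ref, h1, h2, h3, h4, h5⟩ := h
  exact ⟨lstar, nU, usl, x, ref, h1, h2, h3, h4, fun i hi => by rw [he i hi, h5 i hi]⟩

/-- The parameters of the rounds are in place. -/
structure RoundPar (L p m T : ℕ) (ρ : ℝ) (s : State V) : Prop extends Par p m s where
  L_pos : 1 ≤ L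
  L_lt : L < p
  T_ge : L ≤ T
  T_lt : T < p
  N_eq : s.N 13 0 = p ^ m
  T_eq : s.N 14 0 = T
  ρ_nonneg : 0 ≤ ρ
  acc_eq : ∀ l ≤ L + 1, s.R 16 l = acc L ρ l

theorem RoundPar.frame {L p m T : ℕ} {ρ : ℝ} {s' : State V} (h : RoundPar L p m T ρ s) {k : ℕ}
    (hk : 17 ≤ k) (hF : Frame k s s') : RoundPar L p m T ρ s' :=
  ⟨h.toPar.frame (by omega) hF, h.L_pos, h.L_lt, h.T_ge, h.T_lt,
    by rw [hF.n _ (by omega), h.N_eq], by rw [hF.n _ (by omega), h.T_eq], h.ρ_nonneg,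
    fun l hl => by rw [hF.r _ (by omega), h.acc_eq l hl]⟩

variable [NormedAddCommGroup V] [NormedSpace ℝ V]

open scoped Classical in
/-- The program implements `StepAt`. -/
theorem stepP_run (hd : 1 ≤ d) {L p m T t z : ℕ} {ρ gr gr' : ℝ} (hpar : RoundPar L p m T ρ s)
    (hz : s.N 22 0 = z) (hzm : z < p ^ m) (ht : s.N 17 0 = t) (hgr : s.R 18 0 = gr)
    (hgr' : s.R 20 0 = gr') (hgr0 : 0 ≤ gr') :
    Run d (stepP L) s (p ^ 9) fun s' => Frame 23 s s' ∧ s'.N 33 0 ≤ p ^ 3 ∧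
      StepAt L T ρ gr gr' t (p * p) (fun q => nbr p m z (q / p) (q % p) m) (s.lists L 19)
        (s'.N 33 0) (s'.X 32) := by
  have h2 := hpar.two_le
  have hpow : ∀ i j, i ≤ j → p ^ i ≤ p ^ j := fun i j h => Nat.pow_le_pow_right (by omega) h
  have hpow1 : ∀ i, 1 ≤ p ^ i := fun i => Nat.one_le_pow _ _ (by omega)
  have hLp := hpar.L_lt
  refine Run.then (nbsP_run hd hpar.toPar hz hzm) (hpow _ _ (by norm_num)) ?_
  rintro s1 ⟨hF1, hnb⟩
  have hpar1 := hpar.frame (by omega) hF1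
  refine Run.then (selectP_run hd hpar1.toPar hpar.L_lt.le) (hpow _ _ (by norm_num)) ?_
  rintro s2 ⟨hF2, hsel⟩
  have hpar2 := hpar1.frame (by omega) hF2
  refine Run.then (collectP_run hd hpar2.toPar) (hpow _ _ (by norm_num)) ?_
  rintro s3 ⟨hF3, hnU, hcol⟩
  have e24 : s3.N 24 0 = s2.N 24 0 := hF3.n _ (by omega) _
  have hl : s2.N 24 0 ≤ L := by rcases hsel with h | h <;> omega
  refine Run.then (gatherP_run (L := L) hd (p := p) (by omega) (by omega) hnU) (hpow _ _ (by norm_num)) ?_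
  rintro s4 ⟨hF4, hκ, hx⟩
  have hF14 : Frame 23 s s4 := ((hF1.trans (hF2.mono (by omega))).trans (hF3.mono (by omega))).trans
    (hF4.mono (by omega))
  have hpar4 := hpar.frame (by omega) hF14
  have f24 : s4.N 24 0 = s2.N 24 0 := by rw [hF4.n _ (by omega), e24]
  have f26 : s4.N 26 0 = s3.N 26 0 := by rw [hF4.n _ (by omega)]
  have f17 : s4.N 17 0 = t := by rw [hF14.n _ (by omega), ht]
  have f18 : s4.R 18 0 = gr := by rw [hF14.r _ (by omega), hgr]
  have f20 : s4.R 20 0 = gr' := by rw [hF14.r _ (by omega), hgr']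
  have hκp : s3.N 24 0 * s3.N 26 0 ≤ p ^ 3 := by
    calc s3.N 24 0 * s3.N 26 0 ≤ p * (p * p) := Nat.mul_le_mul (by omega) hnU
      _ = p ^ 3 := by ring
  refine Run.then (B' := 1) (P := fun s' => Frame 28 s4 s' ∧
      s'.R 28 0 = acc L ρ (if t = 0 then L + 1 else s2.N 24 0) * gr ∧
      s'.R 29 0 = thr L T t (s3.N 26 0) ∧ s'.N 30 0 = if t = 0 then L else s2.N 24 0)
    (Run.of_wp hd le_rfl ?_) (hpow1 _) ?_
  · simp only [scaleP, wp_cond, wp_seq, wp_setr, wp_setn]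
    simp only [thr]
    simp [f17, f18, f24, f26, hpar4.T_eq]
    refine ⟨fun h => ?_, fun h => ?_⟩
    · simp [h, hpar4.acc_eq]
    · simp [h, hpar4.acc_eq _ (show s2.N 24 0 ≤ L + 1 by omega)]
  rintro s5 ⟨hF5, he, hτ, hlam⟩
  have g27 : s5.N 27 0 = s3.N 24 0 * s3.N 26 0 := by rw [hF5.n _ (by omega), hκ]
  have g27x : s5.X 27 = s4.X 27 := hF5.x_fun (by omega)
  have g20 : s5.R 20 0 = gr' := by rw [hF5.r _ (by omega), f20]
  have hpar5 := hpar4.frame (by omega) hF5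
  have hlamL : (if t = 0 then L else s2.N 24 0) ≤ L := by split_ifs <;> omega
  have hD : ∀ l ≤ L, 24 * (s5.R 16 l * s5.R 20 0) = 24 * (acc L ρ l * gr') := fun l hl => by
    rw [hpar5.acc_eq l (by omega), g20]
  refine Run.then (pickP_run hd (A := p ^ 3) (hpow1 3) (by rw [g27]; exact hκp) hlam
    (by have := hpow 1 3 (by norm_num); rw [pow_one] at this; omega) (fun l hl => ?_)) (le_of_eq (by ring)) ?_
  · rw [hD l (by omega)]
    exact mul_nonneg (by norm_num) (mul_nonneg (acc_nonneg hpar.ρ_nonneg) hgr0)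
  rintro s6 ⟨hF6, hc, hpick⟩
  refine (meansP_run hd (A := p ^ 3) (hpow1 3) (by rw [hF6.n _ (by omega), g27]; exact hκp)
    (by omega)).mono ((by ring : p ^ 3 * p ^ 3 = p ^ 6).trans_le (hpow _ _ (by norm_num))) ?_
  rintro s7 ⟨hF7, hc7, hmean⟩
  refine ⟨((hF14.trans (hF5.mono (by omega))).trans (hF6.mono (by omega))).trans
    (hF7.mono (by omega)), by omega, s2.N 24 0, s3.N 26 0, s3.N 25, s4.X 27, s6.N 32, ?_, ?_, ?_, ?_, ?_⟩
  · have h19 : s1.N 19 = s.N 19 := hF1.n_fun (by omega)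
    have hfil : ∀ l, {q ∈ range (p * p) | s1.N 19 (s1.N 23 q) = l} =
        {q ∈ range (p * p) | (s.lists L 19).len (nbr p m z (q / p) (q % p) m) = l} := fun l =>
      Finset.filter_congr fun q hq => by rw [h19, hnb q (Finset.mem_range.1 hq)]; rfl
    simp only [hfil] at hsel
    exact hsel
  · intro P
    rw [hcol P]
    congr 1
    refine Finset.filter_congr fun q hq => ?_
    rw [hF2.n _ (by omega), hF2.n _ (by omega), hnb q (Finset.mem_range.1 hq), hF1.n _ (by omega)]
    rfl
  · intro u hu a ha
    rw [e24] at hx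
    rw [hx u hu a ha, hF3.x _ (by omega), hF2.x _ (by omega), hF1.x _ (by omega)]
    rfl
  · rw [hc7]
    rw [g27x, g27, he, hτ, e24] at hpick
    rcases hpick with h | ⟨lam, h1, h2, h3, h4, h5⟩
    · exact .inl h
    · dsimp only at h4 h5
      rw [hD lam (by omega)] at h4
      refine .inr ⟨lam, h1, h2, h3, h4, fun h => ?_⟩
      have := h5 h
      rwa [hD (lam + 1) (by omega)] at this
  · intro i hi
    rw [hmean i (by omega), hF6.x_fun (by omega), g27x, hF6.n _ (by omega), g27, e24,
      hF6.r _ (by omega), he]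

theorem writeP_run (hd : 1 ≤ d) {L A z : ℕ} (hA : 1 ≤ A) (hz : s.N 22 0 = z) (hc : s.N 33 0 ≤ A) :
    Run d (writeP L) s A fun s' => Frame 21 s s' ∧ s'.N 22 0 = z ∧ s'.N 21 z = s.N 33 0 ∧
      (∀ i < s.N 33 0, s'.X 21 (L * z + i) = s.X 32 i) ∧ (∀ z' ≠ z, s'.N 21 z' = s.N 21 z') ∧
      ∀ i < L * z, s'.X 21 i = s.X 21 i := by
  refine Run.then (B' := A) (P := fun t => Frame 21 s t ∧ t.N 22 0 = z ∧ t.N 33 0 = s.N 33 0 ∧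
    (∀ i < s.N 33 0, t.X 21 (L * z + i) = s.X 32 i) ∧ (∀ z', t.N 21 z' = s.N 21 z') ∧
      ∀ i < L * z, t.X 21 i = s.X 21 i) ?_ le_rfl ?_
  · refine Run.forC hd (s.N 33 0) hA le_rfl hc (by omega) (fun j t => Frame 21 s t ∧ t.N 40 0 = j ∧
      t.N 22 0 = z ∧ t.N 33 0 = s.N 33 0 ∧ t.X 32 = s.X 32 ∧
      (∀ i < j, t.X 21 (L * z + i) = s.X 32 i) ∧ (∀ z', t.N 21 z' = s.N 21 z') ∧
      ∀ i < L * z, t.X 21 i = s.X 21 i) ?_ ?_ ?_ ?_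
    · simp [hz]
    · rintro j t hj ⟨hF, h1, h2, h3, -⟩
      simp [h1, h3]
    · rintro j t hj ⟨hF, h1, h2, h3, h4, h5, h6, h7⟩
      refine Run.of_wp hd le_rfl ?_
      simp [hF, h1, h2, h3, h4, h6]
      refine ⟨fun i hi => ?_, fun i hi => ?_⟩
      · split_ifs with h
        · rw [h]
        · exact h5 i (by omega)
      · rw [if_neg (by omega), h7 i hi]
    · rintro t ⟨hF, h1, h2, h3, h4, h5, h6, h7⟩
      exact ⟨hF, h2, h3, h5, h6, h7⟩
  · rintro t ⟨hF, h2, h3, h5, h6, h7⟩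
    refine Run.of_wp hd hA ?_
    simp [hF, h2, h3, h6]
    exact ⟨h5, fun z' hz' h => absurd h hz', h7⟩

theorem copyP_run (hd : 1 ≤ d) {L N A : ℕ} (hA : 1 ≤ A) (hN : s.N 13 0 = N) (hNA : N ≤ A)
    (hLA : L * N ≤ A) : Run d (copyP L) s A fun s' => Frame 18 s s' ∧ s'.R 18 0 = s.R 20 0 ∧
      (∀ z < N, s'.N 19 z = s.N 21 z) ∧ ∀ i < L * N, s'.X 19 i = s.X 21 i := by
  refine Run.wp_seq hd hA ?_
  simp only [wp_setr]
  refine Run.then (B' := A) (P := fun t => Frame 18 s t ∧ t.R 18 0 = s.R 20 0 ∧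
    t.N 21 = s.N 21 ∧ ∀ i < L * N, t.X 19 i = s.X 21 i) ?_ le_rfl ?_
  · refine Run.forC hd (L * N) hA le_rfl hLA (by omega) (fun j t => Frame 18 s t ∧ t.N 40 0 = j ∧
      t.R 18 0 = s.R 20 0 ∧ t.N 21 = s.N 21 ∧ t.X 21 = s.X 21 ∧ ∀ i < j, t.X 19 i = s.X 21 i)
      ?_ ?_ ?_ ?_
    · simp
    · rintro j t hj ⟨hF, h1, -⟩
      simp [h1, hF.n, hN]
    · rintro j t hj ⟨hF, h1, h2, h3, h4, h5⟩
      refine Run.of_wp hd le_rfl ?_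
      simp [hF, h1, h2, h3, h4]
      intro i hi
      split_ifs with h
      · rw [h]
      · exact h5 i (by omega)
    · rintro t ⟨hF, h1, h2, h3, h4, h5⟩
      exact ⟨hF, h2, h3, h5⟩
  · rintro t ⟨hF, h2, h3, h4⟩
    refine Run.forC hd N hA le_rfl hNA (by omega) (fun j t => Frame 18 s t ∧ t.N 40 0 = j ∧
      t.R 18 0 = s.R 20 0 ∧ t.N 21 = s.N 21 ∧ (∀ i < L * N, t.X 19 i = s.X 21 i) ∧
      ∀ i < j, t.N 19 i = s.N 21 i) ?_ ?_ ?_ ?_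
    · simpa [hF, h2, h3] using h4
    · rintro j t hj ⟨hF, h1, -⟩
      simp [h1, hF.n, hN]
    · rintro j t hj ⟨hF, h1, h2, h3, h4, h5⟩
      refine Run.of_wp hd le_rfl ?_
      simp [hF, h1, h2, h3]
      refine ⟨h4, fun i hi => ?_⟩
      split_ifs with h
      · rw [h]
      · exact h5 i (by omega)
    · rintro t ⟨hF, h1, h2, h3, h4, h5⟩
      exact ⟨hF, h2, h5, h4⟩

/-- The total loss of accuracy over all rounds is a constant factor. -/
theorem one_add_inv_pow_le {T : ℕ} (hT : 1 ≤ T) : (1 + 1 / T : ℝ) ^ (T + 1) ≤ 8 := by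
  have hT' : (1 : ℝ) ≤ T := by exact_mod_cast hT
  have h1 : (1 + 1 / T : ℝ) ≤ Real.exp (1 / T) := by
    rw [add_comm]; exact Real.add_one_le_exp _
  calc (1 + 1 / T : ℝ) ^ (T + 1) ≤ Real.exp (1 / T) ^ (T + 1) := by gcongr
    _ = Real.exp (1 + 1 / T) := by
        rw [← Real.exp_nat_mul]; congr 1; push_cast; field_simp
    _ ≤ Real.exp (1 + 1) := by
        gcongr
        rw [div_le_one (by linarith)]; exact hT'
    _ = Real.exp 1 * Real.exp 1 := Real.exp_add _ _
    _ ≤ 8 := by nlinarith [Real.exp_one_lt_d9, Real.exp_pos 1]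

open scoped Classical in
/-- The list of the vertex `0` after the last round has a centre near every ball in which many
vertices start. -/
theorem roundsP_run (hd : 1 ≤ d) {L p m T : ℕ} {ρ : ℝ} (hpar : RoundPar L p m T ρ s)
    (hp : p.Prime) (hNT : p ^ m ≤ 2 ^ T) (hmp : (m / p : ℝ) ≤ 1 / (160 * L * T))
    (h1 : ∀ z < p ^ m, s.N 19 z = 1) :
    Run d (roundsP L) s (p * (p ^ m * p ^ 9)) fun s' => Frame 17 s s' ∧ s'.N 19 0 ≤ L ∧
      ∀ x : V, (2 / L * (p ^ m : ℕ) : ℝ) ≤ #{z ∈ range (p ^ m) | ‖s.X 19 (L * z) - x‖ ≤ ρ} →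
        ∃ a < s'.N 19 0, ‖s'.X 19 a - x‖ ≤ acc L ρ 1 * 8 := by
  have hp2 := hpar.two_le
  have hL := hpar.L_pos
  have hpow : ∀ i j, i ≤ j → p ^ i ≤ p ^ j := fun i j h => Nat.pow_le_pow_right (by omega) h
  have hpow1 : ∀ i, 1 ≤ p ^ i := fun i => Nat.one_le_pow _ _ (by omega)
  have hB : 1 ≤ p ^ m * p ^ 9 := Nat.one_le_iff_ne_zero.2 (by positivity)
  set Γ : ℕ → ℕ → ℕ := fun z q => nbr p m z (q / p) (q % p) m with hΓdef
  have hΓ : IsSampler (p ^ m) (p * p) (m / p) Γ := isSampler_nbr hp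
  refine Run.wp_seq hd (hB.trans (Nat.le_mul_of_pos_left _ (by omega))) ?_
  simp only [wp_setr]
  refine Run.forC hd (T + 1) (A := p) (by omega) hB hpar.T_lt le_rfl (fun t u => Frame 17 s u ∧
    u.N 17 0 = t ∧ u.R 18 0 = (1 + 1 / T : ℝ) ^ t ∧ ∃ X : ℕ → Lists V, X 0 = s.lists L 19 ∧
      X t = u.lists L 19 ∧ (X t).Sep L ρ ((1 + 1 / T) ^ t) (p ^ m) ∧ ∀ t' < t, ∀ z < p ^ m,
        StepAt L T ρ ((1 + 1 / T) ^ t') ((1 + 1 / T) ^ (t' + 1)) t' (p * p) (Γ z) (X t')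
          ((X (t' + 1)).len z) ((X (t' + 1)).el z)) ?_ ?_ ?_ ?_
  · simp
    refine ⟨fun _ => s.lists L 19, rfl, by simp [State.lists], fun z hz => ?_⟩
    have : (s.lists L 19).len z = 1 := h1 z hz
    rw [this]
    exact ⟨hL, fun a ha b hb hab => by omega⟩
  · rintro t u ht ⟨hF, h2, -⟩
    simp [h2, hF.n, hpar.T_eq]
  · rintro t u ht ⟨hF, h2, h3, X, hX0, hXt, hsep, hstep⟩
    refine Run.wp_seq hd hB ?_
    simp only [wp_setr]
    set v := u.setR 20 ((0 : NExp).eval u.nat)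
      ((ra 18 0 * (rn 1 + rn 1 / rn (na 14 0))).eval u) with hv
    have hFv : Frame 17 s v := by simp [hv, hF]
    have hparv := hpar.frame le_rfl hFv
    have v17 : v.N 17 0 = t := by simp [hv, h2]
    have v18 : v.R 18 0 = (1 + 1 / T : ℝ) ^ t := by simp [hv, h3]
    have v20 : v.R 20 0 = (1 + 1 / T : ℝ) ^ (t + 1) := by
      simp [hv, h3, hF.n, hpar.T_eq, pow_succ]
    have vX : v.lists L 19 = X t := by rw [hXt]; simp [hv, State.lists]
    clear_value v
    have hspec : ∀ z < p ^ m, ∀ {len' el'}, StepAt L T ρ ((1 + 1 / T) ^ t) ((1 + 1 / T) ^ (t + 1)) t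
        (p * p) (Γ z) (X t) len' el' → len' ≤ L ∧ ∀ a < len', ∀ b < len', a ≠ b →
          20 * (acc L ρ len' * (1 + 1 / T) ^ (t + 1)) < ‖el' a - el' b‖ := by
      intro z hz len' el' h
      refine (h.spec hL hpar.T_ge hpar.ρ_nonneg (by positivity) (pow_succ _ _) (by positivity)
        ?_ (hΓ.1 z hz) hsep).1
      rintro rfl q hq
      rw [hX0]
      exact h1 _ (hΓ.1 z hz q hq)
    refine Run.then (B' := p ^ m * p ^ 9) (P := fun w => Frame 21 v w ∧ ∀ z < p ^ m, w.N 21 z ≤ L ∧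
      StepAt L T ρ ((1 + 1 / T) ^ t) ((1 + 1 / T) ^ (t + 1)) t (p * p) (Γ z) (X t) (w.N 21 z)
        (fun a => w.X 21 (L * z + a))) ?_ le_rfl ?_
    · refine Run.forC hd (p ^ m) (hpow1 m) (hpow1 9) le_rfl le_rfl (fun z w => Frame 21 v w ∧
        w.N 22 0 = z ∧ ∀ z' < z, w.N 21 z' ≤ L ∧
        StepAt L T ρ ((1 + 1 / T) ^ t) ((1 + 1 / T) ^ (t + 1)) t (p * p) (Γ z') (X t) (w.N 21 z')
          (fun a => w.X 21 (L * z' + a))) ?_ ?_ ?_ ?_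
      · simp
      · rintro z w hz ⟨hF, h4, -⟩
        simp [h4, hF.n, hparv.N_eq]
      · rintro z w hz ⟨hF, h4, h5⟩
        refine Run.then (stepP_run hd (hparv.frame (by omega) hF) h4 hz (by rw [hF.n _ (by omega), v17])
          (by rw [hF.r _ (by omega), v18]) (by rw [hF.r _ (by omega), v20]) (by positivity)) le_rfl ?_
        rintro w1 ⟨hF1, hc, hst⟩
        have hwX : w.lists L 19 = X t := by
          rw [← vX, State.lists, State.lists, hF.n_fun (by omega), hF.x_fun (by omega)]
        rw [hwX] at hst
        have hlen := (hspec z hz hst).1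
        refine (writeP_run hd (hpow1 9) (by rw [hF1.n _ (by omega), h4])
          (hc.trans (hpow _ _ (by norm_num)))).mono le_rfl ?_
        rintro w2 ⟨hF2, g22, gN, gX, gN', gX'⟩
        refine ⟨g22, by simp [(hF.trans (hF1.mono (by omega))).trans hF2], by simp, fun z' hz' => ?_⟩
        simp only [N_setN, X_setN]
        rw [if_neg (by omega)]
        rcases Nat.lt_succ_iff_lt_or_eq.1 hz' with h6 | rfl
        · have h7 := h5 z' h6
          rw [gN' z' h6.ne, hF1.n _ (by omega)]
          refine ⟨h7.1, h7.2.congr fun i hi => ?_⟩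
          rw [gX', hF1.x _ (by omega)]
          calc L * z' + i < L * z' + L := by omega
            _ = L * (z' + 1) := by ring
            _ ≤ L * z := Nat.mul_le_mul_left _ h6
        · rw [gN]
          exact ⟨hlen, hst.congr fun i hi => gX i hi⟩
      · rintro w ⟨hF, -, h⟩
        exact ⟨hF, h⟩
    · rintro w ⟨hFw, hw⟩
      refine (copyP_run hd hB (L := L) (by rw [hFw.n _ (by omega), hparv.N_eq])
        (Nat.le_mul_of_pos_right _ (hpow1 9)) ?_).mono le_rfl ?_
      · rw [mul_comm]
        refine Nat.mul_le_mul_left _ (hpar.L_lt.le.trans ?_)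
        have := hpow 1 9 (by norm_num)
        rwa [pow_one] at this
      rintro y ⟨hFy, g18, gN, gX⟩
      have hlistlen : ∀ z < p ^ m, (y.lists L 19).len z = w.N 21 z := gN
      have hliststep : ∀ z < p ^ m, StepAt L T ρ ((1 + 1 / T) ^ t) ((1 + 1 / T) ^ (t + 1)) t (p * p)
          (Γ z) (X t) ((y.lists L 19).len z) ((y.lists L 19).el z) := by
        intro z hz
        rw [hlistlen z hz]
        refine (hw z hz).2.congr fun i hi => gX _ ?_
        calc L * z + i < L * z + L := by have := (hw z hz).1; omega
            _ = L * (z + 1) := by ring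
            _ ≤ L * p ^ m := Nat.mul_le_mul_left _ hz
      refine ⟨by rw [hFy.n _ (by omega), hFw.n _ (by omega), v17], ?_⟩
      refine ⟨?_, by simp, ?_, Function.update X (t + 1) (y.lists L 19), ?_, ?_, ?_, ?_⟩
      · simp [(hFv.trans (hFw.mono (by omega))).trans (hFy.mono (by omega))]
      · simp [g18, hFw.r, v20]
      · rw [Function.update_of_ne (by omega), hX0]
      · rw [Function.update_self]; simp [State.lists]
      · rw [Function.update_self]
        exact fun z hz => hspec z hz (hliststep z hz)
      · intro t' ht' z hz
        rcases Nat.lt_succ_iff_lt_or_eq.1 ht' with h6 | rfl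
        · rw [Function.update_of_ne (by omega), Function.update_of_ne (by omega)]
          exact hstep t' h6 z hz
        · rw [Function.update_of_ne (by omega), Function.update_self]
          exact hliststep z hz
  · rintro u ⟨hF, -, -, X, hX0, hXT, -, hstep⟩
    have key := near_of_rounds (g := p * p) (N := p ^ m) hL hpar.T_ge hpar.ρ_nonneg (by positivity)
      hΓ (by positivity) hmp hNT (by rw [hX0]; exact h1)
      (fun t ht z hz => hstep t (by omega) z hz)
    rw [hXT, hX0] at key
    refine ⟨hF, key.1 0 (hpow1 m), fun x hx => ?_⟩
    obtain ⟨a, ha, hax⟩ := key.2 x hx 0 (hpow1 m)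
    refine ⟨a, ha, ?_⟩
    have h2 : u.X 19 a = (u.lists L 19).el 0 a := by simp [State.lists]
    rw [h2]
    refine hax.trans (mul_le_mul (acc_anti hpar.ρ_nonneg (by omega))
      (one_add_inv_pow_le (hL.trans hpar.T_ge)) (by positivity) (acc_nonneg hpar.ρ_nonneg))

end Rounds

/-! ### Parameters of the graph -/

section Params

/-- A constant that is large enough for the expansion of the graph. -/
@[irreducible] def bigC (L : ℕ) : ℕ := 2 ^ (2 * L + 20)

/-- The table of the powers of `p`, up to the first one that is at least `L` times the number of
points. -/
def powP (L : ℕ) : Cmd :=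
  setn 12 0 0 ;; setn 15 0 1 ;; setn 13 0 1 ;;
  .loop (.natLT (na 13 0) (mulE L (na 7 0))) (
    mulP 30 (na 11 0) (na 13 0) ;; setn 13 0 (na 30 0) ;; setn 12 0 (na 12 0 + 1) ;;
    setn 15 (na 12 0) (na 13 0))

/-- The table of the accuracies. -/
def accP (L : ℕ) : Cmd :=
  setr 16 (.lit (L + 1)) (ra 3 0) ;;
  forC 30 (.lit (L + 1)) (setr 16 (.lit L - na 30 0) (rn 100 * ra 16 (.lit (L + 1) - na 30 0)))

/-- All parameters: the degree is quadratic in a prime that exceeds a multiple of `b * b`, where `b`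
is the binary length of the number of vertices needed, and the number of rounds is linear in `b`. -/
def paramsP (L : ℕ) : Cmd :=
  sizeP 10 (mulE L (na 7 0)) ;; mulP 11 (na 10 0) (na 10 0) ;;
  nextPrimeP 11 (mulE (bigC L) (na 11 0)) ;; mulP 30 (na 11 0) (na 11 0) ;; setn 11 1 (na 30 0) ;;
  powP L ;; setn 14 0 (mulE 3 (na 10 0) + .lit (2 * L + 21)) ;; accP L

theorem bigC_bound (L : ℕ) : 160 * L * (2 * L + 24) ≤ bigC L := by
  have h1 : L ≤ 2 ^ L := Nat.lt_two_pow_self.le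
  have h2 : 1 ≤ 2 ^ L := Nat.one_le_two_pow
  have h3 : bigC L = 1048576 * (2 ^ L * 2 ^ L) := by rw [bigC, pow_add, two_mul, pow_add]; ring
  rw [h3]
  nlinarith

theorem bigC_pos (L : ℕ) : 0 < bigC L := by rw [bigC]; exact Nat.two_pow_pos _

variable {V : Type u} [NormedAddCommGroup V] [NormedSpace ℝ V] {d : ℕ} {s : State V}

theorem powP_run (hd : 1 ≤ d) {L p b A : ℕ} (hp : 2 ≤ p) (hpA : p + 1 ≤ A)
    (hpp : s.N 11 0 = p) (hb : L * s.N 7 0 < 2 ^ b) (hb1 : 1 ≤ b) (hbA : b ≤ A) :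
    Run d (powP L) s (A * A) fun s' => Frame 12 s s' ∧ ∃ m ≤ b, s'.N 12 0 = m ∧ s'.N 13 0 = p ^ m ∧
      (∀ j ≤ m, s'.N 15 j = p ^ j) ∧ L * s.N 7 0 ≤ p ^ m ∧ (m = 0 ∨ p ^ m ≤ p * (L * s.N 7 0)) := by
  have hA : 1 ≤ A := by omega
  have hAA : 1 ≤ A * A := by nlinarith
  refine Run.wp_seq hd hAA ?_
  simp only [wp_setn]
  refine Run.wp_seq hd hAA ?_
  simp only [wp_setn]
  refine Run.wp_seq hd hAA ?_
  simp only [wp_setn]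
  have hlt : ∀ {m}, p ^ m < L * s.N 7 0 → m < b := fun {m} h => by
    have : 2 ^ m < 2 ^ b := (Nat.pow_le_pow_left hp m).trans_lt (h.trans hb)
    exact (Nat.pow_lt_pow_iff_right (by norm_num)).1 this
  refine Run.loop hd hA hA (fun t => Frame 12 s t ∧ ∃ m ≤ b, t.N 12 0 = m ∧ t.N 13 0 = p ^ m ∧
      (∀ j ≤ m, t.N 15 j = p ^ j) ∧ (m = 0 ∨ p ^ m ≤ p * (L * s.N 7 0)))
      (fun t => b - t.N 12 0) ?_ ?_ le_rfl ?_ ?_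
  · simp
  · simp; omega
  · rintro t ⟨hF, m, hmb, h1, h2, h3, h4⟩ hlt'
    simp [h2, hF.n] at hlt'
    have hmb' := hlt hlt'
    refine Run.then (mulP_run hd 30 (na 11 0) (na 13 0) (x := p) (y := p ^ m)
      (by simp [hF.n, hpp]) (by simp [h2])) hpA ?_
    rintro t' ⟨hF', hm⟩
    refine Run.of_wp hd hA ?_
    have e12 : t'.N 12 0 = m := by rw [hF'.n _ (by omega), h1]
    have e15 : ∀ j, t'.N 15 j = t.N 15 j := hF'.n 15 (by omega)
    simp [hF.trans (hF'.mono (by omega)), hm, e12, e15]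
    refine ⟨⟨hmb', (pow_succ' _ _).symm, fun j hj => ?_, ?_⟩, by omega⟩
    · split_ifs with h
      · rw [h, pow_succ']
      · exact h3 j (by omega)
    · rw [pow_succ']
      exact Nat.mul_le_mul_left _ hlt'.le
  · rintro t ⟨hF, m, hmb, h1, h2, h3, h4⟩ hlt'
    simp [h2, hF.n] at hlt'
    exact ⟨hF, m, hmb, h1, h2, h3, hlt', h4⟩

theorem accP_run (hd : 1 ≤ d) {L A : ℕ} (hLA : L + 1 ≤ A) :
    Run d (accP L) s A fun s' => Frame 16 s s' ∧ ∀ l ≤ L + 1, s'.R 16 l = acc L (s.R 3 0) l := by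
  have hA : 1 ≤ A := by omega
  refine Run.wp_seq hd hA ?_
  simp only [wp_setr]
  refine Run.forC hd (L + 1) hA le_rfl hLA (by omega) (fun j t => Frame 16 s t ∧ t.N 30 0 = j ∧
    ∀ l, L + 1 - j ≤ l → l ≤ L + 1 → t.R 16 l = acc L (s.R 3 0) l) ?_ ?_ ?_ ?_
  · simp
    intro l h1 h2
    rw [if_pos (by omega), show l = L + 1 by omega]
    simp [acc]
  · rintro j t hj ⟨hF, h1, -⟩
    simp [h1]
  · rintro j t hj ⟨hF, h1, h2⟩
    refine Run.of_wp hd le_rfl ?_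
    simp [hF, h1]
    intro l h3 h4
    split_ifs with h
    · rw [h2 (L + 1 - j) le_rfl (by omega), h, acc_succ (L := L) (l := L - j) _ (by omega),
        show L - j + 1 = L + 1 - j by omega]
    · exact h2 l (by omega) h4
  · rintro t ⟨hF, -, h⟩
    exact ⟨hF, fun l hl => h l (by omega) hl⟩

theorem paramsP_run (hd : 1 ≤ d) {L n b q : ℕ} (hL : 1 ≤ L) (hn : s.N 7 0 = n) (hn1 : 1 ≤ n)
    (hb : Nat.size (L * n) = b) (hq : 2 * (bigC L * (b * b)) = q) (hρ : 0 ≤ s.R 3 0) :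
    Run d (paramsP L) s (q ^ 3) fun s' => Frame 10 s s' ∧ ∃ p m T, RoundPar L p m T (s.R 3 0) s' ∧
      p.Prime ∧ p ≤ q ∧ p ^ m ≤ 2 ^ T ∧ (m / p : ℝ) ≤ 1 / (160 * L * T) ∧ L * n ≤ p ^ m ∧
      p ^ m ≤ p * (L * n) := by
  have hLn : 1 ≤ L * n := Nat.mul_pos hL hn1
  have hlt : L * n < 2 ^ b := hb ▸ Nat.lt_size_self _
  have hb1 : 1 ≤ b := by
    rcases Nat.eq_zero_or_pos b with h | h
    · rw [h] at hlt; omega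
    · exact h
  obtain ⟨D, hD⟩ : ∃ D, bigC L * (b * b) = D := ⟨_, rfl⟩
  rw [hD] at hq
  have hbound := bigC_bound L
  have hbb : b ≤ b * b := Nat.le_mul_of_pos_left _ hb1
  have hkey : 160 * L * (3 * b + (2 * L + 21)) * b ≤ D := by
    rw [← hD]
    have h1 : 3 * b + (2 * L + 21) ≤ (2 * L + 24) * b := by
      have : 2 * L + 21 ≤ (2 * L + 21) * b := Nat.le_mul_of_pos_right _ hb1
      linarith
    calc 160 * L * (3 * b + (2 * L + 21)) * b ≤ 160 * L * ((2 * L + 24) * b) * b := by gcongr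
      _ = 160 * L * (2 * L + 24) * (b * b) := by ring
      _ ≤ bigC L * (b * b) := by gcongr
  have hTD : 160 * (3 * b + (2 * L + 21)) ≤ D := by
    refine le_trans ?_ hkey
    calc 160 * (3 * b + (2 * L + 21)) = 160 * 1 * (3 * b + (2 * L + 21)) * 1 := by ring
      _ ≤ 160 * L * (3 * b + (2 * L + 21)) * b := by gcongr
  have hq1 : 1 ≤ q := by omega
  have hqq : q ≤ q ^ 3 := Nat.le_self_pow (by norm_num) q
  have hqq2 : (q + 1) * (q + 1) ≤ q ^ 3 := by
    calc (q + 1) * (q + 1) ≤ (2 * q) * (2 * q) := Nat.mul_le_mul (by omega) (by omega)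
      _ = 4 * (q * q) := by ring
      _ ≤ q * (q * q) := Nat.mul_le_mul_right _ (by omega)
      _ = q ^ 3 := by ring
  have hqq3 : q + 1 ≤ q ^ 3 := (Nat.le_mul_of_pos_left _ (by omega)).trans hqq2
  refine Run.then (sizeP_run hd 10 (mulE L (na 7 0)) (x := L * n) (by simp [hn])) (by omega) ?_
  rintro s1 ⟨hF1, h1⟩
  rw [hb] at h1
  refine Run.then (mulP_run hd 11 (na 10 0) (na 10 0) (x := b) (y := b) (by simp [h1]) (by simp [h1]))
    (by omega) ?_
  rintro s2 ⟨hF2, h2⟩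
  refine Run.then (nextPrimeP_run hd 11 (mulE (bigC L) (na 11 0)) (x := D) (by simp [h2, hD])
    (by omega)) (by rw [hq]) ?_
  rintro s3 ⟨hF3, hprime, hp1, hp2⟩
  set p := s3.N 11 0 with hp
  refine Run.then (mulP_run hd 30 (na 11 0) (na 11 0) (x := p) (y := p) (by simp [hp]) (by simp [hp]))
    (by omega) ?_
  rintro s4 ⟨hF4, h4⟩
  refine Run.wp_seq hd (by omega) ?_
  simp only [wp_setn]
  set s5 := s4.setN 11 ((1 : NExp).eval s4.nat) ((na 30 0).eval s4.nat) with hs5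
  have hF35 : Frame 11 s3 s5 := by simp [hs5, hF4.mono (show 11 ≤ 30 by omega)]
  have g0 : s5.N 11 0 = p := by simp [hs5, hF4.n, hp]
  have g1 : s5.N 11 1 = p * p := by simp [hs5, h4]
  have hF15 : Frame 11 s1 s5 := (hF2.trans hF3).trans hF35
  have hF05 : Frame 10 s s5 := hF1.trans (hF15.mono (by omega))
  clear_value s5
  have hn5 : s5.N 7 0 = n := by rw [hF05.n _ (by omega), hn]
  refine Run.then (powP_run hd (L := L) (b := b) (A := q + 1) hprime.two_le (by omega) g0
    (by rw [hn5]; exact hlt) hb1 (by omega)) hqq2 ?_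
  rintro s6 ⟨hF6, m, hmb, k1, k2, k3, k4, k5⟩
  rw [hn5] at k4 k5
  refine Run.wp_seq hd (by omega) ?_
  simp only [wp_setn]
  set s7 := s6.setN 14 ((0 : NExp).eval s6.nat)
    ((mulE 3 (na 10 0) + .lit (2 * L + 21)).eval s6.nat) with hs7
  have hT : s7.N 14 0 = 3 * b + (2 * L + 21) := by
    simp [hs7, hF6.n, hF15.n, h1]
  have hF67 : Frame 14 s6 s7 := by simp [hs7]
  have l12 : s7.N 12 0 = m := by rw [hF67.n _ (by omega), k1]
  have l13 : s7.N 13 0 = p ^ m := by rw [hF67.n _ (by omega), k2]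
  have l15 : ∀ j ≤ m, s7.N 15 j = p ^ j := fun j hj => by
    rw [← k3 j hj, hs7]; simp
  have hF57 : Frame 12 s5 s7 := hF6.trans (hF67.mono (by omega))
  clear_value s7
  have hF07 : Frame 10 s s7 := hF05.trans (hF57.mono (by omega))
  refine (accP_run hd (L := L) (A := q ^ 3) (by omega)).mono le_rfl ?_
  rintro s8 ⟨hF8, hacc⟩
  have hmT : 160 * L * (3 * b + (2 * L + 21)) * m ≤ p :=
    (Nat.mul_le_mul_left _ hmb).trans (hkey.trans hp1.le)
  refine ⟨hF07.trans (hF8.mono (by omega)), p, m, 3 * b + (2 * L + 21), ?_, hprime, by omega, ?_, ?_, k4,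
    ?_⟩
  · refine ⟨⟨hprime.two_le, ?_, ?_, ?_, ?_, ?_⟩, hL, by omega, by omega, by omega, ?_, ?_, hρ, ?_⟩
    · omega
    · rw [hF8.n _ (by omega), hF57.n _ (by omega), g0]
    · rw [hF8.n _ (by omega), hF57.n _ (by omega), g1]
    · rw [hF8.n _ (by omega), l12]
    · intro j hj
      rw [hF8.n _ (by omega), l15 j hj]
    · rw [hF8.n _ (by omega), l13]
    · rw [hF8.n _ (by omega), hT]
    · intro l hl
      rw [hacc l hl, hF07.r _ (by omega)]
  · rcases k5 with rfl | k5
    · simpa using Nat.one_le_two_pow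
    · calc p ^ m ≤ p * (L * n) := k5
        _ ≤ (2 * D) * 2 ^ b := Nat.mul_le_mul hp2 hlt.le
        _ = 2 ^ (2 * L + 21) * (b * b) * 2 ^ b := by rw [← hD, bigC]; ring
        _ ≤ 2 ^ (2 * L + 21) * (2 ^ b * 2 ^ b) * 2 ^ b := by
            have : b ≤ 2 ^ b := Nat.lt_two_pow_self.le
            gcongr
        _ = 2 ^ (3 * b + (2 * L + 21)) := by
            rw [pow_add, show 3 * b = b + b + b by ring, pow_add, pow_add]; ring
  · have hp0 : (0 : ℝ) < p := by exact_mod_cast hprime.pos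
    have hL0 : (0 : ℝ) < L := by exact_mod_cast hL
    rw [div_le_div_iff₀ hp0 (by positivity)]
    have : ((160 * L * (3 * b + (2 * L + 21)) * m : ℕ) : ℝ) ≤ p := by exact_mod_cast hmT
    push_cast at this ⊢
    linarith
  · rcases k5 with rfl | k5
    · rw [pow_zero]; exact Nat.mul_pos hprime.pos hLn
    · exact k5

end Params

/-! ### Replacing the weights by multiplicities, and the centres of one block -/

section Slots

open Finset
open scoped Classical

/-- The weight of the points `x 0, …, x (n - 1)` in a ball. -/
noncomputable def bw {V : Type*} [NormedAddCommGroup V] (x : ℕ → V) (w : ℕ → ℝ) (n : ℕ) (p : V)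
    (ρ : ℝ) : ℝ := ∑ i ∈ range n, if ‖x i - p‖ ≤ ρ then w i else 0

/-- The vertex `z` of `N` vertices receives the point `i`: the weight of the points before `i` is at
most the fraction `z / N` of the total weight `W`, and with the point `i` it exceeds this
fraction. -/
def Slot (w : ℕ → ℝ) (W : ℝ) (N z i : ℕ) : Prop :=
  (∑ j ∈ range i, w j) * N ≤ z * W ∧ z * W < (∑ j ∈ range (i + 1), w j) * N

/-- Assigns a point to every vertex. -/
def slotsP (L : ℕ) : Cmd :=
  setn 30 0 0 ;; setn 31 0 0 ;; setr 30 0 (ra 2 (na 6 0)) ;;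
  .loop (.natLT (na 31 0) (na 13 0)) (
    .cond (.realLE (ra 30 0 * rn (na 13 0)) (rn (na 31 0) * ra 7 0))
      (setn 30 0 (na 30 0 + 1) ;; setr 30 0 (ra 30 0 + ra 2 (na 6 0 + na 30 0)))
      (setv 19 (mulE L (na 31 0)) (va 2 (na 6 0 + na 30 0)) ;; setn 19 (na 31 0) 1 ;;
        setn 31 0 (na 31 0 + 1)))

/-- Up to rounding, every point receives a fraction of the vertices that corresponds to its
weight. -/
theorem card_slots_ge {V : Type*} [NormedAddCommGroup V] {w : ℕ → ℝ} {W : ℝ} {N n L : ℕ}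
    {x f : ℕ → V} (hw : ∀ i, 0 ≤ w i) (hW : ∑ i ∈ range n, w i = W) (hW0 : 0 < W) (hL : 1 ≤ L)
    (hN : L * n ≤ N) (hf : ∀ z < N, ∃ i < n, f z = x i ∧ Slot w W N z i) {p : V} {ρ : ℝ}
    (h : 3 / L * W ≤ bw x w n p ρ) : (2 / L * N : ℝ) ≤ #{z ∈ range N | ‖f z - p‖ ≤ ρ} := by
  have hL0 : (0 : ℝ) < L := by exact_mod_cast hL
  set c : ℕ → ℕ := fun i => ⌈(∑ j ∈ range i, w j) * N / W⌉₊ with hc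
  have hmono : Monotone c := by
    intro i j hij
    refine Nat.ceil_le_ceil ?_
    have : ∑ k ∈ range i, w k ≤ ∑ k ∈ range j, w k :=
      Finset.sum_le_sum_of_subset_of_nonneg (Finset.range_mono hij) fun k _ _ => hw k
    gcongr
  have hslot : ∀ z i, Slot w W N z i ↔ z ∈ Ico (c i) (c (i + 1)) := by
    intro z i
    rw [Slot, Finset.mem_Ico, hc, Nat.ceil_le, Nat.lt_ceil, div_le_iff₀ hW0, lt_div_iff₀ hW0]
  set G : Finset ℕ := {i ∈ range n | ‖x i - p‖ ≤ ρ} with hG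
  have hdisj : ∀ {i j z}, z ∈ Ico (c i) (c (i + 1)) → z ∈ Ico (c j) (c (j + 1)) → i = j := by
    intro i j z hi hj
    rw [Finset.mem_Ico] at hi hj
    by_contra hne
    rcases Nat.lt_or_gt_of_ne hne with h | h
    · have := hmono (Nat.succ_le_of_lt h)
      simp only [Nat.succ_eq_add_one] at this
      omega
    · have := hmono (Nat.succ_le_of_lt h)
      simp only [Nat.succ_eq_add_one] at this
      omega
  have hcn : c n = N := by
    have : (∑ j ∈ range n, w j) * N / W = N := by rw [hW]; field_simp
    simp only [hc, this, Nat.ceil_natCast]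
  have hsub : G.biUnion (fun i => Ico (c i) (c (i + 1))) ⊆ {z ∈ range N | ‖f z - p‖ ≤ ρ} := by
    intro z hz
    obtain ⟨i, hi, hzi⟩ := Finset.mem_biUnion.1 hz
    obtain ⟨hi1, hi2⟩ := Finset.mem_filter.1 hi
    have hzN : z < N := by
      have h1 := (Finset.mem_Ico.1 hzi).2
      have h2 : c (i + 1) ≤ c n := hmono (by simpa using hi1)
      omega
    obtain ⟨j, hj, hfz, hs⟩ := hf z hzN
    rw [← hdisj hzi ((hslot z j).1 hs)] at hfz
    exact Finset.mem_filter.2 ⟨Finset.mem_range.2 hzN, by rw [hfz]; exact hi2⟩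
  have hcard := Finset.card_le_card hsub
  rw [Finset.card_biUnion fun i _ j _ hij => Finset.disjoint_left.2 fun z hz hz' =>
    hij (hdisj hz hz')] at hcard
  have hcard' : (∑ i ∈ G, (#(Ico (c i) (c (i + 1))) : ℝ)) ≤ #{z ∈ range N | ‖f z - p‖ ≤ ρ} := by
    exact_mod_cast hcard
  refine le_trans ?_ hcard'
  have hone : ∀ i, w i * (N / W) - 1 ≤ (#(Ico (c i) (c (i + 1))) : ℝ) := by
    intro i
    rw [Nat.card_Ico, Nat.cast_sub (hmono (Nat.le_succ i))]
    have h1 : (c i : ℝ) < (∑ j ∈ range i, w j) * N / W + 1 := by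
      refine Nat.ceil_lt_add_one ?_
      have : 0 ≤ ∑ j ∈ range i, w j := Finset.sum_nonneg fun j _ => hw j
      positivity
    have h2 : (∑ j ∈ range (i + 1), w j) * N / W ≤ c (i + 1) := Nat.le_ceil _
    rw [Finset.sum_range_succ] at h2
    have h3 : (∑ j ∈ range i, w j + w i) * N / W = (∑ j ∈ range i, w j) * N / W + w i * (N / W) := by
      ring
    linarith
  have hsum : ∑ i ∈ G, (w i * (N / W) - 1) ≤ ∑ i ∈ G, (#(Ico (c i) (c (i + 1))) : ℝ) :=
    Finset.sum_le_sum fun i _ => hone i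
  refine le_trans ?_ hsum
  rw [Finset.sum_sub_distrib, ← Finset.sum_mul, Finset.sum_const, nsmul_eq_mul, mul_one]
  have hGn : (#G : ℝ) ≤ n := by
    have := Finset.card_le_card (Finset.filter_subset (fun i => ‖x i - p‖ ≤ ρ) (range n))
    rw [Finset.card_range] at this
    exact_mod_cast this
  have hGw : ∑ i ∈ G, w i = bw x w n p ρ := by rw [hG, Finset.sum_filter, bw]
  rw [hGw]
  have h1 : 3 / L * W * (N / W) ≤ bw x w n p ρ * (N / W) := by gcongr
  have h2 : 3 / L * W * (N / W) = 3 / L * (N : ℝ) := by field_simp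
  have h3 : (n : ℝ) ≤ 1 / L * N := by
    rw [div_mul_eq_mul_div, one_mul, le_div_iff₀ hL0]
    have : ((L * n : ℕ) : ℝ) ≤ N := by exact_mod_cast hN
    push_cast at this
    linarith
  have h4 : (3 / L * N : ℝ) = 2 / L * N + 1 / L * N := by ring
  linarith

variable {V : Type u} [NormedAddCommGroup V] [NormedSpace ℝ V] {d : ℕ} {s : State V}

theorem slotsP_run (hd : 1 ≤ d) {L N n σ : ℕ} {W : ℝ} (hL : 1 ≤ L) (hN : s.N 13 0 = N)
    (hN1 : 1 ≤ N) (hσ : s.N 6 0 = σ) (hWr : s.R 7 0 = W)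
    (hW : ∑ i ∈ range n, s.R 2 (σ + i) = W) (hW0 : 0 < W) (hn : n ≤ N) :
    Run d (slotsP L) s (2 * N) fun s' => Frame 19 s s' ∧ ∀ z < N, s'.N 19 z = 1 ∧
      ∃ i < n, s'.X 19 (L * z) = s.X 2 (σ + i) ∧ Slot (fun i => s.R 2 (σ + i)) W N z i := by
  have hn0 : 0 < n := by
    rcases Nat.eq_zero_or_pos n with rfl | h
    · simp at hW; linarith
    · exact h
  have hN0 : (0 : ℝ) < N := by exact_mod_cast hN1
  refine Run.wp_seq hd (by omega) ?_
  simp only [wp_setn]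
  refine Run.wp_seq hd (by omega) ?_
  simp only [wp_setn]
  refine Run.wp_seq hd (by omega) ?_
  simp only [wp_setr]
  refine Run.loop hd (A := 2 * N) (B := 1) (by omega) le_rfl (fun t => Frame 19 s t ∧ t.N 31 0 ≤ N ∧
    t.N 30 0 < n ∧ t.R 30 0 = ∑ j ∈ range (t.N 30 0 + 1), s.R 2 (σ + j) ∧
    (∑ j ∈ range (t.N 30 0), s.R 2 (σ + j)) * N ≤ t.N 31 0 * W ∧ ∀ z < t.N 31 0, t.N 19 z = 1 ∧
      ∃ i < n, t.X 19 (L * z) = s.X 2 (σ + i) ∧ Slot (fun i => s.R 2 (σ + i)) W N z i)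
    (fun t => (N - t.N 31 0) + (n - t.N 30 0)) ?_ ?_ (by omega) ?_ ?_
  · simp [hσ, hn0]
  · simp; omega
  · rintro t ⟨hF, h1, h2, h3, h4, h5⟩ hb
    simp [hF.n, hN] at hb
    refine Run.of_wp hd le_rfl ?_
    simp only [wp_cond, wp_seq, wp_setn, wp_setr, wp_setv]
    simp [hF, hF.n, hF.r, hF.x, hN, hσ, hWr, -not_le]
    refine ⟨fun h => ?_, fun h => ?_⟩
    · have h6 : t.N 30 0 + 1 < n := by
        by_contra hcon
        have h7 : t.N 30 0 + 1 = n := by omega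
        rw [h3, h7, hW] at h
        have h8 : (t.N 31 0 : ℝ) < N := by exact_mod_cast hb
        nlinarith
      refine ⟨⟨h1, h6, ?_, ?_, h5⟩, by omega⟩
      · rw [Finset.sum_range_succ _ (t.N 30 0 + 1), h3]
      · rw [← h3]; exact h
    · refine ⟨⟨hb, h2, h3, ?_, fun z hz => ⟨fun h' => (h5 z (by omega)).1, ?_⟩⟩, by omega⟩
      · have : (0 : ℝ) ≤ W := hW0.le
        nlinarith
      · rcases (Nat.lt_succ_iff_lt_or_eq.1 (Nat.lt_succ_of_le hz)) with h6 | rfl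
        · obtain ⟨i, hi, h7, h8⟩ := (h5 z h6).2
          refine ⟨i, hi, ?_, h8⟩
          rw [if_neg (by intro h9; rcases h9 with h9 | h9 <;> omega), h7]
        · refine ⟨t.N 30 0, h2, by simp, h4, ?_⟩
          rw [← h3]
          exact not_le.1 h
  · rintro t ⟨hF, h1, h2, h3, h4, h5⟩ hb
    simp [hF.n, hN] at hb
    refine ⟨hF, fun z hz => h5 z (by omega)⟩

/-- The centres of the block that starts at `na 6 0` and has `na 7 0` points. -/
def baseP (L : ℕ) : Cmd := paramsP L ;; slotsP L ;; roundsP L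

/-- The centres of a block are close to every ball that contains a large fraction of its weight. -/
theorem baseP_run (hd : 1 ≤ d) {L n b q σ : ℕ} {W ρ : ℝ} (hL : 1 ≤ L) (hσ : s.N 6 0 = σ)
    (hn : s.N 7 0 = n) (hb : Nat.size (L * n) = b) (hq : 2 * (bigC L * (b * b)) = q)
    (hρ : s.R 3 0 = ρ) (hρ0 : 0 ≤ ρ) (hWr : s.R 7 0 = W) (hw : ∀ i, 0 ≤ s.R 2 i)
    (hW : ∑ i ∈ range n, s.R 2 (σ + i) = W) (hW0 : 0 < W) :
    Run d (baseP L) s (L * n * q ^ 11) fun s' => Frame 10 s s' ∧ s'.N 19 0 ≤ L ∧ ∀ x : V,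
      3 / L * W ≤ bw (fun i => s.X 2 (σ + i)) (fun i => s.R 2 (σ + i)) n x ρ →
        ∃ a < s'.N 19 0, ‖s'.X 19 a - x‖ ≤ acc L ρ 1 * 8 := by
  have hn0 : 1 ≤ n := by
    rcases Nat.eq_zero_or_pos n with rfl | h
    · simp at hW; linarith
    · exact h
  have hLn : 1 ≤ L * n := Nat.mul_pos hL hn0
  have hq1 : 2 ≤ q := by
    have hb1 : 0 < b := by rw [← hb]; exact Nat.size_pos.2 hLn
    have : 0 < bigC L * (b * b) := Nat.mul_pos (bigC_pos L) (Nat.mul_pos hb1 hb1)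
    omega
  have hpow : ∀ i, i ≤ 11 → q ^ i ≤ L * n * q ^ 11 := fun i h =>
    (Nat.pow_le_pow_right (by omega) h).trans (Nat.le_mul_of_pos_left _ hLn)
  refine Run.then (paramsP_run hd hL hn hn0 hb hq (hρ ▸ hρ0)) (hpow 3 (by norm_num)) ?_
  rintro s1 ⟨hF1, p, m, T, hpar, hprime, hpq, hNT, hmp, hN, hNp⟩
  rw [hρ] at hpar
  have hN1 : 1 ≤ p ^ m := hLn.trans hN
  have hr2 : s1.R 2 = s.R 2 := hF1.r_fun (by omega)
  have hx2 : s1.X 2 = s.X 2 := hF1.x_fun (by omega)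
  refine Run.then (slotsP_run hd (L := L) (σ := σ) (W := W) (n := n) hL hpar.N_eq hN1
    (by rw [hF1.n _ (by omega), hσ]) (by rw [hF1.r _ (by omega), hWr])
    (by rw [hr2]; exact hW) hW0 ((Nat.le_mul_of_pos_left _ hL).trans hN)) ?_ ?_
  · calc 2 * p ^ m ≤ q * (q * (L * n)) :=
          Nat.mul_le_mul hq1 (hNp.trans (Nat.mul_le_mul_right _ hpq))
      _ = L * n * q ^ 2 := by ring
      _ ≤ _ := by gcongr <;> omega
  rintro s2 ⟨hF2, hslot⟩
  refine (roundsP_run hd (hpar.frame (by omega) hF2) hprime hNT hmp fun z hz => (hslot z hz).1).mono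
    ?_ ?_
  · calc p * (p ^ m * p ^ 9) ≤ q * (q * (L * n) * q ^ 9) := by
          gcongr
          exact hNp.trans (Nat.mul_le_mul_right _ hpq)
      _ = L * n * q ^ 11 := by ring
  rintro s3 ⟨hF3, hlen, hnear⟩
  refine ⟨(hF1.trans (hF2.mono (by omega))).trans (hF3.mono (by omega)), hlen, fun x hx => ?_⟩
  refine hnear x (card_slots_ge (x := fun i => s.X 2 (σ + i)) (fun i => hw _) hW hW0 hL hN (fun z hz => ?_) hx)
  obtain ⟨i, hi, h1, h2⟩ := (hslot z hz).2
  rw [hx2] at h1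
  rw [hr2] at h2
  exact ⟨i, hi, h1, h2⟩

end Slots

/-! ### One stage: replacing blocks of points by their centres -/

section Stage

open Finset
open scoped Classical

/-- Appends the centres of a block to the new points. The weight of every point of the block is
added to the weight of some centre in its vicinity, if there is one. -/
def emitP (L : ℕ) : Cmd :=
  setr 43 0 (rn (.lit (8 * 100 ^ L + 1)) * ra 3 0) ;;
  forC 40 (na 19 0) (setv 5 (na 5 0 + na 40 0) (va 19 (na 40 0)) ;;
    setr 5 (na 5 0 + na 40 0) (rn 0)) ;;
  forC 40 (na 7 0) (
    setn 42 0 (na 19 0) ;;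
    forC 41 (na 19 0) (.cond (.realLE (ds 2 (na 6 0 + na 40 0) 19 (na 41 0)) (ra 43 0))
      (setn 42 0 (na 41 0)) .skip) ;;
    .cond (.natLT (na 42 0) (na 19 0)) (setr 5 (na 5 0 + na 42 0)
      (ra 5 (na 5 0 + na 42 0) + ra 2 (na 6 0 + na 40 0))) .skip) ;;
  setn 5 0 (na 5 0 + na 19 0)

/-- Treats one block. A block of weight `0` is discarded. -/
def blockP (L : ℕ) : Cmd :=
  setn 7 0 (na 2 0 - na 6 0) ;; .cond (.natLT (na 4 0) (na 7 0)) (setn 7 0 (na 4 0)) .skip ;;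
  setr 7 0 (rn 0) ;; forC 8 (na 7 0) (setr 7 0 (ra 7 0 + ra 2 (na 6 0 + na 8 0))) ;;
  .cond (.realLE (ra 7 0) (rn 0)) .skip (baseP L ;; emitP L) ;;
  setn 6 0 (na 6 0 + na 7 0)

/-- Treats all blocks, and replaces the points by the new ones. -/
def stageP (L : ℕ) : Cmd :=
  setn 5 0 0 ;; setn 6 0 0 ;; .loop (.natLT (na 6 0) (na 2 0)) (blockP L) ;;
  forC 8 (na 5 0) (setv 2 (na 8 0) (va 5 (na 8 0)) ;; setr 2 (na 8 0) (ra 5 (na 8 0))) ;;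
  setn 2 0 (na 5 0) ;; setr 3 0 (rn (.lit (8 * 100 ^ L + 2)) * ra 3 0)

variable {V : Type u} [NormedAddCommGroup V]

theorem bw_add (x : ℕ → V) (w : ℕ → ℝ) (m n : ℕ) (p : V) (ρ : ℝ) :
    bw x w (m + n) p ρ = bw x w m p ρ + bw (fun i => x (m + i)) (fun i => w (m + i)) n p ρ :=
  Finset.sum_range_add _ _ _

theorem bw_congr {x x' : ℕ → V} {w w' : ℕ → ℝ} {n : ℕ} (hx : ∀ i < n, x i = x' i)
    (hw : ∀ i < n, w i = w' i) (p : V) (ρ : ℝ) : bw x w n p ρ = bw x' w' n p ρ :=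
  Finset.sum_congr rfl fun i hi => by
    rw [hx i (Finset.mem_range.1 hi), hw i (Finset.mem_range.1 hi)]

theorem bw_le_sum {x : ℕ → V} {w : ℕ → ℝ} {n : ℕ} (hw : ∀ i < n, 0 ≤ w i) (p : V) (ρ : ℝ) :
    bw x w n p ρ ≤ ∑ i ∈ range n, w i :=
  Finset.sum_le_sum fun i hi => by
    split_ifs
    · exact le_rfl
    · exact hw i (Finset.mem_range.1 hi)

theorem bw_nonneg {x : ℕ → V} {w : ℕ → ℝ} {n : ℕ} (hw : ∀ i < n, 0 ≤ w i) (p : V) (ρ : ℝ) :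
    0 ≤ bw x w n p ρ :=
  Finset.sum_nonneg fun i hi => by
    split_ifs
    · exact hw i (Finset.mem_range.1 hi)
    · exact le_rfl

theorem bw_update {x : ℕ → V} {w : ℕ → ℝ} {n i0 : ℕ} (hi : i0 < n) (v : ℝ) (p : V) (ρ : ℝ) :
    bw x (fun i => if i = i0 then w i0 + v else w i) n p ρ =
      bw x w n p ρ + if ‖x i0 - p‖ ≤ ρ then v else 0 := by
  have h1 : ∀ i ∈ range n, (if ‖x i - p‖ ≤ ρ then (if i = i0 then w i0 + v else w i) else 0) =
      (if ‖x i - p‖ ≤ ρ then w i else 0) + if i = i0 then (if ‖x i0 - p‖ ≤ ρ then v else 0) else 0 := by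
    intro i _
    by_cases h : i = i0
    · subst h
      by_cases h2 : ‖x i - p‖ ≤ ρ <;> simp [h2]
    · by_cases h2 : ‖x i - p‖ ≤ ρ <;> simp [h, h2]
  rw [bw, Finset.sum_congr rfl h1, Finset.sum_add_distrib, Finset.sum_ite_eq', bw,
    if_pos (Finset.mem_range.2 hi)]

theorem sum_update {w : ℕ → ℝ} {n i0 : ℕ} (hi : i0 < n) (v : ℝ) :
    ∑ i ∈ range n, (if i = i0 then w i0 + v else w i) = ∑ i ∈ range n, w i + v := by
  have h1 : ∀ i ∈ range n, (if i = i0 then w i0 + v else w i) = w i + if i = i0 then v else 0 := by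
    intro i _
    by_cases h : i = i0
    · subst h; simp
    · simp [h]
  rw [Finset.sum_congr rfl h1, Finset.sum_add_distrib, Finset.sum_ite_eq',
    if_pos (Finset.mem_range.2 hi)]

variable [NormedSpace ℝ V] {d : ℕ} {s : State V}

/-- Every point of a ball around `p` is close to the centre near `p`, so it is assigned to a centre
within the distance `(8 * 100 ^ L + 1) * ρ`, which belongs to the enlarged ball. -/
theorem emitP_run (hd : 1 ≤ d) {L n c o σ : ℕ} {ρ : ℝ} (hL : 1 ≤ L) (hn1 : 1 ≤ n) (hc : c ≤ L)
    (hcr : s.N 19 0 = c) (hn : s.N 7 0 = n) (hσ : s.N 6 0 = σ) (ho : s.N 5 0 = o)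
    (hρ : s.R 3 0 = ρ) (hw : ∀ i, 0 ≤ s.R 2 i) :
    Run d (emitP L) s (n * L) fun s' => Frame 5 s s' ∧ s'.N 6 0 = σ ∧ s'.N 7 0 = n ∧
      s'.N 5 0 = o + c ∧ (∀ i < o, s'.X 5 i = s.X 5 i ∧ s'.R 5 i = s.R 5 i) ∧
      (∀ i < c, 0 ≤ s'.R 5 (o + i)) ∧
      ∑ i ∈ range c, s'.R 5 (o + i) ≤ ∑ i ∈ range n, s.R 2 (σ + i) ∧
      ∀ p : V, (∃ a < c, ‖s.X 19 a - p‖ ≤ 8 * 100 ^ L * ρ) →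
        bw (fun i => s.X 2 (σ + i)) (fun i => s.R 2 (σ + i)) n p ρ ≤
          bw (fun i => s'.X 5 (o + i)) (fun i => s'.R 5 (o + i)) c p ((8 * 100 ^ L + 2) * ρ) := by
  have hnL : 1 ≤ n * L := Nat.mul_pos hn1 hL
  have hLn : L ≤ n * L := Nat.le_mul_of_pos_left _ hn1
  refine Run.wp_seq hd hnL ?_
  simp only [wp_setr]
  refine Run.then (B' := L) (P := fun t => Frame 5 s t ∧ t.R 43 0 = (8 * 100 ^ L + 1) * ρ ∧
    t.N 5 0 = o ∧ t.N 6 0 = σ ∧ t.N 7 0 = n ∧ t.N 19 0 = c ∧ t.X 19 = s.X 19 ∧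
    (∀ i < o, t.X 5 i = s.X 5 i ∧ t.R 5 i = s.R 5 i) ∧
    (∀ i < c, t.X 5 (o + i) = s.X 19 i ∧ t.R 5 (o + i) = 0)) ?_ hLn ?_
  · refine Run.forC hd c hL le_rfl hc (by omega) (fun j t => Frame 5 s t ∧
      t.R 43 0 = (8 * 100 ^ L + 1) * ρ ∧ t.N 5 0 = o ∧ t.N 6 0 = σ ∧ t.N 7 0 = n ∧ t.N 19 0 = c ∧
      t.X 19 = s.X 19 ∧ (∀ i < o, t.X 5 i = s.X 5 i ∧ t.R 5 i = s.R 5 i) ∧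
      (∀ i < j, t.X 5 (o + i) = s.X 19 i ∧ t.R 5 (o + i) = 0) ∧ t.N 40 0 = j) ?_ ?_ ?_ ?_
    · simp [hρ, hcr, hn, hσ, ho]
    · rintro j t hj ⟨hF, h1, h2, h3, h4, h5, h6, h7, h8, h9⟩
      simp [h9, h5]
    · rintro j t hj ⟨hF, h1, h2, h3, h4, h5, h6, h7, h8, h9⟩
      refine Run.of_wp hd le_rfl ?_
      simp [hF, h1, h2, h3, h4, h5, h6, h9]
      refine ⟨fun i hi => ?_, fun i hi => ?_⟩
      · rw [if_neg (by omega), if_neg (by omega)]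
        exact h7 i hi
      · split_ifs with h
        · simp [h]
        · exact ⟨(h8 i (by omega)).1, fun _ => (h8 i (by omega)).2⟩
    · rintro t ⟨hF, h1, h2, h3, h4, h5, h6, h7, h8, h9⟩
      exact ⟨hF, h1, h2, h3, h4, h5, h6, h7, h8⟩
  rintro s1 ⟨hF1, h1, h2, h3, h4, h5, h6, h7, h8⟩
  refine Run.then (B' := n * L) (P := fun t => Frame 5 s t ∧
    t.N 5 0 = o ∧ t.N 6 0 = σ ∧ t.N 7 0 = n ∧ t.N 19 0 = c ∧
    (∀ i < o, t.X 5 i = s.X 5 i ∧ t.R 5 i = s.R 5 i) ∧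
    (∀ i < c, t.X 5 (o + i) = s.X 19 i) ∧ (∀ i < c, 0 ≤ t.R 5 (o + i)) ∧
    ∑ i ∈ range c, t.R 5 (o + i) ≤ ∑ i ∈ range n, s.R 2 (σ + i) ∧
      ∀ p : V, (∃ a < c, ‖s.X 19 a - p‖ ≤ 8 * 100 ^ L * ρ) →
        bw (fun i => s.X 2 (σ + i)) (fun i => s.R 2 (σ + i)) n p ρ ≤
          bw (s.X 19) (fun i => t.R 5 (o + i)) c p ((8 * 100 ^ L + 2) * ρ)) ?_ le_rfl ?_
  · refine Run.forC hd n hn1 hL le_rfl le_rfl (fun j t => Frame 5 s t ∧ t.R 43 0 = (8 * 100 ^ L + 1) * ρ ∧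
      t.N 5 0 = o ∧ t.N 6 0 = σ ∧ t.N 7 0 = n ∧ t.N 19 0 = c ∧ t.X 19 = s.X 19 ∧
      (∀ i < o, t.X 5 i = s.X 5 i ∧ t.R 5 i = s.R 5 i) ∧
      (∀ i < c, t.X 5 (o + i) = s.X 19 i) ∧ t.N 40 0 = j ∧ (∀ i < c, 0 ≤ t.R 5 (o + i)) ∧
      ∑ i ∈ range c, t.R 5 (o + i) ≤ ∑ i ∈ range j, s.R 2 (σ + i) ∧
      ∀ p : V, (∃ a < c, ‖s.X 19 a - p‖ ≤ 8 * 100 ^ L * ρ) →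
        bw (fun i => s.X 2 (σ + i)) (fun i => s.R 2 (σ + i)) j p ρ ≤
          bw (s.X 19) (fun i => t.R 5 (o + i)) c p ((8 * 100 ^ L + 2) * ρ)) ?_ ?_ ?_ ?_
    · simp [hF1, h1, h2, h3, h4, h5, h6]
      refine ⟨h7, fun i hi => (h8 i hi).1, fun i hi => (h8 i hi).2.ge, ?_, fun p a ha hap => ?_⟩
      · exact (Finset.sum_eq_zero fun i hi => (h8 i (Finset.mem_range.1 hi)).2).le
      · refine le_trans (by simp [bw]) (bw_nonneg (fun i hi => (h8 i hi).2.ge) _ _)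
    · rintro j t hj ⟨hF, h1, h2, h3, h4, h5, h6, h7, h8, h9, -⟩
      simp [h9, h4]
    · rintro j t hj ⟨hF, h1, h2, h3, h4, h5, h6, h7, h8, h9, h10, h11, h12⟩
      refine Run.wp_seq hd hL ?_
      simp only [wp_setn]
      refine Run.then (B' := L) (P := fun u => Frame 41 t u ∧
        (u.N 42 0 < c → ‖s.X 2 (σ + j) - s.X 19 (u.N 42 0)‖ ≤ (8 * 100 ^ L + 1) * ρ) ∧
        (c ≤ u.N 42 0 → ∀ i < c, ¬ ‖s.X 2 (σ + j) - s.X 19 i‖ ≤ (8 * 100 ^ L + 1) * ρ) ∧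
        u.R 43 0 = (8 * 100 ^ L + 1) * ρ) ?_ le_rfl ?_
      · refine Run.forC hd c hL le_rfl hc (by omega) (fun i u => Frame 41 t u ∧ u.N 41 0 = i ∧
          (u.N 42 0 < c → ‖s.X 2 (σ + j) - s.X 19 (u.N 42 0)‖ ≤ (8 * 100 ^ L + 1) * ρ) ∧
          (c ≤ u.N 42 0 → ∀ i' < i, ¬ ‖s.X 2 (σ + j) - s.X 19 i'‖ ≤ (8 * 100 ^ L + 1) * ρ) ∧
          u.R 43 0 = (8 * 100 ^ L + 1) * ρ) ?_ ?_ ?_ ?_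
        · simp [h1, h5]
        · rintro i u hi ⟨hF', h13, -⟩
          simp [h13, hF'.n, h5]
        · rintro i u hi ⟨hF', h13, h14, h15, h16⟩
          refine Run.of_wp hd le_rfl ?_
          simp only [wp_cond, wp_setn, wp_skip]
          simp [hF', h13, h16, hF'.n, hF'.x, hF.x, h3, h9, h6, -not_le]
          refine ⟨fun h => ⟨fun _ => h, fun h' => by omega⟩, fun h => ⟨h14, fun h' i' hi' => ?_⟩⟩
          rcases Nat.lt_succ_iff_lt_or_eq.1 (Nat.lt_succ_of_le hi') with h17 | rfl
          · exact h15 h' i' h17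
          · exact h
        · rintro u ⟨hF', h13, h14, h15, h16⟩
          exact ⟨hF', h14, h15, h16⟩
      · rintro u ⟨hF', h13, h14, h15⟩
        refine Run.of_wp hd hL ?_
        have hx19 : u.X 19 = s.X 19 := by rw [hF'.x_fun (by omega), h6]
        simp only [wp_cond, wp_setr, wp_skip]
        simp [hF.trans (hF'.mono (by omega)), h15, hF'.n, hF'.x, hF'.r, hF.r, h2, h3, h4, h5, hx19,
          h9]
        have hwj : 0 ≤ s.R 2 (σ + j) := hw _
        refine ⟨fun h => ⟨fun i hi => ?_, h8, fun i hi => ?_, ?_, fun p a ha hap => ?_⟩,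
          fun h => ⟨h7, h8, h10, ?_, fun p a ha hap => ?_⟩⟩
        · rw [if_neg (by omega)]
          exact h7 i hi
        · split_ifs
          · exact add_nonneg (h10 _ h) hwj
          · exact h10 i hi
        · rw [sum_update (w := fun i => t.R 5 (o + i)) h, Finset.sum_range_succ]
          linarith
        · rw [bw_update (w := fun i => t.R 5 (o + i)) h, bw, Finset.sum_range_succ, ← bw]
          have h17 := h12 p ⟨a, ha, hap⟩
          refine add_le_add h17 ?_
          split_ifs with h18 h19 h19
          · exact le_rfl
          · exfalso
            apply h19
            have h20 := h13 h
            have h21 := norm_sub_le_norm_sub_add_norm_sub (s.X 19 (u.N 42 0)) (s.X 2 (σ + j)) p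
            rw [norm_sub_rev] at h20
            linarith
          · exact hwj
          · exact le_rfl
        · rw [Finset.sum_range_succ]
          linarith
        · rw [bw, Finset.sum_range_succ, ← bw, if_neg, add_zero]
          · exact h12 p ⟨a, ha, hap⟩
          · intro h18
            refine h14 h a ha ?_
            have h21 := norm_sub_le_norm_sub_add_norm_sub (s.X 2 (σ + j)) p (s.X 19 a)
            rw [norm_sub_rev p] at h21
            linarith
    · rintro t ⟨hF, h1, h2, h3, h4, h5, h6, h7, h8, h9, h10, h11, h12⟩
      exact ⟨hF, h2, h3, h4, h5, h7, h8, h10, h11, h12⟩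
  · rintro t ⟨hF, h2, h3, h4, h5, h7, h8, h10, h11, h12⟩
    refine Run.of_wp hd hnL ?_
    simp [hF, h2, h3, h4, h5]
    refine ⟨h7, h10, h11, fun p a ha hap => (h12 p ⟨a, ha, hap⟩).trans_eq ?_⟩
    exact bw_congr (fun i hi => (h8 i hi).symm) (fun i hi => rfl) _ _

/-- A ball that contains less than the fraction `3 / L` of the block may lose all of its points. -/
theorem blockP_run (hd : 1 ≤ d) {L cnt B o σ n : ℕ} {ρ : ℝ} (hL : 1 ≤ L) (hB : 1 ≤ B)
    (hcnt : s.N 2 0 = cnt) (hBB : s.N 4 0 = B) (hσ : s.N 6 0 = σ) (hσc : σ < cnt)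
    (ho : s.N 5 0 = o) (hρ : s.R 3 0 = ρ) (hρ0 : 0 ≤ ρ) (hw : ∀ i, 0 ≤ s.R 2 i)
    (hn : min B (cnt - σ) = n) :
    Run d (blockP L) s (L * B * (2 * (bigC L * (Nat.size (L * B) * Nat.size (L * B)))) ^ 11)
      fun s' => Frame 5 s s' ∧ s'.N 6 0 = σ + n ∧ ∃ c ≤ L, s'.N 5 0 = o + c ∧
      (∀ i < o, s'.X 5 i = s.X 5 i ∧ s'.R 5 i = s.R 5 i) ∧
      (∀ i < c, 0 ≤ s'.R 5 (o + i)) ∧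
      ∑ i ∈ range c, s'.R 5 (o + i) ≤ ∑ i ∈ range n, s.R 2 (σ + i) ∧
      ∀ p : V, bw (fun i => s.X 2 (σ + i)) (fun i => s.R 2 (σ + i)) n p ρ ≤
          bw (fun i => s'.X 5 (o + i)) (fun i => s'.R 5 (o + i)) c p ((8 * 100 ^ L + 2) * ρ) +
          3 / L * ∑ i ∈ range n, s.R 2 (σ + i) := by
  have hn1 : 1 ≤ n := by omega
  have hnB : n ≤ B := by omega
  have hsz : 1 ≤ Nat.size (L * n) := Nat.size_pos.2 (Nat.mul_pos hL hn1)
  have hC := bigC_pos L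
  set Q := 2 * (bigC L * (Nat.size (L * B) * Nat.size (L * B))) with hQ
  have hsz2 : Nat.size (L * n) ≤ Nat.size (L * B) := Nat.size_le_size (Nat.mul_le_mul_left _ hnB)
  have hQ1 : 1 ≤ Q := by
    have : 0 < bigC L * (Nat.size (L * B) * Nat.size (L * B)) :=
      Nat.mul_pos hC (Nat.mul_pos (by omega) (by omega))
    omega
  have hQ11 : 1 ≤ Q ^ 11 := Nat.one_le_pow _ _ hQ1
  have hLB : 1 ≤ L * B := Nat.mul_pos hL hB
  have hT : 1 ≤ L * B * Q ^ 11 := Nat.mul_pos hLB hQ11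
  have hBT : B ≤ L * B * Q ^ 11 := by
    calc B ≤ L * B := Nat.le_mul_of_pos_left _ hL
      _ ≤ _ := Nat.le_mul_of_pos_right _ hQ11
  refine Run.then (B' := 1) (P := fun t => Frame 5 s t ∧ t.N 7 0 = cnt - σ ∧ t.N 6 0 = σ ∧
    t.N 5 0 = o ∧ t.X 5 = s.X 5 ∧ t.R 5 = s.R 5) ?_ hT ?_
  · refine Run.of_wp hd le_rfl ?_
    simp [hcnt, hσ, ho]
  rintro s1 ⟨hF1, h1, h2, h3, h4, h5⟩
  refine Run.then (B' := 1) (P := fun t => Frame 5 s t ∧ t.N 7 0 = n ∧ t.N 6 0 = σ ∧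
    t.N 5 0 = o ∧ t.X 5 = s.X 5 ∧ t.R 5 = s.R 5) ?_ hT ?_
  · refine Run.of_wp hd le_rfl ?_
    simp only [wp_cond, wp_setn, wp_skip]
    simp [hF1, hF1.n, h1, h2, h3, h4, h5, hBB]
    omega
  clear! s1
  rintro s1 ⟨hF1, h1, h2, h3, h4, h5⟩
  refine Run.wp_seq hd hT ?_
  simp only [wp_setr]
  refine Run.then (B' := B) (P := fun t => Frame 5 s t ∧ t.N 7 0 = n ∧ t.N 6 0 = σ ∧
    t.N 5 0 = o ∧ t.X 5 = s.X 5 ∧ t.R 5 = s.R 5 ∧ t.R 7 0 = ∑ i ∈ range n, s.R 2 (σ + i)) ?_ hBT ?_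
  · refine Run.forC hd n hB le_rfl hnB (by omega) (fun j t => Frame 5 s t ∧ t.N 7 0 = n ∧
      t.N 6 0 = σ ∧ t.N 5 0 = o ∧ t.X 5 = s.X 5 ∧ t.R 5 = s.R 5 ∧
      t.R 7 0 = ∑ i ∈ range j, s.R 2 (σ + i) ∧ t.N 8 0 = j) ?_ ?_ ?_ ?_
    · simp [hF1, h1, h2, h3, h4, h5]
    · rintro j t hj ⟨hF, h1, h2, h3, h4, h5, h6, h7⟩
      simp [h1, h7]
    · rintro j t hj ⟨hF, h1, h2, h3, h4, h5, h6, h7⟩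
      refine Run.of_wp hd le_rfl ?_
      simp [hF, h1, h2, h3, h4, h5, h6, h7, hF.r, Finset.sum_range_succ]
    · rintro t ⟨hF, h1, h2, h3, h4, h5, h6, h7⟩
      exact ⟨hF, h1, h2, h3, h4, h5, h6⟩
  clear! s1
  rintro s1 ⟨hF1, h1, h2, h3, h4, h5, h6⟩
  have hsum : 0 ≤ ∑ i ∈ range n, s.R 2 (σ + i) := Finset.sum_nonneg fun i _ => hw _
  have h3L : (0 : ℝ) ≤ 3 / L := by positivity
  refine Run.then (B' := L * B * Q ^ 11) (P := fun t => Frame 5 s t ∧ t.N 6 0 = σ ∧ t.N 7 0 = n ∧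
      ∃ c ≤ L, t.N 5 0 = o + c ∧
      (∀ i < o, t.X 5 i = s.X 5 i ∧ t.R 5 i = s.R 5 i) ∧
      (∀ i < c, 0 ≤ t.R 5 (o + i)) ∧
      ∑ i ∈ range c, t.R 5 (o + i) ≤ ∑ i ∈ range n, s.R 2 (σ + i) ∧
      ∀ p : V, bw (fun i => s.X 2 (σ + i)) (fun i => s.R 2 (σ + i)) n p ρ ≤
          bw (fun i => t.X 5 (o + i)) (fun i => t.R 5 (o + i)) c p ((8 * 100 ^ L + 2) * ρ) +
          3 / L * ∑ i ∈ range n, s.R 2 (σ + i)) ?_ le_rfl ?_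
  · refine Run.cond hd hT (fun hb => ?_) fun hb => ?_
    · refine Run.of_wp hd hT ?_
      simp [h6] at hb
      refine ⟨hF1, h2, h1, 0, Nat.zero_le _, h3, fun i _ => ⟨by rw [h4], by rw [h5]⟩,
        fun i hi => absurd hi (Nat.not_lt_zero _), by simpa using hsum, fun p => ?_⟩
      refine (bw_le_sum (fun i _ => hw _) _ _).trans (hb.trans ?_)
      refine add_nonneg (by simp [bw]) (mul_nonneg h3L hsum)
    · simp [h6] at hb
      have hx2 : s1.X 2 = s.X 2 := hF1.x_fun (by omega)
      have hr2 : s1.R 2 = s.R 2 := hF1.r_fun (by omega)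
      refine Run.then (baseP_run hd hL h2 h1 rfl rfl ((hF1.r 3 (by omega) 0).trans hρ) hρ0 h6
        (fun i => by rw [hr2]; exact hw i) (by rw [hr2]) hb) ?_ ?_
      · rw [hQ]
        gcongr
      rintro s2 ⟨hF2, h7, h8⟩
      have hF12 := hF1.trans (hF2.mono (show 5 ≤ 10 by omega))
      have hx5 : s2.X 5 = s.X 5 := by rw [hF2.x_fun (by omega), h4]
      have hr5 : s2.R 5 = s.R 5 := by rw [hF2.r_fun (by omega), h5]
      have hx2' : s2.X 2 = s.X 2 := hF12.x_fun (by omega)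
      have hr2' : s2.R 2 = s.R 2 := hF12.r_fun (by omega)
      refine (emitP_run hd hL hn1 h7 rfl ((hF2.n 7 (by omega) 0).trans h1)
        ((hF2.n 6 (by omega) 0).trans h2) ((hF2.n 5 (by omega) 0).trans h3)
        ((hF12.r 3 (by omega) 0).trans hρ) (fun i => by rw [hr2']; exact hw i)).mono ?_ ?_
      · calc n * L ≤ L * B := by rw [mul_comm]; gcongr
          _ ≤ _ := Nat.le_mul_of_pos_right _ hQ11
      rintro t ⟨hF3, h9, h10, h11, h12, h13, h14, h15⟩
      rw [hr2'] at h14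
      rw [hx2', hr2'] at h15
      rw [hx5, hr5] at h12
      refine ⟨hF12.trans hF3, h9, h10, _, h7, h11, h12, h13, h14, fun p => ?_⟩
      by_cases hp : 3 / L * ∑ i ∈ range n, s.R 2 (σ + i) ≤
          bw (fun i => s.X 2 (σ + i)) (fun i => s.R 2 (σ + i)) n p ρ
      · rw [hx2, hr2] at h8
        obtain ⟨a, ha, ha'⟩ := h8 p hp
        have h16 := h15 p ⟨a, ha, ha'.trans_eq (by rw [acc, Nat.add_sub_cancel]; ring)⟩
        exact h16.trans (le_add_of_nonneg_right (mul_nonneg h3L hsum))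
      · exact (not_le.1 hp).le.trans (le_add_of_nonneg_left (bw_nonneg h13 _ _))
  clear! s1
  rintro t ⟨hF, h1, h2, c, h3, h4, h5, h6, h7, h8⟩
  refine Run.of_wp hd hT ?_
  simp [hF, h1, h2]
  exact ⟨c, h3, h4, h5, h6, h7, h8⟩

/-- A stage loses at most the fraction `3 / L` of the total weight. -/
theorem stageP_run (hd : 1 ≤ d) {L cnt B : ℕ} {ρ : ℝ} (hL : 1 ≤ L) (hB : 1 ≤ B)
    (hcnt : s.N 2 0 = cnt) (hBB : s.N 4 0 = B) (hρ : s.R 3 0 = ρ) (hρ0 : 0 ≤ ρ)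
    (hw : ∀ i, 0 ≤ s.R 2 i) :
    Run d (stageP L) s ((cnt / B + 1) *
        (L * B * (2 * (bigC L * (Nat.size (L * B) * Nat.size (L * B)))) ^ 11))
      fun s' => Frame 2 s s' ∧ (∀ i, 0 ≤ s'.R 2 i) ∧ s'.R 3 0 = (8 * 100 ^ L + 2) * ρ ∧
        s'.N 2 0 ≤ L * (cnt / B + 1) ∧
        ∑ i ∈ range (s'.N 2 0), s'.R 2 i ≤ ∑ i ∈ range cnt, s.R 2 i ∧
        ∀ p : V, bw (s.X 2) (s.R 2) cnt p ρ ≤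
          bw (s'.X 2) (s'.R 2) (s'.N 2 0) p ((8 * 100 ^ L + 2) * ρ) +
            3 / L * ∑ i ∈ range cnt, s.R 2 i := by
  have hsz : 1 ≤ Nat.size (L * B) := Nat.size_pos.2 (Nat.mul_pos hL hB)
  have hC := bigC_pos L
  set Q := 2 * (bigC L * (Nat.size (L * B) * Nat.size (L * B))) with hQ
  have hQ11 : 1 ≤ Q ^ 11 := by
    refine Nat.one_le_pow _ _ ?_
    have : 0 < bigC L * (Nat.size (L * B) * Nat.size (L * B)) :=
      Nat.mul_pos hC (Nat.mul_pos (by omega) (by omega))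
    omega
  have hT0 : L ≤ L * B * Q ^ 11 := by
    calc L ≤ L * B := Nat.le_mul_of_pos_right _ hB
      _ ≤ _ := Nat.le_mul_of_pos_right _ hQ11
  set T := L * B * Q ^ 11 with hTdef
  have hT : 1 ≤ T := hL.trans hT0
  have hA : 1 ≤ (cnt / B + 1) * T := Nat.mul_pos (Nat.succ_pos _) hT
  refine Run.wp_seq hd hA ?_
  simp only [wp_setn]
  refine Run.wp_seq hd hA ?_
  simp only [wp_setn]
  refine Run.then (B' := (cnt / B + 1) * T) (P := fun t => Frame 5 s t ∧ ∃ out, t.N 5 0 = out ∧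
      out ≤ L * (cnt / B + 1) ∧
      (∀ i < out, 0 ≤ t.R 5 i) ∧ ∑ i ∈ range out, t.R 5 i ≤ ∑ i ∈ range cnt, s.R 2 i ∧
      ∀ p : V, bw (s.X 2) (s.R 2) cnt p ρ ≤ bw (t.X 5) (t.R 5) out p ((8 * 100 ^ L + 2) * ρ) +
        3 / L * ∑ i ∈ range cnt, s.R 2 i) ?_ le_rfl ?_
  · refine Run.loop hd (A := cnt / B + 1) (B := T) (Nat.succ_pos _) hT (fun t => Frame 5 s t ∧
      ∃ σ out j, t.N 6 0 = σ ∧ t.N 5 0 = out ∧ σ ≤ cnt ∧ out ≤ j * L ∧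
      (σ = j * B ∨ σ = cnt ∧ j ≤ cnt / B + 1) ∧
      (∀ i < out, 0 ≤ t.R 5 i) ∧ ∑ i ∈ range out, t.R 5 i ≤ ∑ i ∈ range σ, s.R 2 i ∧
      ∀ p : V, bw (s.X 2) (s.R 2) σ p ρ ≤ bw (t.X 5) (t.R 5) out p ((8 * 100 ^ L + 2) * ρ) +
        3 / L * ∑ i ∈ range σ, s.R 2 i) (fun t => (cnt - t.N 6 0 + (B - 1)) / B) ?_ ?_ le_rfl ?_ ?_
    · refine ⟨by simp, 0, 0, 0, by simp, by simp, by simp, by simp, by simp, by simp, by simp, ?_⟩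
      simp [bw]
    · simp only [State.N_setN, NExp.eval_zero, and_self, if_true]
      calc (cnt - 0 + (B - 1)) / B ≤ (cnt + B) / B := Nat.div_le_div_right (by omega)
        _ = cnt / B + 1 := Nat.add_div_right _ hB
    · rintro t ⟨hF, σ, o, j, h1, h2, h3, h4, h5, h6, h7, h8⟩ hb
      have hx2 : t.X 2 = s.X 2 := hF.x_fun (by omega)
      have hr2 : t.R 2 = s.R 2 := hF.r_fun (by omega)
      simp [h1, hF.n, hcnt] at hb
      have key := blockP_run (s := t) hd hL hB ((hF.n 2 (by omega) 0).trans hcnt)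
        ((hF.n 4 (by omega) 0).trans hBB) h1 hb h2 ((hF.r 3 (by omega) 0).trans hρ) hρ0
        (fun i => by rw [hr2]; exact hw i) rfl
      refine key.mono le_rfl ?_
      rintro u ⟨hF', h9, c, h10, h11, h12, h13, h14, h15⟩
      rw [hr2] at h14
      rw [hx2, hr2] at h15
      have hj : ¬ (σ = cnt ∧ j ≤ cnt / B + 1) := fun h => by omega
      have hσ : σ = j * B := by tauto
      refine ⟨⟨hF.trans hF', _, o + c, j + 1, h9, h11, by omega, ?_, ?_, ?_, ?_, fun p => ?_⟩, ?_⟩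
      · rw [add_mul, one_mul]; omega
      · rcases le_total B (cnt - σ) with h | h
        · left; rw [min_eq_left h, hσ]; ring
        · right
          refine ⟨by omega, ?_⟩
          have : j ≤ cnt / B := by
            rw [Nat.le_div_iff_mul_le hB]; omega
          omega
      · intro i hi
        by_cases hi' : i < o
        · rw [(h12 i hi').2]; exact h6 i hi'
        · have := h13 (i - o) (by omega)
          rwa [show o + (i - o) = i by omega] at this
      · rw [Finset.sum_range_add, Finset.sum_range_add]
        refine add_le_add ?_ h14
        rw [Finset.sum_congr rfl fun i hi => (h12 i (Finset.mem_range.1 hi)).2]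
        exact h7
      · rw [bw_add, bw_add, Finset.sum_range_add, mul_add, bw_congr (fun i hi => (h12 i hi).1)
          (fun i hi => (h12 i hi).2)]
        linarith [h8 p, h15 p]
      · rw [h9, h1]
        rcases le_total B (cnt - σ) with h | h
        · rw [min_eq_left h, show cnt - σ + (B - 1) = cnt - (σ + B) + (B - 1) + B by omega,
            Nat.add_div_right _ hB]
          omega
        · rw [min_eq_right h, show cnt - (σ + (cnt - σ)) + (B - 1) = B - 1 by omega,
            Nat.div_eq_of_lt (by omega)]
          exact Nat.div_pos (by omega) hB
    · rintro t ⟨hF, σ, o, j, h1, h2, h3, h4, h5, h6, h7, h8⟩ hb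
      simp [h1, hF.n, hcnt] at hb
      obtain rfl : σ = cnt := by omega
      refine ⟨hF, o, h2, ?_, h6, h7, h8⟩
      have hj : j ≤ σ / B + 1 := by
        rcases h5 with h | h
        · have : σ / B = j := by rw [h]; exact Nat.mul_div_cancel _ hB
          omega
        · exact h.2
      rw [mul_comm]
      rw [mul_comm] at h4
      exact (h4.trans (Nat.mul_le_mul_left _ hj)).trans_eq (mul_comm _ _)
  rintro s1 ⟨hF1, o, h1, h2, h3, h4, h5⟩
  have hoT : o ≤ (cnt / B + 1) * T := h2.trans (by rw [mul_comm]; gcongr)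
  refine Run.then (B' := (cnt / B + 1) * T) (P := fun t => Frame 2 s t ∧ t.N 5 0 = o ∧
      t.R 3 0 = ρ ∧ (∀ i, 0 ≤ t.R 2 i) ∧ ∀ i < o, t.X 2 i = s1.X 5 i ∧ t.R 2 i = s1.R 5 i)
    ?_ le_rfl ?_
  · refine Run.forC hd o hA le_rfl hoT (by omega) (fun j t => Frame 2 s t ∧ t.N 5 0 = o ∧
      t.R 3 0 = ρ ∧ (∀ i, 0 ≤ t.R 2 i) ∧ (∀ i < j, t.X 2 i = s1.X 5 i ∧ t.R 2 i = s1.R 5 i) ∧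
      t.X 5 = s1.X 5 ∧ t.R 5 = s1.R 5 ∧ t.N 8 0 = j) ?_ ?_ ?_ ?_
    · simp [hF1.mono (show 2 ≤ 5 by omega), h1, hF1.r, hρ, hw]
    · rintro j t hj ⟨hF, h6, h7, h8, h9, h10, h11, h12⟩
      simp [h6, h12]
    · rintro j t hj ⟨hF, h6, h7, h8, h9, h10, h11, h12⟩
      refine Run.of_wp hd le_rfl ?_
      simp [hF, h6, h7, h10, h11, h12]
      refine ⟨fun i => ?_, fun i hi => ?_⟩
      · split_ifs
        · exact h3 j hj
        · exact h8 i
      · split_ifs with h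
        · rw [h]; exact ⟨rfl, rfl⟩
        · exact h9 i (by omega)
    · rintro t ⟨hF, h6, h7, h8, h9, -⟩
      exact ⟨hF, h6, h7, h8, h9⟩
  rintro t ⟨hF, h6, h7, h8, h9⟩
  refine Run.of_wp hd hA ?_
  simp [hF, h6, h7, h8, h2]
  refine ⟨?_, fun p => ?_⟩
  · rw [Finset.sum_congr rfl fun i hi => (h9 i (Finset.mem_range.1 hi)).2]
    exact h4
  · rw [bw_congr (fun i hi => (h9 i hi).1) (fun i hi => (h9 i hi).2)]
    exact h5 p

end Stage

/-! ### Iterated logarithms -/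

section Iter

/-- Polynomials in the logarithm are sublinear. -/
theorem size_pow_le {D n : ℕ} (hD : 1 ≤ D) (hn : 1 ≤ n) : Nat.size n ^ D ≤ 2 * D ^ D * n := by
  have h1 : ∀ x : ℕ, x ^ D ≤ D ^ D * 2 ^ x := by
    intro x
    calc x ^ D ≤ (D * 2 ^ (x / D)) ^ D := by
          refine Nat.pow_le_pow_left ?_ D
          have h2 : x / D < 2 ^ (x / D) := Nat.lt_two_pow_self
          calc x ≤ D * (x / D + 1) := (Nat.lt_mul_div_succ x hD).le
            _ ≤ _ := Nat.mul_le_mul_left _ h2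
      _ = D ^ D * 2 ^ (x / D * D) := by rw [mul_pow, pow_mul]
      _ ≤ _ := by gcongr; exacts [by norm_num, Nat.div_mul_le_self _ _]
  have h2 : 2 ^ (Nat.size n - 1) ≤ n := by
    refine Nat.lt_size.1 ?_
    have := Nat.size_pos.2 hn
    omega
  have h3 : 2 ^ Nat.size n = 2 * 2 ^ (Nat.size n - 1) := by
    rw [← pow_succ', Nat.sub_add_cancel (Nat.size_pos.2 hn)]
  calc _ ≤ D ^ D * 2 ^ Nat.size n := h1 _
    _ = 2 * D ^ D * 2 ^ (Nat.size n - 1) := by rw [h3]; ring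
    _ ≤ _ := by gcongr

theorem size_le_log {n : ℕ} (hn : 1 ≤ n) : (Nat.size n : ℝ) ≤ 3 * max 1 (Real.log n) := by
  have h2 : 2 ^ (Nat.size n - 1) ≤ n := by
    refine Nat.lt_size.1 ?_
    have := Nat.size_pos.2 hn
    omega
  have h3 : ((Nat.size n - 1 : ℕ) : ℝ) * Real.log 2 ≤ Real.log n := by
    rw [← Real.log_pow]
    exact Real.log_le_log (by positivity) (by exact_mod_cast h2)
  rw [Nat.cast_sub (Nat.size_pos.2 hn)] at h3
  have h4 := Real.log_two_gt_d9
  have h5 := le_max_left 1 (Real.log n)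
  have h6 := le_max_right 1 (Real.log n)
  have h7 : (1 : ℝ) ≤ Nat.size n := by exact_mod_cast Nat.size_pos.2 hn
  push_cast at h3
  nlinarith

/-- The iterated binary length. -/
def sz (i n : ℕ) : ℕ := Nat.size^[i] n

theorem sz_succ (i n : ℕ) : sz (i + 1) n = Nat.size (sz i n) := Function.iterate_succ_apply' _ _ _

theorem sz_pos (i : ℕ) {n : ℕ} (hn : 1 ≤ n) : 1 ≤ sz i n := by
  induction i with
  | zero => exact hn
  | succ i ih => rw [sz_succ]; exact Nat.size_pos.2 ih

theorem size_le_self (n : ℕ) : Nat.size n ≤ n := Nat.size_le.2 Nat.lt_two_pow_self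

theorem sz_le (i n : ℕ) : sz i n ≤ n := by
  induction i with
  | zero => exact le_rfl
  | succ i ih => rw [sz_succ]; exact (size_le_self _).trans ih

theorem sz_succ_le (i n : ℕ) : sz (i + 1) n ≤ Nat.size n := by
  rw [sz_succ]; exact Nat.size_le_size (sz_le i n)

theorem one_le_iterLog (k : ℕ) (x : ℝ) : 1 ≤ iterLog k x := by
  cases k <;> exact le_max_left _ _

theorem exists_sz_le_iterLog (k : ℕ) :
    ∃ c : ℝ, 1 ≤ c ∧ ∀ n : ℕ, 1 ≤ n → (sz k n : ℝ) ≤ c * iterLog k n := by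
  induction k with
  | zero => exact ⟨1, le_rfl, fun n _ => by simp [sz, iterLog]⟩
  | succ k ih =>
    obtain ⟨c, hc, h⟩ := ih
    have hlc := Real.log_nonneg hc
    refine ⟨3 * (1 + Real.log c), by linarith, fun n hn => ?_⟩
    have h1 : (1 : ℝ) ≤ sz k n := by exact_mod_cast sz_pos k hn
    have h2 := one_le_iterLog k n
    have h3 : Real.log (sz k n) ≤ Real.log c + Real.log (iterLog k n) := by
      rw [← Real.log_mul (by linarith) (by linarith)]
      exact Real.log_le_log (by linarith) (h n hn)
    rw [sz_succ]
    refine (size_le_log (sz_pos k hn)).trans ?_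
    rw [mul_assoc, iterLog]
    have h5 := le_max_left 1 (Real.log (iterLog k n))
    have h6 := le_max_right 1 (Real.log (iterLog k n))
    refine mul_le_mul_of_nonneg_left (max_le ?_ ?_) (by norm_num) <;> nlinarith

/-- The running time in terms of the iterated logarithm. -/
theorem exists_sz_pow_le_iterLog (k : ℕ) :
    ∃ c : ℝ, 1 ≤ c ∧ ∀ n : ℕ, 1 ≤ n → (sz (k + 1) n : ℝ) ^ 22 ≤ c * iterLog k n := by
  obtain ⟨c, hc, h⟩ := exists_sz_le_iterLog k
  refine ⟨((2 * 22 ^ 22 : ℕ) : ℝ) * c, ?_, fun n hn => ?_⟩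
  · push_cast; nlinarith
  · have h1 : Nat.size (sz k n) ^ 22 ≤ 2 * 22 ^ 22 * sz k n :=
      size_pow_le (by norm_num) (sz_pos k hn)
    rw [sz_succ, mul_assoc]
    refine le_trans ?_ (mul_le_mul_of_nonneg_left (h n hn) (Nat.cast_nonneg _))
    exact_mod_cast h1

end Iter

/-! ### All stages -/

section Stages

open Finset
open scoped Classical

/-- The `i`-fold iterated binary length of the number of points. -/
def iterSizeP : ℕ → Cmd
  | 0 => setn 7 0 (.cell (.lit 0))
  | i + 1 => iterSizeP i ;; sizeP 8 (na 7 0) ;; setn 7 0 (na 8 0)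

/-- The block size: the least power of two which is at least the number of points, or the
`22 * ℓ`-th power of two, if this is smaller, where `ℓ` is the content of `na 7 0`. The exponent is
that of the logarithm in the running time of `baseP`. -/
def blockSizeP : Cmd :=
  setn 4 0 1 ;; forC 8 (mulE 22 (na 7 0))
    (.cond (.natLT (na 4 0) (na 2 0)) (setn 4 0 (na 4 0 + na 4 0)) .skip)

/-- The stages `i, i - 1, …, 1`; the block size of stage `i` is polynomial in the `i - 1`-fold
iterated logarithm of the number of points. -/
def stagesP (L : ℕ) : ℕ → Cmd
  | 0 => .skip
  | i + 1 => iterSizeP (i + 1) ;; blockSizeP ;; stageP L ;; stagesP L i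

variable {V : Type u} [NormedAddCommGroup V] [NormedSpace ℝ V] {d : ℕ} {s : State V}

theorem iterSizeP_run (hd : 1 ≤ d) {n : ℕ} (hn : 1 ≤ n) (h0 : s.nat 0 = n) (i : ℕ) :
    Run d (iterSizeP i) s (2 * n) fun s' => Frame 7 s s' ∧ s'.N 7 0 = sz i n := by
  induction i with
  | zero =>
    refine Run.of_wp hd (by omega) ?_
    rw [iterSizeP]
    simp [NExp.eval, h0, sz]
  | succ i ih =>
    refine ih.then le_rfl ?_
    rintro s1 ⟨hF, h1⟩
    refine Run.then (sizeP_run hd 8 (na 7 0) (by simpa using h1)) ?_ ?_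
    · rw [← sz_succ]
      have := sz_le (i + 1) n
      omega
    · rintro s2 ⟨hF2, h2⟩
      refine Run.of_wp hd (by omega) ?_
      simp [hF.trans (hF2.mono (by omega)), h2, sz_succ]

theorem blockSizeP_run (hd : 1 ≤ d) {l cnt n : ℕ} (hn : 1 ≤ n) (hl : s.N 7 0 = l) (hln : l ≤ n)
    (hcnt : s.N 2 0 = cnt) :
    Run d blockSizeP s (22 * n) fun s' => Frame 4 s s' ∧ ∃ B, s'.N 4 0 = B ∧ 1 ≤ B ∧
      B ≤ 2 ^ (22 * l) ∧ B ≤ 2 * cnt + 1 ∧ (cnt ≤ B ∨ 2 ^ (22 * l) ≤ B) := by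
  refine Run.wp_seq hd (by omega) ?_
  simp only [wp_setn]
  refine Run.forC hd (22 * l) (A := 22 * n) (B := 1) (by omega) le_rfl (by omega) (by omega)
    (fun j t => Frame 4 s t ∧ t.N 7 0 = l ∧ t.N 8 0 = j ∧ ∃ B, t.N 4 0 = B ∧ 1 ≤ B ∧
      B ≤ 2 ^ j ∧ B ≤ 2 * cnt + 1 ∧ (cnt ≤ B ∨ 2 ^ j ≤ B)) ?_ ?_ ?_ ?_
  · simp [hl]
  · rintro j t hj ⟨hF, h1, h2, -⟩
    simp [h1, h2]
  · rintro j t hj ⟨hF, h1, h2, B, h3, h4, h5, h6, h7⟩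
    refine Run.of_wp hd le_rfl ?_
    simp only [wp_cond, wp_setn, wp_skip]
    simp [hF, h1, h2, h3, hF.n, hcnt, -not_lt, pow_succ]
    omega
  · rintro t ⟨hF, h1, h2, h⟩
    exact ⟨hF, h⟩

/-- The running time of a stage with `cnt` points, where `G` is the bound for the total running time
up to a constant. -/
theorem stage_time {L l A cnt B G z : ℕ} (hl : 1 ≤ l)
    (hBl : B ≤ 2 ^ (22 * l)) (hBc : B ≤ 2 * cnt + 1) (hA : cnt * l ^ 22 ≤ A * (G + l ^ 22))
    (hG : l ^ 22 ≤ z * G) :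
    (cnt / B + 1) * (L * B * (2 * (bigC L * (Nat.size (L * B) * Nat.size (L * B)))) ^ 11) ≤
      (L * (2 * bigC L) ^ 11 * (Nat.size L + 22) ^ 22 * ((3 * A + 1) * (1 + z))) * G := by
  have hb : Nat.size (L * B) ≤ (Nat.size L + 22) * l := by
    refine (Nat.size_le.2 (?_ : L * B < 2 ^ (Nat.size L + 22 * l))).trans ?_
    · rw [pow_add]
      exact Nat.mul_lt_mul_of_lt_of_le (Nat.lt_size_self L) hBl (Nat.two_pow_pos _)
    · rw [add_mul]
      gcongr
      exact Nat.le_mul_of_pos_right _ hl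
  have h1 : (cnt / B + 1) * B ≤ 3 * cnt + 1 := by
    have := Nat.div_mul_le_self cnt B
    rw [add_mul, one_mul]; omega
  have h2 : (3 * cnt + 1) * l ^ 22 ≤ (3 * A + 1) * (1 + z) * G := by
    calc (3 * cnt + 1) * l ^ 22 = 3 * (cnt * l ^ 22) + l ^ 22 := by ring
      _ ≤ 3 * (A * (G + l ^ 22)) + (G + l ^ 22) := by gcongr; exact Nat.le_add_left _ _
      _ = (3 * A + 1) * (G + l ^ 22) := by ring
      _ ≤ (3 * A + 1) * (G + z * G) := by gcongr
      _ = _ := by ring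
  calc _ = L * (2 * bigC L) ^ 11 * ((cnt / B + 1) * B * Nat.size (L * B) ^ 22) := by ring
    _ ≤ L * (2 * bigC L) ^ 11 * ((3 * cnt + 1) * ((Nat.size L + 22) * l) ^ 22) := by gcongr
    _ = L * (2 * bigC L) ^ 11 * (Nat.size L + 22) ^ 22 * ((3 * cnt + 1) * l ^ 22) := by ring
    _ ≤ L * (2 * bigC L) ^ 11 * (Nat.size L + 22) ^ 22 * ((3 * A + 1) * (1 + z) * G) := by gcongr
    _ = _ := by ring

/-- A stage reduces the number of points as required for the running time of the next one. -/
theorem stage_card {L l l' A cnt cnt' B G : ℕ} (hl : 1 ≤ l) (hG : 1 ≤ G)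
    (hl' : l' ^ 22 ≤ 2 ^ (22 * l)) (hBl : cnt ≤ B ∨ 2 ^ (22 * l) ≤ B)
    (hA : cnt * l ^ 22 ≤ A * (G + l ^ 22)) (hcnt' : cnt' ≤ L * (cnt / B + 1)) :
    cnt' * l' ^ 22 ≤ (L * (2 * A + 2)) * (G + l' ^ 22) := by
  have hx : 1 ≤ l ^ 22 := Nat.one_le_pow _ _ hl
  have h1 : cnt ≤ 2 * A * G := by
    have : cnt * l ^ 22 ≤ 2 * A * G * l ^ 22 := by
      refine hA.trans ?_
      calc A * (G + l ^ 22) ≤ A * (G * l ^ 22 + G * l ^ 22) := by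
            gcongr
            · exact Nat.le_mul_of_pos_right _ hx
            · exact Nat.le_mul_of_pos_left _ hG
        _ = _ := by ring
    exact Nat.le_of_mul_le_mul_right this hx
  have h2 : (cnt / B + 1) * l' ^ 22 ≤ cnt + 2 * l' ^ 22 := by
    rcases hBl with h | h
    · have : cnt / B ≤ 1 := Nat.div_le_of_le_mul (by omega)
      calc (cnt / B + 1) * l' ^ 22 ≤ 2 * l' ^ 22 := by gcongr; omega
        _ ≤ _ := Nat.le_add_left _ _
    · have h3 : cnt / B * l' ^ 22 ≤ cnt :=
        (Nat.mul_le_mul_left _ (hl'.trans h)).trans (Nat.div_mul_le_self _ _)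
      rw [add_mul]; omega
  calc cnt' * l' ^ 22 ≤ L * (cnt / B + 1) * l' ^ 22 := by gcongr
    _ = L * ((cnt / B + 1) * l' ^ 22) := by ring
    _ ≤ L * (2 * A * G + 2 * l' ^ 22) := by gcongr; omega
    _ ≤ L * ((2 * A + 2) * G + (2 * A + 2) * l' ^ 22) := by gcongr <;> omega
    _ = _ := by ring

/-- Each stage loses at most the fraction `3 / L` of the weight of a ball whose radius is enlarged
by a constant factor, and the number of points decreases such that the running times of all stages
are of the same order. -/
theorem stagesP_run {L : ℕ} (hL : 1 ≤ L) (i A : ℕ) : ∃ c A' : ℕ, ∀ {V : Type u}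
    [NormedAddCommGroup V] [NormedSpace ℝ V] {d n G cnt : ℕ} {ρ : ℝ} {s : State V}, 1 ≤ d →
    1 ≤ n → n ≤ G → s.nat 0 = n → s.N 2 0 = cnt → s.R 3 0 = ρ → 0 ≤ ρ → (∀ i, 0 ≤ s.R 2 i) →
    cnt * sz i n ^ 22 ≤ A * (G + sz i n ^ 22) →
    Run d (stagesP L i) s (c * G) fun s' => Frame 2 s s' ∧
      s'.N 2 0 * n ^ 22 ≤ A' * (G + n ^ 22) ∧ (∀ i, 0 ≤ s'.R 2 i) ∧
      ∑ i ∈ range (s'.N 2 0), s'.R 2 i ≤ ∑ i ∈ range cnt, s.R 2 i ∧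
      ∀ p : V, bw (s.X 2) (s.R 2) cnt p ρ ≤
        bw (s'.X 2) (s'.R 2) (s'.N 2 0) p ((8 * 100 ^ L + 2) ^ i * ρ) +
          i * (3 / L * ∑ i ∈ range cnt, s.R 2 i) := by
  obtain ⟨z, hz⟩ : ∃ z, ∀ n, 1 ≤ n → Nat.size n ^ 22 ≤ z * n :=
    ⟨_, fun n hn => size_pow_le (by norm_num) hn⟩
  induction i generalizing A with
  | zero =>
    refine ⟨1, A, fun {V _ _ d n G cnt ρ s} hd hn hG h0 h1 h2 h3 h4 h5 => ?_⟩
    refine Run.of_wp hd (by omega) ?_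
    simp only [sz, Function.iterate_zero, id] at h5
    rw [stagesP]
    simp [h1, h4, h5]
  | succ i ih =>
    obtain ⟨c, A', h⟩ := ih (L * (2 * A + 2))
    refine ⟨c + 22 + L * (2 * bigC L) ^ 11 * (Nat.size L + 22) ^ 22 *
      ((3 * A + 1) * (1 + z)), A',
      fun {V _ _ d n G cnt ρ s} hd hn hG h0 h1 h2 h3 h4 h5 => ?_⟩
    have hl := sz_pos (i + 1) hn
    have hl2 : sz (i + 1) n ^ 22 ≤ z * G :=
      (Nat.pow_le_pow_left (sz_succ_le i n) 22).trans
        ((hz n hn).trans (Nat.mul_le_mul_left _ hG))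
    have hl3 : sz i n ^ 22 ≤ 2 ^ (22 * sz (i + 1) n) := by
      rw [sz_succ, mul_comm, pow_mul]
      exact Nat.pow_le_pow_left (Nat.lt_size_self _).le 22
    generalize hK : L * (2 * bigC L) ^ 11 * (Nat.size L + 22) ^ 22 *
      ((3 * A + 1) * (1 + z)) = K
    refine Run.then (iterSizeP_run hd hn h0 (i + 1)) (by rw [add_mul, add_mul]; omega) ?_
    rintro s1 ⟨hF1, h6⟩
    refine Run.then (blockSizeP_run hd hn h6 (sz_le _ _) ((hF1.n 2 (by omega) 0).trans h1))
      (by rw [add_mul, add_mul]; omega) ?_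
    rintro s2 ⟨hF2, B, h7, h8, h9, h10, h11⟩
    have hF12 := (hF1.mono (show 4 ≤ 7 by omega)).trans hF2
    have hr : s2.R 2 = s.R 2 := hF12.r_fun (by omega)
    have hx : s2.X 2 = s.X 2 := hF12.x_fun (by omega)
    refine Run.then (stageP_run hd hL h8 ((hF12.n 2 (by omega) 0).trans h1) h7
      ((hF12.r 3 (by omega) 0).trans h2) h3 (fun i => by rw [hr]; exact h4 i)) ?_ ?_
    · refine (stage_time hl h9 h10 h5 hl2).trans ?_
      rw [hK, add_mul]
      exact Nat.le_add_left _ _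
    rintro s3 ⟨hF3, h12, h13, h14, h15, h16⟩
    rw [hr] at h15
    rw [hr, hx] at h16
    have hF13 := (hF12.mono (show 2 ≤ 4 by omega)).trans hF3
    refine (h hd hn hG (hF13.n0.trans h0) rfl h13 (by positivity) h12
      (stage_card hl (hn.trans hG) hl3 h11 h5 h14)).mono ?_ ?_
    · rw [add_assoc, add_mul]
      exact Nat.le_add_right _ _
    rintro s4 ⟨hF4, h17, h18, h19, h20⟩
    refine ⟨hF13.trans hF4, h17, h18, h19.trans h15, fun p => ?_⟩
    have h21 := h20 p
    have h22 := h16 p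
    have h23 : (i : ℝ) * (3 / L * ∑ i ∈ range (s3.N 2 0), s3.R 2 i) ≤
        i * (3 / L * ∑ i ∈ range cnt, s.R 2 i) := by gcongr
    rw [pow_succ, mul_assoc]
    push_cast
    linarith

end Stages

/-! ### Input and output -/

section InOut

open Finset
open scoped Classical

/-- Moves the points and their weights to class `1`, in descending order, because the arrays of the
input overlap with the class. -/
def spreadP : Cmd :=
  forC 8 (.cell (.lit 0)) (
    setv 1 (.cell (.lit 0) - 1 - na 8 0) (.cell (.cell (.lit 0) - 1 - na 8 0)) ;;
    setr 1 (.cell (.lit 0) - 1 - na 8 0) (.cell (.cell (.lit 0) - 1 - na 8 0 + 2)))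

/-- The input of the first stage. -/
def loadP : Cmd :=
  forC 8 (.cell (.lit 0)) (setv 2 (na 8 0) (va 1 (na 8 0)) ;; setr 2 (na 8 0) (ra 1 (na 8 0))) ;;
  setn 2 0 (.cell (.lit 0)) ;; setr 3 0 (.cell (.lit 0))

/-- Chooses the remaining point whose ball with radius `D * r` has the largest weight. -/
def chooseP (D : ℕ) : Cmd :=
  setr 9 0 (rn 0) ;;
  forC 8 (na 2 0) (
    setr 7 0 (rn 0) ;;
    forC 9 (.cell (.lit 0)) (.cond (.realLE (ds 1 (na 9 0) 2 (na 8 0)) (rn (.lit D) * .cell (.lit 0)))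
      (setr 7 0 (ra 7 0 + ra 1 (na 9 0))) .skip) ;;
    .cond (.realLE (ra 9 0) (ra 7 0)) (setr 9 0 (ra 7 0) ;; .setVec (.lit 0) (va 2 (na 8 0))) .skip)

/-- The program for the weighted problem. -/
def weightedP (L J D : ℕ) : Cmd := spreadP ;; loadP ;; stagesP L J ;; chooseP D

/-- The program for the unweighted problem: all weights are set to `1`. -/
def unweightedP (L J D : ℕ) : Cmd :=
  forC 8 (.cell (.lit 0)) (.setReal (na 8 0 + 2) (rn 1)) ;; weightedP L J D

theorem adr_one (i : ℕ) : adr 1 i = 4 * i + 2 := by simp only [adr]; omega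

variable {V : Type u}

/-- The state after an assignment to the vector cell of the result. -/
def State.setOut (s : State V) (v : V) : State V :=
  { s with vec := Function.update s.vec 0 v }

section
variable (s : State V) (c c' i i' n j : ℕ) (r : ℝ) (v : V)
@[simp] theorem State.N_setOut : (s.setOut v).N c i = s.N c i := rfl
@[simp] theorem State.R_setOut : (s.setOut v).R c i = s.R c i := rfl
@[simp] theorem State.X_setOut : (s.setOut v).X c i = s.X c i := by
  simp [X, setOut, adr_ne_zero]
@[simp] theorem State.setOut_nat : (s.setOut v).nat = s.nat := rfl
@[simp] theorem State.setOut_real : (s.setOut v).real = s.real := rfl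
@[simp] theorem State.setOut_vec_zero : (s.setOut v).vec 0 = v := by simp [setOut]
theorem State.frame_setOut_self (k : ℕ) : Frame k s (s.setOut v) :=
  ⟨fun _ _ _ => rfl, fun _ _ _ => rfl, fun _ _ _ => X_setOut s _ _ v, rfl, rfl⟩
@[simp] theorem State.frame_setOut (k : ℕ) (s' : State V) :
    Frame k s (s'.setOut v) ↔ Frame k s s' := (frame_setOut_self s' v k).iff_of_frame
@[simp] theorem State.setN_vec : (s.setN c i n).vec = s.vec := rfl
@[simp] theorem State.setR_vec : (s.setR c i r).vec = s.vec := rfl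
theorem State.setX_vec : (s.setX c i v).vec j = if j = adr c i then v else s.vec j := by
  simp [setX, Function.update_apply]
theorem State.setR_real_apply : (s.setR c i r).real j = if j = adr c i then r else s.real j := by
  simp [setR, Function.update_apply]
end

@[simp] theorem NExp.eval_cell_zero (m : ℕ → ℕ) : NExp.eval m (.cell (.lit 0)) = m 0 := rfl

variable [NormedAddCommGroup V]

@[simp] theorem RExp.eval_cell (s : State V) (e : NExp) :
    RExp.eval s (.cell e) = s.real (e.eval s.nat) := rfl

variable [NormedSpace ℝ V] {d : ℕ} {s : State V}

@[simp] theorem VExp.eval_cell (s : State V) (e : NExp) :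
    VExp.eval s (.cell e) = s.vec (e.eval s.nat) := rfl

@[simp] theorem wp_setOut (e : VExp) (Q : State V → Prop) :
    wp (.setVec (.lit 0) e) s Q = Q (s.setOut (e.eval s)) := rfl

/-- The new place `4 * i + 2` of the point `i` is not the old place of a point before it. -/
theorem spreadP_run (hd : 1 ≤ d) {n : ℕ} (hn : 1 ≤ n) (h0 : s.nat 0 = n)
    (hw : ∀ i, 0 ≤ s.real i) : Run d spreadP s n fun s' => s'.nat 0 = n ∧ s'.real 0 = s.real 0 ∧
      (∀ i, 0 ≤ s'.real i) ∧ ∀ i < n, s'.X 1 i = s.vec i ∧ s'.R 1 i = s.real (i + 2) := by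
  refine Run.forC hd n hn le_rfl le_rfl (by omega) (fun j t => t.nat 0 = n ∧
    t.real 0 = s.real 0 ∧ t.N 8 0 = j ∧ (∀ i, 0 ≤ t.real i) ∧
    (∀ i < n - j, t.vec i = s.vec i ∧ t.real (i + 2) = s.real (i + 2)) ∧
    ∀ i < n, n - j ≤ i → t.X 1 i = s.vec i ∧ t.R 1 i = s.real (i + 2)) ?_ ?_ ?_ ?_
  · simp [h0, hw]
    intro i hi hi'; omega
  · rintro j t hj ⟨h1, h2, h3, h4, h5⟩
    simp [h1, h3]
  · rintro j t hj ⟨h1, h2, h3, h4, h5, h6⟩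
    refine Run.of_wp hd le_rfl ?_
    have h7 := h5 (n - 1 - j) (by omega)
    simp [h1, h2, h3]
    refine ⟨fun i => ?_, fun i hi => ?_, fun i hi hi' => ?_⟩
    · rw [State.setR_real_apply]
      split_ifs
      · exact h4 _
      · exact h4 _
    · rw [State.setX_vec, State.setR_real_apply, adr_one, if_neg (by omega)]
      refine ⟨(h5 i (by omega)).1, ?_⟩
      rw [if_neg (by omega)]
      exact (h5 i (by omega)).2
    · by_cases h : i = n - 1 - j
      · subst h
        simpa using h7
      · rw [if_neg h, if_neg h]
        exact h6 i hi (by omega)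
  · rintro t ⟨h1, h2, h3, h4, h5, h6⟩
    exact ⟨h1, h2, h4, fun i hi => h6 i hi (by omega)⟩

theorem loadP_run (hd : 1 ≤ d) {n : ℕ} (hn : 1 ≤ n) (h0 : s.nat 0 = n)
    (hw : ∀ i, 0 ≤ s.real i) : Run d loadP s n fun s' => Frame 2 s s' ∧ s'.N 2 0 = n ∧
      s'.R 3 0 = s.real 0 ∧ (∀ i, 0 ≤ s'.R 2 i) ∧
      ∀ i < n, s'.X 2 i = s.X 1 i ∧ s'.R 2 i = s.R 1 i := by
  refine Run.then (B' := n) (P := fun t => Frame 2 s t ∧ (∀ i, 0 ≤ t.R 2 i) ∧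
      ∀ i < n, t.X 2 i = s.X 1 i ∧ t.R 2 i = s.R 1 i) ?_ le_rfl ?_
  · refine Run.forC hd n hn le_rfl le_rfl (by omega) (fun j t => Frame 2 s t ∧ t.N 8 0 = j ∧
      (∀ i, 0 ≤ t.R 2 i) ∧ ∀ i < j, t.X 2 i = s.X 1 i ∧ t.R 2 i = s.R 1 i) ?_ ?_ ?_ ?_
    · simp
      exact fun i => hw _
    · rintro j t hj ⟨hF, h1, h2, h3⟩
      simp [h1, hF.n0, h0]
    · rintro j t hj ⟨hF, h1, h2, h3⟩
      refine Run.of_wp hd le_rfl ?_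
      simp [hF, h1, hF.x, hF.r]
      refine ⟨fun i => ?_, fun i hi => ?_⟩
      · split_ifs
        · exact hw _
        · exact h2 i
      · split_ifs with h
        · rw [h]; exact ⟨rfl, rfl⟩
        · exact h3 i (by omega)
    · rintro t ⟨hF, h1, h2, h3⟩
      exact ⟨hF, h2, h3⟩
  · rintro t ⟨hF, h1, h2⟩
    refine Run.of_wp hd hn ?_
    simp [hF, h1, hF.n0, hF.r0, h0]
    exact h2

theorem chooseP_run (hd : 1 ≤ d) {D n cnt M : ℕ} {r : ℝ} (hn : 1 ≤ n) (h0 : s.nat 0 = n)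
    (hr : s.real 0 = r) (hcnt : s.N 2 0 = cnt) (hM : cnt ≤ M) (hM1 : 1 ≤ M)
    (hw : ∀ i, 0 ≤ s.R 1 i) : Run d (chooseP D) s (M * n) fun s' =>
      ∀ i < cnt, bw (s.X 1) (s.R 1) n (s.X 2 i) (D * r) ≤
        bw (s.X 1) (s.R 1) n (s'.vec 0) (D * r) := by
  have hMn : 1 ≤ M * n := Nat.mul_pos hM1 hn
  refine Run.wp_seq hd hMn ?_
  simp only [wp_setr]
  refine Run.forC hd cnt hM1 hn hM le_rfl (fun j t => Frame 7 s t ∧ t.N 8 0 = j ∧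
    t.R 9 0 ≤ bw (s.X 1) (s.R 1) n (t.vec 0) (D * r) ∧
    ∀ i < j, bw (s.X 1) (s.R 1) n (s.X 2 i) (D * r) ≤ t.R 9 0) ?_ ?_ ?_ ?_
  · simp
    exact bw_nonneg (fun i _ => hw i) _ _
  · rintro j t hj ⟨hF, h1, -⟩
    simp [h1, hF.n, hcnt]
  · rintro j t hj ⟨hF, h1, h2, h3⟩
    refine Run.wp_seq hd hn ?_
    simp only [wp_setr]
    refine Run.then (B' := n) (P := fun u => Frame 7 s u ∧ u.N 8 0 = j ∧ u.R 9 0 = t.R 9 0 ∧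
      u.vec 0 = t.vec 0 ∧ u.R 7 0 = bw (s.X 1) (s.R 1) n (s.X 2 j) (D * r)) ?_ le_rfl ?_
    · refine Run.forC hd n hn le_rfl le_rfl (by omega) (fun i u => Frame 7 s u ∧ u.N 8 0 = j ∧
        u.R 9 0 = t.R 9 0 ∧ u.vec 0 = t.vec 0 ∧ u.N 9 0 = i ∧
        u.R 7 0 = bw (s.X 1) (s.R 1) i (s.X 2 j) (D * r)) ?_ ?_ ?_ ?_
      · simp [hF, h1, bw]
      · rintro i u hi ⟨hF', h4, h5, h6, h7, h8⟩
        simp [h7, hF'.n0, h0]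
      · rintro i u hi ⟨hF', h4, h5, h6, h7, h8⟩
        refine Run.of_wp hd le_rfl ?_
        simp only [wp_cond, wp_setr, wp_skip]
        simp [hF', h4, h5, h6, h7, h8, hF'.x, hF'.r, hF'.r0, hr, -not_le]
        refine ⟨fun h => ?_, fun h => ?_⟩
        · rw [bw, bw, Finset.sum_range_succ, if_pos h]
        · rw [bw, bw, Finset.sum_range_succ, if_neg h, add_zero]
      · rintro u ⟨hF', h4, h5, h6, h7, h8⟩
        exact ⟨hF', h4, h5, h6, h8⟩
    · rintro u ⟨hF', h4, h5, h6, h8⟩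
      refine Run.of_wp hd hn ?_
      simp only [wp_cond, wp_seq, wp_setr, wp_skip, wp_setOut]
      simp [hF', h4, h5, h6, h8, hF'.x]
      refine ⟨fun h i hi => ?_, fun h => ⟨h2, fun i hi => ?_⟩⟩
      · rcases hi.lt_or_eq with h9 | rfl
        · exact (h3 i h9).trans h
        · exact le_rfl
      · rcases hi.lt_or_eq with h9 | rfl
        · exact h3 i h9
        · exact h.le
  · rintro t ⟨hF, h1, h2, h3⟩ i hi
    exact (h3 i hi).trans h2

end InOut

/-! ### The result -/

section Result

open Finset
open scoped Classical

theorem bw_le_bw {V : Type u} [NormedAddCommGroup V] {x : ℕ → V} {w : ℕ → ℝ} {n : ℕ}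
    (hw : ∀ i < n, 0 ≤ w i) {p y : V} {ρ ρ' σ : ℝ} (h : ‖y - p‖ ≤ ρ') (hσ : ρ + ρ' ≤ σ) :
    bw x w n p ρ ≤ bw x w n y σ := by
  refine Finset.sum_le_sum fun i hi => ?_
  split_ifs with h1 h2 h2
  · exact le_rfl
  · exfalso
    apply h2
    have h3 := norm_sub_le_norm_sub_add_norm_sub (x i) p y
    rw [norm_sub_rev p y] at h3
    linarith
  · exact hw i (Finset.mem_range.1 hi)
  · exact le_rfl

theorem exists_of_bw_pos {V : Type u} [NormedAddCommGroup V] {x : ℕ → V} {w : ℕ → ℝ} {n : ℕ}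
    {p : V} {ρ : ℝ} (h : 0 < bw x w n p ρ) : ∃ i < n, ‖x i - p‖ ≤ ρ := by
  by_contra! hc
  refine h.ne' (Finset.sum_eq_zero fun i hi => if_neg ?_)
  exact not_le.2 (hc i (Finset.mem_range.1 hi))

theorem weightedP_run {α : ℝ} {L J : ℕ} (hL : 1 ≤ L) (hJ : 1 ≤ J)
    (hLJ : 3 * (J + 1) ≤ α * L) : ∃ c : ℕ, ∀ {V : Type u} [NormedAddCommGroup V]
    [NormedSpace ℝ V] {d n : ℕ} {r W : ℝ} {s : State V}, 1 ≤ d → 1 ≤ n → s.nat 0 = n →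
    s.real 0 = r → (∀ i, 0 ≤ s.real i) → ∑ i ∈ range n, s.real (i + 2) = W → 0 < W →
    Run d (weightedP L J ((8 * 100 ^ L + 2) ^ J + 1)) s (c * (n * sz J n ^ 22)) fun s' =>
      ∀ p : V, α * W ≤ bw s.vec (fun i => s.real (i + 2)) n p r →
        α * W ≤ bw s.vec (fun i => s.real (i + 2)) n (s'.vec 0)
          (((8 * 100 ^ L + 2) ^ J + 1 : ℕ) * r) := by
  obtain ⟨c, A, h⟩ := stagesP_run.{u} hL J 1
  obtain ⟨z, hz⟩ : ∃ z, ∀ n, 1 ≤ n → Nat.size n ^ 22 ≤ z * n :=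
    ⟨_, fun n hn => size_pow_le (by norm_num) hn⟩
  refine ⟨c + A * (z + 1) + 1, fun {V _ _ d n r W s} hd hn h0 h1 h2 h3 h4 => ?_⟩
  have hl : 1 ≤ sz J n ^ 22 := Nat.one_le_pow _ _ (sz_pos J hn)
  have hnG : n ≤ n * sz J n ^ 22 := Nat.le_mul_of_pos_right _ hl
  have hnG' : n ≤ (c + A * (z + 1) + 1) * (n * sz J n ^ 22) :=
    hnG.trans (Nat.le_mul_of_pos_left _ (by omega))
  have hl2 : sz J n ^ 22 ≤ z * n := by
    obtain ⟨j, rfl⟩ := Nat.exists_eq_add_of_le' hJ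
    exact (Nat.pow_le_pow_left (sz_succ_le j n) 22).trans (hz n hn)
  set G := n * sz J n ^ 22 with hG
  refine (spreadP_run hd hn h0 h2).then hnG' ?_
  rintro s1 ⟨a0, a1, a2, a3⟩
  refine (loadP_run hd hn a0 a2).then hnG' ?_
  rintro s2 ⟨hF2, b1, b2, b3, b4⟩
  rw [a1, h1] at b2
  have hr0 : 0 ≤ r := h1 ▸ h2 0
  refine (h hd hn hnG (hF2.n0.trans a0) b1 b2 hr0 b3 ?_).then ?_ ?_
  · rw [one_mul, ← hG]; exact Nat.le_add_right _ _
  · gcongr; omega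
  rintro s3 ⟨hF3, c1, c2, c3, c4⟩
  have hF13 := hF2.trans hF3
  have hx : s3.X 1 = s1.X 1 := hF13.x_fun (by omega)
  have hr : s3.R 1 = s1.R 1 := hF13.r_fun (by omega)
  -- The last stage has essentially one block: the number of remaining points is bounded.
  have hcnt : s3.N 2 0 ≤ A * (z + 1) := by
    have hn22 : 1 ≤ n ^ 22 := Nat.one_le_pow _ _ hn
    have h5 : G ≤ z * n ^ 22 := by
      calc G ≤ n * (z * n) := Nat.mul_le_mul_left _ hl2
        _ = z * n ^ 2 := by ring
        _ ≤ _ := Nat.mul_le_mul_left _ (Nat.pow_le_pow_right hn (by norm_num))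
    have h6 : s3.N 2 0 * n ^ 22 ≤ A * (z + 1) * n ^ 22 := by
      refine c1.trans ?_
      calc A * (G + n ^ 22) ≤ A * (z * n ^ 22 + n ^ 22) := by gcongr
        _ = _ := by ring
    exact Nat.le_of_mul_le_mul_right h6 hn22
  refine (chooseP_run hd hn (hF13.n0.trans a0) (hF13.r0.trans (a1.trans h1)) rfl
    (hcnt.trans (Nat.le_succ _)) (Nat.succ_pos _) (fun i => by rw [hr]; exact a2 _)).mono ?_ ?_
  · exact Nat.mul_le_mul (by omega) hnG
  rintro s4 h5 p hp
  rw [hx, hr] at h5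
  have hbw : ∀ (q : V) (ρ : ℝ), bw (s1.X 1) (s1.R 1) n q ρ =
      bw s.vec (fun i => s.real (i + 2)) n q ρ :=
    bw_congr (fun i hi => (a3 i hi).1) fun i hi => (a3 i hi).2
  have hbw2 : bw (s2.X 2) (s2.R 2) n p r = bw (s1.X 1) (s1.R 1) n p r :=
    bw_congr (fun i hi => (b4 i hi).1) (fun i hi => (b4 i hi).2) _ _
  have hsum : ∑ i ∈ range n, s2.R 2 i = W := by
    rw [← h3]
    refine Finset.sum_congr rfl fun i hi => ?_
    rw [(b4 i (Finset.mem_range.1 hi)).2, (a3 i (Finset.mem_range.1 hi)).2]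
  have h6 := c4 p
  rw [hbw2, hbw, hsum] at h6
  -- The stages lose less than the weight of the given ball.
  have h7 : J * (3 / L * W) < α * W := by
    have hL0 : (0 : ℝ) < L := by exact_mod_cast hL
    have : (J : ℝ) * (3 / L) < α := by
      rw [← mul_div_assoc, div_lt_iff₀ hL0]; linarith
    calc J * (3 / L * W) = J * (3 / L) * W := by ring
      _ < _ := mul_lt_mul_of_pos_right this h4
  obtain ⟨i, hi, hip⟩ := exists_of_bw_pos (by linarith :
    0 < bw (s3.X 2) (s3.R 2) (s3.N 2 0) p ((8 * 100 ^ L + 2) ^ J * r))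
  refine hp.trans ?_
  rw [← hbw, ← hbw]
  refine le_trans ?_ (h5 i hi)
  refine bw_le_bw (fun i _ => a2 _) hip (le_of_eq ?_)
  push_cast; ring

theorem unweightedP_run {α : ℝ} {L J : ℕ} (hL : 1 ≤ L) (hJ : 1 ≤ J)
    (hLJ : 3 * (J + 1) ≤ α * L) : ∃ c : ℕ, ∀ {V : Type u} [NormedAddCommGroup V]
    [NormedSpace ℝ V] {d n : ℕ} {r : ℝ} {s : State V}, 1 ≤ d → 1 ≤ n → s.nat 0 = n →
    s.real 0 = r → (∀ i, 0 ≤ s.real i) →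
    Run d (unweightedP L J ((8 * 100 ^ L + 2) ^ J + 1)) s (c * (n * sz J n ^ 22)) fun s' =>
      ∀ p : V, α * n ≤ bw s.vec (fun _ => 1) n p r →
        α * n ≤ bw s.vec (fun _ => 1) n (s'.vec 0) (((8 * 100 ^ L + 2) ^ J + 1 : ℕ) * r) := by
  obtain ⟨c, h⟩ := weightedP_run.{u} hL hJ hLJ
  refine ⟨c + 1, fun {V _ _ d n r s} hd hn h0 h1 h2 => ?_⟩
  have hl : 1 ≤ sz J n ^ 22 := Nat.one_le_pow _ _ (sz_pos J hn)
  have hnG : n ≤ n * sz J n ^ 22 := Nat.le_mul_of_pos_right _ hl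
  refine Run.then (B' := n) (P := fun t => t.nat 0 = n ∧ t.real 0 = r ∧ t.vec = s.vec ∧
    (∀ i, 0 ≤ t.real i) ∧ ∀ i < n, t.real (i + 2) = 1) ?_ ?_ ?_
  · refine Run.forC hd n hn le_rfl le_rfl (by omega) (fun j t => t.nat 0 = n ∧ t.real 0 = r ∧
      t.vec = s.vec ∧ (∀ i, 0 ≤ t.real i) ∧ t.N 8 0 = j ∧ ∀ i < j, t.real (i + 2) = 1) ?_ ?_ ?_ ?_
    · simp [h0, h1, h2]
    · rintro j t hj ⟨a1, a2, a3, a4, a5, a6⟩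
      simp [a1, a5]
    · rintro j t hj ⟨a1, a2, a3, a4, a5, a6⟩
      refine Run.of_wp hd le_rfl ?_
      simp only [wp, NExp.eval_add, na_eval, NExp.eval_zero, NExp.eval_two, a5, rn_eval,
        NExp.eval_one, Nat.cast_one]
      refine ⟨a5, by simpa using a1, by simpa [Function.update_apply] using a2, a3, fun i => ?_,
        by simp, fun i hi => ?_⟩
      · simp only [State.setN_real, Function.update_apply]
        split_ifs
        · exact zero_le_one
        · exact a4 i
      · simp only [State.setN_real, Function.update_apply]
        split_ifs with h3
        · rfl
        · exact a6 i (by omega)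
    · rintro t ⟨a1, a2, a3, a4, a5, a6⟩
      exact ⟨a1, a2, a3, a4, a6⟩
  · exact hnG.trans (Nat.le_mul_of_pos_left _ (Nat.succ_pos _))
  · rintro t ⟨a1, a2, a3, a4, a5⟩
    have hsum : ∑ i ∈ range n, t.real (i + 2) = n := by
      rw [Finset.sum_congr rfl fun i hi => a5 i (Finset.mem_range.1 hi)]; simp
    refine (h hd hn a1 a2 a4 hsum (by exact_mod_cast hn)).mono (by gcongr; omega) ?_
    intro s' h3 p hp
    have hbw := fun q ρ => bw_congr (x := t.vec) (x' := s.vec) (n := n) (fun i _ => by rw [a3])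
      a5 q ρ
    rw [← hbw] at hp ⊢
    exact h3 p hp

theorem bw_eq_ballWeight {V : Type u} [NormedAddCommGroup V] [NormedSpace ℝ V] {n : ℕ}
    {a : Fin n → V} {w : Fin n → ℝ} {x : ℕ → V} {w' : ℕ → ℝ} (hx : ∀ i : Fin n, x i = a i)
    (hw : ∀ i : Fin n, w' i = w i) (p : V) (ρ : ℝ) : bw x w' n p ρ = ballWeight a w p ρ := by
  rw [bw, Finset.sum_range, ballWeight, Finset.sum_filter]
  exact Finset.sum_congr rfl fun i _ => by rw [hx, hw]

theorem bw_eq_ballCount {V : Type u} [NormedAddCommGroup V] [NormedSpace ℝ V] {n : ℕ}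
    {a : Fin n → V} {x : ℕ → V} (hx : ∀ i : Fin n, x i = a i) (p : V) (ρ : ℝ) :
    bw x (fun _ => 1) n p ρ = ballCount a p ρ := by
  rw [bw_eq_ballWeight (w := fun _ => 1) hx fun _ => rfl, ballWeight, ballCount,
    Finset.sum_const, nsmul_eq_mul, mul_one]

/-- The running time bound of `Run` in the form used by `Solves`. -/
theorem Run.exists_exec {V : Type u} [NormedAddCommGroup V] [NormedSpace ℝ V] {d n J c : ℕ}
    {P : Cmd} {s : State V} {Q : State V → Prop} {C K T : ℝ}
    (h : Run d P s (c * (n * sz J n ^ 22)) Q) (hT : (sz J n : ℝ) ^ 22 ≤ C * T) (hT0 : 0 ≤ T)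
    (hK : kk P * c * C ≤ K) :
    ∃ (t : ℕ) (s' : State V), Exec d P s t s' ∧ (t : ℝ) ≤ K * (n * d * T) ∧ Q s' := by
  obtain ⟨t, s', h1, h2, h3⟩ := h
  refine ⟨t, s', h1, ?_, h3⟩
  calc (t : ℝ) ≤ ((kk P * (c * (n * sz J n ^ 22)) * d : ℕ) : ℝ) := by exact_mod_cast h2
    _ = kk P * c * (n * d) * (sz J n : ℝ) ^ 22 := by push_cast; ring
    _ ≤ kk P * c * (n * d) * (C * T) := by gcongr
    _ = kk P * c * C * (n * d * T) := by ring
    _ ≤ _ := by gcongr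

end Result

end VecRAM

open VecRAM in
theorem mainTheorem3 (α : ℝ) (hα : 0 < α) (hα' : α ≤ 1 / 2) (k : ℕ) :
    ∃ C K : ℝ, 1 ≤ C ∧ 0 < K ∧
      (∃ P : VecRAM.Cmd,
        VecRAM.Solves.{u} P α C (fun n d => K * (n * d * VecRAM.iterLog k n))) ∧
      (∃ P : VecRAM.Cmd,
        VecRAM.SolvesWeighted.{u} P α C (fun n d => K * (n * d * VecRAM.iterLog k n))) := by
  obtain ⟨L, hL⟩ := exists_nat_ge (3 * ((k + 1 : ℕ) + 1) / α)
  have hLJ : 3 * (((k + 1 : ℕ) : ℝ) + 1) ≤ α * L := by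
    rw [div_le_iff₀ hα] at hL; linarith
  have hL1 : 1 ≤ L := by
    rcases Nat.eq_zero_or_pos L with rfl | h
    · push_cast at hLJ
      have : (0 : ℝ) ≤ k := Nat.cast_nonneg k
      linarith
    · exact h
  have hJ : 1 ≤ k + 1 := Nat.succ_pos _
  obtain ⟨c, hc⟩ := unweightedP_run.{u} hL1 hJ hLJ
  obtain ⟨c', hc'⟩ := weightedP_run.{u} hL1 hJ hLJ
  obtain ⟨M, hM1, hM⟩ := exists_sz_pow_le_iterLog k
  have hM0 : 0 ≤ M := zero_le_one.trans hM1
  obtain ⟨D, hD⟩ : ∃ D : ℕ, (8 * 100 ^ L + 2) ^ (k + 1) + 1 = D := ⟨_, rfl⟩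
  have hD1 : (1 : ℝ) ≤ D := by
    rw [← hD]; exact_mod_cast Nat.le_add_left _ _
  rw [hD] at hc hc'
  obtain ⟨K, hK⟩ : ∃ K : ℝ,
    K = kk (unweightedP L (k + 1) D) * c * M + kk (weightedP L (k + 1) D) * c' * M + 1 := ⟨_, rfl⟩
  have hK1 : (0 : ℝ) ≤ kk (unweightedP L (k + 1) D) * c * M :=
    mul_nonneg (mul_nonneg (Nat.cast_nonneg _) (Nat.cast_nonneg _)) hM0
  have hK2 : (0 : ℝ) ≤ kk (weightedP L (k + 1) D) * c' * M :=
    mul_nonneg (mul_nonneg (Nat.cast_nonneg _) (Nat.cast_nonneg _)) hM0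
  refine ⟨D, K, hD1, by linarith, ⟨unweightedP L (k + 1) D, ?_⟩,
    ⟨weightedP L (k + 1) D, ?_⟩⟩
  · intro V _ _ d n hd hn a r hr
    have hpos : ∀ i, 0 ≤ (input α r a).real i := by
      intro i
      simp only [input]
      split_ifs <;> first | exact hr | exact hα.le | exact le_rfl
    obtain ⟨t, s', h1, h2, h3⟩ := (hc (s := input α r a) hd hn (by simp [input])
      (by simp [input] : _ = r) hpos).exists_exec (hM n hn)
      (zero_le_one.trans (one_le_iterLog k n)) (K := K) (by linarith)
    refine ⟨t, s', h1, h2, ?_⟩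
    rintro ⟨p, hp⟩
    have hx : ∀ i : Fin n, (input α r a).vec i = a i := fun i => by simp [input]
    rw [← bw_eq_ballCount hx] at hp ⊢
    exact h3 p hp
  · intro V _ _ d n hd hn a w r hw hW hr
    have hpos : ∀ i, 0 ≤ (weightedInput α r a w).real i := by
      intro i
      simp only [weightedInput]
      split_ifs <;> first | exact hr | exact hα.le | exact hw _ | exact le_rfl
    have hwt : ∀ i : Fin n, (weightedInput α r a w).real (i + 2) = w i := fun i => by
      simp [weightedInput]
    have hsum : ∑ i ∈ Finset.range n, (weightedInput α r a w).real (i + 2) = ∑ i, w i := by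
      rw [Finset.sum_range]
      exact Finset.sum_congr rfl fun i _ => hwt i
    obtain ⟨t, s', h1, h2, h3⟩ := (hc' (s := weightedInput α r a w) hd hn (by simp [weightedInput])
      (by simp [weightedInput] : _ = r) hpos hsum hW).exists_exec (hM n hn)
      (zero_le_one.trans (one_le_iterLog k n)) (K := K) (by linarith)
    refine ⟨t, s', h1, h2, ?_⟩
    rintro ⟨p, hp⟩
    have hx : ∀ i : Fin n, (weightedInput α r a w).vec i = a i := fun i => by simp [weightedInput]
    rw [← bw_eq_ballWeight (w' := fun i => (weightedInput α r a w).real (i + 2)) hx hwt] at hp ⊢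
    exact h3 p hp
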